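/- Let $M$ be a smooth finite-dimensional manifold, $S\subset M$ a smooth embedded submanifold of codimension $1$, $X$ a smooth vector field on $M$, and $\Delta:S\to M$ a smooth map, such that $S\cap\Delta(S)=\emptyset$ and $\overline S\cap\overline{\Delta(S)}$ has codimension at least $2$ (it is empty, or its Hausdorff dimension in charts is at most $\dim M-2$). For $t\ge 0$ let $\varphi^{\mathcal H}_t$ be the (partially defined) hybrid flow of $\mathcal H=(M,S,X,\Delta)$: the point $x$ follows the integral curve of $X$ as long as this curve does not meet $S$; when the curve meets $S$ at $y$, the state at that time is $y$, and immediately afterwards the motion restarts from $\Delta(y)$; $\varphi^{\mathcal H}_t(x)$ is defined if the integral curves involved exist long enough and only finitely many impacts occur before time $t$. Assume that $\mathcal H$ is smooth, i.e. (A.1) if $\varphi^{\mathcal H}_t(x)\in\overline S\setminus S$, then there is $\varepsilon>0$ such that for all $0<\delta<\varepsilon$ the point $\varphi^{\mathcal H}_{t+\delta}(x)$ is defined and not in $S$; (A.2) $T_xM=T_xS\oplus\mathbb R\,X(x)$ for all $x\in S$. For $x\in S$ let the augmented differential $\Delta_*^X:T_xM\to T_{\Delta(x)}M$ be the linear map with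 $\Delta_*^X u=\Delta_*u$ for $u\in T_xS$ and $\Delta_*^XX(x)=X(\Delta(x))$. Let $\alpha\in\Omega^m(M)$ be a smooth $m$-form, $m\ge0$. Then $(\varphi^{\mathcal H}_t)^*\alpha=\alpha$ for all $t\ge0$ if and only if both $$\mathcal L_X\alpha=0\quad\text{on } M$$ and $$\alpha_{\Delta(x)}\bigl(\Delta_*^Xv_1,\dots,\Delta_*^Xv_m\bigr)=\alpha_x(v_1,\dots,v_m)\quad\text{for all }x\in S,\ v_1,\dots,v_m\in T_xM.$$ Here $(\varphi^{\mathcal H}_t)^*\alpha=\alpha$ means that this equality of forms holds at every $x\in M\setminus S$ with $\varphi^{\mathcal H}_t(x)\notin S$ that has an open neighbourhood $U$ with $U\cap S=\emptyset$ on which $\varphi^{\mathcal H}_t$ is defined and smooth. -/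

import Mathlib

open Set Module
open scoped Manifold ContDiff ENNReal

noncomputable section

namespace Hybrid

section Forms

variable {E : Type*} [NormedAddCommGroup E] [NormedSpace ℝ E]
  {M : Type*} [TopologicalSpace M] [ChartedSpace E M]

/-- Differential forms of degree `m` on a manifold `M` without boundary modelled on `E`, not
necessarily smooth: an alternating `m`-form on each tangent space. -/
abbrev Form (E : Type*) [NormedAddCommGroup E] [NormedSpace ℝ E]
    (M : Type*) [TopologicalSpace M] [ChartedSpace E M] (m : ℕ) : Type _ :=
  ∀ x : M, TangentSpace 𝓘(ℝ, E) x [⋀^Fin m]→L[ℝ] ℝ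

/-- The expression of a form in the preferred chart at `x₀`, i.e. its pullback under the inverse
of that chart. It is meaningful on the target of the chart. -/
def Form.inChart {m : ℕ} (α : Form E M m) (x₀ : M) (y : E) : E [⋀^Fin m]→L[ℝ] ℝ :=
  (α ((extChartAt 𝓘(ℝ, E) x₀).symm y)).compContinuousLinearMap
    (mfderiv 𝓘(ℝ, E) 𝓘(ℝ, E) (extChartAt 𝓘(ℝ, E) x₀).symm y)

/-- A form is smooth if its expressions in charts are `C^∞`. -/
def Form.IsSmooth {m : ℕ} (α : Form E M m) : Prop :=
  ∀ x₀ : M, ContDiffOn ℝ ∞ (α.inChart x₀) (extChartAt 𝓘(ℝ, E) x₀).target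

/-- The Lie derivative, at the point `y` of the vector space `E`, of the form `η` along the vector
field `V`: `(L_V η)(v₁, …, v_m) = (D_V η)(v₁, …, v_m) + ∑ᵢ η(v₁, …, DV(vᵢ), …, v_m)`. -/
def flatLieDeriv {m : ℕ} (V : E → E) (η : E → E [⋀^Fin m]→L[ℝ] ℝ) (y : E) (v : Fin m → E) : ℝ :=
  fderiv ℝ η y (V y) v + ∑ i, η y (Function.update v i (fderiv ℝ V y (v i)))

/-- The Lie derivative `L_X α` of a form along a vector field on a manifold, at the point `x`,
computed in the preferred chart at `x`. -/
def lieDeriv {m : ℕ} (X : ∀ x : M, TangentSpace 𝓘(ℝ, E) x) (α : Form E M m) (x : M)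
    (v : Fin m → TangentSpace 𝓘(ℝ, E) x) : ℝ :=
  flatLieDeriv
    (VectorField.mpullback 𝓘(ℝ, E) 𝓘(ℝ, E) (extChartAt 𝓘(ℝ, E) x).symm X)
    (α.inChart x)
    (extChartAt 𝓘(ℝ, E) x x)
    (fun i => mfderiv 𝓘(ℝ, E) 𝓘(ℝ, E) (extChartAt 𝓘(ℝ, E) x) x (v i))

/-- A subset of a finite-dimensional manifold has codimension at least two: it is empty, or its
Hausdorff dimension, measured in charts, is at most `dim M - 2`. -/
def CodimGETwo (E : Type*) [NormedAddCommGroup E] [NormedSpace ℝ E]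
    {M : Type*} [TopologicalSpace M] [ChartedSpace E M] (Z : Set M) : Prop :=
  Z = ∅ ∨ ∀ x : M, dimH (chartAt E x '' (Z ∩ (chartAt E x).source)) + 2 ≤ (finrank ℝ E : ℝ≥0∞)

end Forms

/-- A hybrid dynamical system on the manifold `M`. The impact surface is the image of the smooth
embedding `emb : S → M` of a manifold `S` with `dim S + 1 = dim M`; the reset map is
`reset : S → M`. -/
structure HybridSystem (E : Type*) [NormedAddCommGroup E] [NormedSpace ℝ E]
    (M : Type*) [TopologicalSpace M] [ChartedSpace E M] [IsManifold 𝓘(ℝ, E) ∞ M]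
    (F : Type*) [NormedAddCommGroup F] [NormedSpace ℝ F]
    (S : Type*) [TopologicalSpace S] [ChartedSpace F S] where
  emb : S → M
  isSmoothEmbedding_emb : Manifold.IsSmoothEmbedding 𝓘(ℝ, F) 𝓘(ℝ, E) ∞ emb
  finrank_add_one : finrank ℝ F + 1 = finrank ℝ E
  field : ∀ x : M, TangentSpace 𝓘(ℝ, E) x
  contMDiff_field : ContMDiff 𝓘(ℝ, E) 𝓘(ℝ, E).tangent ∞
    (fun x => (⟨x, field x⟩ : TangentBundle 𝓘(ℝ, E) M))
  reset : S → M
  contMDiff_reset : ContMDiff 𝓘(ℝ, F) 𝓘(ℝ, E) ∞ reset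
  disjoint_range : Disjoint (range emb) (range reset)
  codim_closure_inter : CodimGETwo E (closure (range emb) ∩ closure (range reset))

section Systems

variable {E : Type*} [NormedAddCommGroup E] [NormedSpace ℝ E]
  {M : Type*} [TopologicalSpace M] [ChartedSpace E M] [IsManifold 𝓘(ℝ, E) ∞ M]
  {F : Type*} [NormedAddCommGroup F] [NormedSpace ℝ F]
  {S : Type*} [TopologicalSpace S] [ChartedSpace F S]

/-- The impact surface as a subset of the state space. -/
def HybridSystem.surface (H : HybridSystem E M F S) : Set M := range H.emb

/-- The hybrid flow: `H.Flow t x y` says that `φ_t(x)` is defined and equal to `y`, for `t ≥ 0`.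
The state follows the vector field as long as the surface is not met. When the surface is met, at
the point `p`, the state is reset to `reset p`; the value at the time of an impact is the state
before the reset. The flow is defined at time `t` if only finitely many impacts occur before. -/
inductive HybridSystem.Flow (H : HybridSystem E M F S) : ℝ → M → M → Prop
  | continuous {t : ℝ} {x y : M} (γ : ℝ → M) (ht : 0 ≤ t) (hx : γ 0 = x) (hy : γ t = y)
      (hγ : IsMIntegralCurveOn γ H.field (Icc 0 t))
      (hS : ∀ s ∈ Ico 0 t, γ s ∉ H.surface) : H.Flow t x y
  | impact {t r : ℝ} {x y : M} {p : S} (γ : ℝ → M) (ht : 0 ≤ t) (hx : γ 0 = x)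
      (hp : γ t = H.emb p)
      (hγ : IsMIntegralCurveOn γ H.field (Icc 0 t))
      (hS : ∀ s ∈ Ico 0 t, γ s ∉ H.surface)
      (hr : 0 < r) (hy : H.Flow r (H.reset p) y) : H.Flow (t + r) x y

/-- A hybrid system is smooth if a trajectory that is at a point of `closure S \ S` continues and
avoids `S` for a short time afterwards, and the vector field is transverse to `S`, i.e.
`T_x M = T_x S ⊕ ℝ X(x)` at the points of `S`. -/
structure HybridSystem.IsSmooth (H : HybridSystem E M F S) : Prop where
  avoid : ∀ (t : ℝ) (x y : M), H.Flow t x y → y ∈ closure H.surface \ H.surface →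
    ∃ ε > 0, ∀ δ ∈ Ioo 0 ε, ∃ z, H.Flow (t + δ) x z ∧ z ∉ H.surface
  transverse : ∀ p : S, IsCompl
    (LinearMap.range (mfderiv 𝓘(ℝ, F) 𝓘(ℝ, E) H.emb p).toLinearMap)
    (Submodule.span ℝ {H.field (H.emb p)})

/-- The linear map `T_p S × ℝ → T_p M`, `(u, c) ↦ u + c X(p)`. -/
def HybridSystem.split (H : HybridSystem E M F S) (p : S) :
    TangentSpace 𝓘(ℝ, F) p × ℝ →ₗ[ℝ] TangentSpace 𝓘(ℝ, E) (H.emb p) :=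
  (mfderiv 𝓘(ℝ, F) 𝓘(ℝ, E) H.emb p).toLinearMap.coprod
    (LinearMap.toSpanSingleton ℝ _ (H.field (H.emb p)))

/-- The linear map `T_p S × ℝ → T_{Δ(p)} M`, `(u, c) ↦ Δ_* u + c X(Δ(p))`. -/
def HybridSystem.resetSplit (H : HybridSystem E M F S) (p : S) :
    TangentSpace 𝓘(ℝ, F) p × ℝ →ₗ[ℝ] TangentSpace 𝓘(ℝ, E) (H.reset p) :=
  (mfderiv 𝓘(ℝ, F) 𝓘(ℝ, E) H.reset p).toLinearMap.coprod
    (LinearMap.toSpanSingleton ℝ _ (H.field (H.reset p)))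

/-- `(φ_t)^* α = α` for all `t ≥ 0`. As the hybrid flow is only piecewise smooth, the equality is
required where `φ_t` is smooth: at every point `x ∉ S` with `φ_t(x) ∉ S` that has an open
neighbourhood `U`, disjoint from `S`, on which `φ_t` is defined and given by a smooth map `f`. -/
def HybridSystem.IsInvariant (H : HybridSystem E M F S) {m : ℕ} (α : Form E M m) : Prop :=
  ∀ t : ℝ, 0 ≤ t → ∀ (U : Set M) (f : M → M), IsOpen U → Disjoint U H.surface →
    (∀ x ∈ U, H.Flow t x (f x)) → ContMDiffOn 𝓘(ℝ, E) 𝓘(ℝ, E) ∞ f U →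
    ∀ x ∈ U, f x ∉ H.surface → ∀ v : Fin m → TangentSpace 𝓘(ℝ, E) x,
      α (f x) (fun i => mfderiv 𝓘(ℝ, E) 𝓘(ℝ, E) f x (v i)) = α x v

variable [FiniteDimensional ℝ E] [FiniteDimensional ℝ F]

theorem HybridSystem.IsSmooth.bijective_split {H : HybridSystem E M F S} (hH : H.IsSmooth)
    (p : S) : Function.Bijective (H.split p) := by
  have hsurj : Function.Surjective (H.split p) := by
    rw [← LinearMap.range_eq_top, HybridSystem.split, LinearMap.range_coprod,
      LinearMap.range_toSpanSingleton]
    exact (hH.transverse p).sup_eq_top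
  have : FiniteDimensional ℝ (TangentSpace 𝓘(ℝ, F) p) := inferInstanceAs (FiniteDimensional ℝ F)
  have : FiniteDimensional ℝ (TangentSpace 𝓘(ℝ, E) (H.emb p)) :=
    inferInstanceAs (FiniteDimensional ℝ E)
  have hdim : finrank ℝ (TangentSpace 𝓘(ℝ, F) p × ℝ)
      = finrank ℝ (TangentSpace 𝓘(ℝ, E) (H.emb p)) := by
    rw [finrank_prod, finrank_self]
    exact H.finrank_add_one
  exact ⟨(LinearMap.injective_iff_surjective_of_finrank_eq_finrank hdim).2 hsurj, hsurj⟩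

/-- The augmented differential `Δ_*^X : T_p M → T_{Δ(p)} M` at a point `p` of the surface. -/
def HybridSystem.IsSmooth.augmentedDifferential {H : HybridSystem E M F S} (hH : H.IsSmooth)
    (p : S) : TangentSpace 𝓘(ℝ, E) (H.emb p) →ₗ[ℝ] TangentSpace 𝓘(ℝ, E) (H.reset p) :=
  H.resetSplit p ∘ₗ
    (LinearEquiv.ofBijective (H.split p) (hH.bijective_split p)).symm.toLinearMap

/-- The augmented differential is the differential of the reset map on vectors tangent to `S`. -/
theorem HybridSystem.IsSmooth.augmentedDifferential_tangent {H : HybridSystem E M F S}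
    (hH : H.IsSmooth) (p : S) (u : TangentSpace 𝓘(ℝ, F) p) :
    hH.augmentedDifferential p (mfderiv 𝓘(ℝ, F) 𝓘(ℝ, E) H.emb p u)
      = mfderiv 𝓘(ℝ, F) 𝓘(ℝ, E) H.reset p u := by
  have h : mfderiv 𝓘(ℝ, F) 𝓘(ℝ, E) H.emb p u
      = LinearEquiv.ofBijective (H.split p) (hH.bijective_split p) (u, 0) := by
    simp [HybridSystem.split]
  rw [h, HybridSystem.IsSmooth.augmentedDifferential, LinearMap.comp_apply,
    LinearEquiv.coe_coe, LinearEquiv.symm_apply_apply]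
  simp [HybridSystem.resetSplit]

/-- The augmented differential sends `X(p)` to `X(Δ(p))`. -/
theorem HybridSystem.IsSmooth.augmentedDifferential_field {H : HybridSystem E M F S}
    (hH : H.IsSmooth) (p : S) :
    hH.augmentedDifferential p (H.field (H.emb p)) = H.field (H.reset p) := by
  have h : H.field (H.emb p)
      = LinearEquiv.ofBijective (H.split p) (hH.bijective_split p) (0, 1) := by
    simp [HybridSystem.split]
  rw [h, HybridSystem.IsSmooth.augmentedDifferential, LinearMap.comp_apply,
    LinearEquiv.coe_coe, LinearEquiv.symm_apply_apply]
  simp [HybridSystem.resetSplit]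

end Systems

end Hybrid

end

open scoped Topology

set_option linter.unusedSectionVars false

noncomputable section

namespace Hybrid

universe u

/-! ### Inverse function theorem, smooth case -/

/-! The continuous flow `fl` preserves `α` when the Lie derivative vanishes (`frm_fl_eq`), so what
matters is an impact. Let `G` follow the points of an open set, `G x` being reached at a time `σ x`
that depends on `x`. Then `G` itself need not preserve `α`, but the corrected derivative `v ↦ G' v -
σ' v • X` does: this is `Adapted`. Flowing on keeps the property (`Adapted.fl`). On arrival at `S`,
the corrected derivative is a vector tangent to `S` minus a multiple of `X`; the augmented
differential is exactly the map that carries it to the corrected derivative after the restart, so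
the reset condition keeps the property as well (`Adapted.reset`). At the final time `σ` is the
constant `t` and the correction disappears.

By transversality and the inverse function theorem, the time and place of an impact depend smoothly
on the starting point within a flow box (`nonempty_flowBox`). Still, the first impact time may jump,
because `S` need not be closed. It is upper semicontinuous, since a transverse hit persists, so by
Baire it has continuity points in every nonempty open set; near such a point the first impact is the
one seen by the flow box. A further Baire argument finds an open set where a fixed number of impacts
occurs on a dense subset, and induction on this number ends at a point where the pullback of `α` is
`α` (`exists_frm_pullback_eq`). Such points are dense, and smoothness of the time-`t` map extends
the equality to all points of `U`.

Conversely, away from the closure of `S` the hybrid flow is `fl` for a short time, so the Lie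
derivative vanishes there; that closure has empty interior, so it vanishes everywhere. For the reset
condition, take an impact point after whose reset `S` is avoided for a locally uniform time.
Starting slightly before the impact and stopping slightly after it gives a smooth hybrid flow; its
invariance, transported by the invariance under `fl` on both sides, is the reset condition at that
point (`frm_reset_eq_of_uniform_avoid`). Condition (A.1) and Baire on the surface make such points
dense (`exists_uniform_avoid`).

The smooth flow itself comes from the inverse function theorem for the integral equation on `C([0,
1], E)`. -/

/-- The inverse is smooth at the image of every point with invertible derivative. Invertible
operators form an open set, so the source can be shrunk until this covers the whole target. -/
theorem exists_openPartialHomeomorph_contDiffOn_symm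
    {E F : Type*} [NormedAddCommGroup E] [NormedSpace ℝ E] [CompleteSpace E]
    [NormedAddCommGroup F] [NormedSpace ℝ F] {f : E → F} {U : Set E} (hU : IsOpen U)
    (hf : ContDiffOn ℝ ∞ f U) {a : E} (ha : a ∈ U) {f' : E ≃L[ℝ] F}
    (hf' : HasFDerivAt f (f' : E →L[ℝ] F) a) :
    ∃ e : OpenPartialHomeomorph E F, a ∈ e.source ∧ e.source ⊆ U ∧ (∀ x, e x = f x) ∧
      ContDiffOn ℝ ∞ e.symm e.target := by
  have hfa : ContDiffAt ℝ ∞ f a := hf.contDiffAt (hU.mem_nhds ha)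
  let e₀ := hfa.toOpenPartialHomeomorph f hf' (by simp)
  have hcont : ContinuousOn (fderiv ℝ f) U := hf.continuousOn_fderiv_of_isOpen hU (by simp)
  let R : Set (E →L[ℝ] F) := range ((↑) : (E ≃L[ℝ] F) → (E →L[ℝ] F))
  have hR : IsOpen R := ContinuousLinearEquiv.isOpen
  have hW : IsOpen (U ∩ fderiv ℝ f ⁻¹' R) := hcont.isOpen_inter_preimage hU hR
  refine ⟨e₀.restrOpen _ hW, ?_, ?_, fun x => rfl, ?_⟩
  · refine ⟨hfa.mem_toOpenPartialHomeomorph_source hf' (by simp), ha, f', ?_⟩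
    exact hf'.fderiv.symm
  · exact fun x hx => hx.2.1
  · intro y hy
    have hx := (e₀.restrOpen _ hW).map_target hy
    obtain ⟨-, hxU, g, hg⟩ := hx
    refine ContDiffAt.contDiffWithinAt ?_
    have hd : DifferentiableAt ℝ f ((e₀.restrOpen _ hW).symm y) :=
      (hf.contDiffAt (hU.mem_nhds hxU)).differentiableAt (by simp)
    refine (e₀.restrOpen _ hW).contDiffAt_symm (f₀' := g) hy ?_
      (hf.contDiffAt (hU.mem_nhds hxU))
    rw [hg]
    exact hd.hasFDerivAt

/-! ### Superposition operators on spaces of continuous maps -/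

section Superposition

variable {K : Type*} [TopologicalSpace K] [CompactSpace K]

/-- Pointwise evaluation of a continuous family of linear maps on a continuous map. -/
def pointwiseCLM (K : Type*) [TopologicalSpace K] [CompactSpace K]
    (E G : Type*) [NormedAddCommGroup E] [NormedSpace ℝ E]
    [NormedAddCommGroup G] [NormedSpace ℝ G] :
    C(K, E →L[ℝ] G) →L[ℝ] C(K, E) →L[ℝ] C(K, G) :=
  LinearMap.mkContinuous₂
    (LinearMap.mk₂ ℝ (fun (A : C(K, E →L[ℝ] G)) (h : C(K, E)) =>
        (⟨fun t => A t (h t), by fun_prop⟩ : C(K, G)))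
      (fun _ _ _ => by ext; simp) (fun _ _ _ => by ext; simp)
      (fun _ _ _ => by ext; simp) (fun _ _ _ => by ext; simp))
    1 (fun A h => by
      refine (ContinuousMap.norm_le _ (by positivity)).2 fun t => ?_
      rw [one_mul]
      exact (ContinuousLinearMap.le_opNorm _ _).trans
        (mul_le_mul (A.norm_coe_le_norm t) (h.norm_coe_le_norm t) (norm_nonneg _) (by positivity)))

/-- The remainder is estimated uniformly in `t` by the mean value inequality, because `W'` is
uniformly continuous around the compact range of `a`. -/
theorem hasFDerivAt_comp_left {E G : Type*} [NormedAddCommGroup E] [NormedSpace ℝ E]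
    [NormedAddCommGroup G] [NormedSpace ℝ G] (W : C(E, G)) (W' : C(E, E →L[ℝ] G))
    (hW : ∀ x, HasFDerivAt W (W' x) x) (a : C(K, E)) :
    HasFDerivAt (fun b : C(K, E) => W.comp b) (pointwiseCLM K E G (W'.comp a)) a := by
  rw [hasFDerivAt_iff_isLittleO, Asymptotics.isLittleO_iff]
  intro ε hε
  have hcomp : IsCompact (range a) := isCompact_range a.continuous
  have hu := hcomp.uniformContinuousAt_of_continuousAt W'
    (fun x _ => W'.continuous.continuousAt) (Metric.dist_mem_uniformity hε)
  obtain ⟨δ, hδ, hu⟩ := Metric.mem_uniformity_dist.1 hu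
  filter_upwards [Metric.ball_mem_nhds a hδ] with b hb
  refine (ContinuousMap.norm_le _ (by positivity)).2 fun t => ?_
  have hbt : b t ∈ Metric.ball (a t) δ := by
    rw [Metric.mem_ball]
    exact (ContinuousMap.dist_apply_le_dist t).trans_lt hb
  have key := (convex_ball (a t) δ).norm_image_sub_le_of_norm_hasFDerivWithin_le'
    (f := W) (f' := W') (φ := W' (a t)) (C := ε)
    (fun x _ => (hW x).hasFDerivWithinAt) (fun x hx => by
      have := hu (a := a t) (b := x) (by rw [dist_comm]; exact hx) (mem_range_self t)
      rw [← dist_eq_norm, dist_comm]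
      exact (le_of_lt this)) (Metric.mem_ball_self hδ) hbt
  refine (le_of_eq ?_).trans (key.trans ?_)
  · rfl
  · exact mul_le_mul_of_nonneg_left ((b - a).norm_coe_le_norm t) hε.le

/-- The derivative is the superposition operator of `fderiv ℝ W` followed by the bounded bilinear
evaluation, so induction on `n` works once `G` may vary. It passes from `G` to `E →L[ℝ] G`, which is
why both spaces share a universe. -/
theorem contDiff_comp_left {E : Type u} [NormedAddCommGroup E] [NormedSpace ℝ E] (n : ℕ) :
    ∀ {G : Type u} [NormedAddCommGroup G] [NormedSpace ℝ G] (W : C(E, G)),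
      ContDiff ℝ ∞ W → ContDiff ℝ n (fun b : C(K, E) => W.comp b) := by
  induction n with
  | zero =>
    intro G _ _ W _
    exact contDiff_zero.2 (ContinuousMap.continuous_postcomp W)
  | succ n ih =>
    intro G _ _ W hW
    have hd : ContDiff ℝ ∞ (fderiv ℝ W) := hW.fderiv_right (by simp)
    let W' : C(E, E →L[ℝ] G) := ⟨fderiv ℝ W, hd.continuous⟩
    have h := (pointwiseCLM K E G).contDiff.comp (ih W' hd)
    exact_mod_cast contDiff_succ_iff_hasFDerivAt.2 ⟨_, h, fun a =>
      hasFDerivAt_comp_left W W' (fun x => (hW.differentiable (by simp) x).hasFDerivAt) a⟩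

end Superposition

/-! ### Smooth dependence of solutions of differential equations on the initial value -/

section LocalFlow

variable {E : Type u} [NormedAddCommGroup E] [NormedSpace ℝ E]

/-- The operator sending a curve on `[0, 1]` to its primitive vanishing at `0`. -/
def primitiveCLM (E : Type*) [NormedAddCommGroup E] [NormedSpace ℝ E] :
    C(Icc (0 : ℝ) 1, E) →L[ℝ] C(Icc (0 : ℝ) 1, E) :=
  LinearMap.mkContinuous
    { toFun := fun b => ⟨fun t => ∫ s in (0 : ℝ)..t, IccExtend zero_le_one b s, by
        have h : Continuous (IccExtend zero_le_one b : ℝ → E) := b.continuous.Icc_extend'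
        exact (intervalIntegral.continuous_primitive (fun _ _ => h.intervalIntegrable _ _) 0).comp
          continuous_subtype_val⟩
      map_add' := fun b c => by
        ext t
        have hb : Continuous (IccExtend zero_le_one b : ℝ → E) := b.continuous.Icc_extend'
        have hc : Continuous (IccExtend zero_le_one c : ℝ → E) := c.continuous.Icc_extend'
        simp only [ContinuousMap.coe_mk, ContinuousMap.add_apply]
        rw [← intervalIntegral.integral_add (hb.intervalIntegrable _ _) (hc.intervalIntegrable _ _)]
        rfl
      map_smul' := fun r b => by
        ext t
        simp only [ContinuousMap.coe_mk, ContinuousMap.smul_apply, RingHom.id_apply]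
        rw [← intervalIntegral.integral_smul]
        rfl }
    1 (fun b => by
      refine (ContinuousMap.norm_le _ (by positivity)).2 fun t => ?_
      refine (intervalIntegral.norm_integral_le_of_norm_le_const (C := ‖b‖)
        (fun s _ => b.norm_coe_le_norm _)).trans ?_
      have h0 := t.2.1
      have h1 := t.2.2
      rw [sub_zero, abs_of_nonneg h0, one_mul]
      exact mul_le_of_le_one_right (norm_nonneg _) h1)

/-- A smooth vector field with compact support has a smooth local flow. -/
theorem exists_local_flow_of_bounded [FiniteDimensional ℝ E] {V : E → E} (hV : ContDiff ℝ ∞ V)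
    {L : ℝ} (hL : ∀ x, ‖V x‖ ≤ L) (x₀ : E) :
    ∃ (φ : ℝ × E → E) (δ : ℝ), 0 < δ ∧
      ContDiffOn ℝ ∞ φ (Metric.ball 0 δ ×ˢ Metric.ball x₀ δ) ∧
      ∀ x ∈ Metric.ball x₀ δ, φ (0, x) = x ∧ ∀ s ∈ Metric.ball (0 : ℝ) δ,
        HasDerivAt (fun s => φ (s, x)) (V (φ (s, x))) s := by
  have hL0 : 0 ≤ L := (norm_nonneg _).trans (hL x₀)
  let I := Icc (0 : ℝ) 1
  let one : I := ⟨1, right_mem_Icc.2 zero_le_one⟩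
  let W : C(E, E) := ⟨V, hV.continuous⟩
  let J := primitiveCLM E
  let c : E →L[ℝ] C(I, E) := ContinuousLinearMap.const ℝ I
  -- The last component vanishes exactly when `b t = x + s ∫₀ᵗ V (b u) du`. Rescaling time to `[0,
  -- 1]` turns the duration `s` into a parameter, so that all solutions live in one Banach space.
  let Φ : (E × ℝ) × C(I, E) → (E × ℝ) × C(I, E) :=
    fun q => (q.1, q.2 - c q.1.1 - q.1.2 • J (W.comp q.2))
  have hN : ContDiff ℝ ∞ (fun b : C(I, E) => W.comp b) :=
    contDiff_infty.2 fun n => contDiff_comp_left n W hV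
  have hΦ : ContDiff ℝ ∞ Φ := by
    have : ContDiff ℝ ∞ (fun q : (E × ℝ) × C(I, E) => J (W.comp q.2)) :=
      J.contDiff.comp (hN.comp contDiff_snd)
    have h2 : ContDiff ℝ ∞ (fun q : (E × ℝ) × C(I, E) => c q.1.1) :=
      c.contDiff.comp (contDiff_fst.comp contDiff_fst)
    exact contDiff_fst.prodMk ((contDiff_snd.sub h2).sub
      ((contDiff_snd.comp contDiff_fst).smul this))
  let q₀ : (E × ℝ) × C(I, E) := ((x₀, 0), c x₀)
  -- At `s = 0` the integral term contributes nothing to the derivative in the curve, so the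
  -- derivative is triangular with identity blocks.
  let Φ' : ((E × ℝ) × C(I, E)) ≃L[ℝ] ((E × ℝ) × C(I, E)) :=
    (ContinuousLinearEquiv.refl ℝ (E × ℝ)).skewProd (ContinuousLinearEquiv.refl ℝ C(I, E))
      (-(c ∘L ContinuousLinearMap.fst ℝ E ℝ) -
        (ContinuousLinearMap.toSpanSingleton ℝ (J (W.comp (c x₀)))) ∘L
          ContinuousLinearMap.snd ℝ E ℝ)
  have hΦ' : HasFDerivAt Φ (Φ' : ((E × ℝ) × C(I, E)) →L[ℝ] ((E × ℝ) × C(I, E))) q₀ := by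
    have hJ : HasFDerivAt (fun q : (E × ℝ) × C(I, E) => J (W.comp q.2)) (fderiv ℝ _ q₀) q₀ :=
      ((J.contDiff.comp (hN.comp contDiff_snd)).differentiable (by simp) q₀).hasFDerivAt
    have h1 : HasFDerivAt (fun q : (E × ℝ) × C(I, E) => q.1)
        (ContinuousLinearMap.fst ℝ _ _) q₀ := hasFDerivAt_fst
    have h2 : HasFDerivAt (fun q : (E × ℝ) × C(I, E) => q.2)
        (ContinuousLinearMap.snd ℝ _ _) q₀ := hasFDerivAt_snd
    have h12 : HasFDerivAt (fun q : (E × ℝ) × C(I, E) => q.1.2)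
        (ContinuousLinearMap.snd ℝ _ _ ∘L ContinuousLinearMap.fst ℝ _ _) q₀ := h1.snd
    have h11 : HasFDerivAt (fun q : (E × ℝ) × C(I, E) => c q.1.1)
        (c ∘L (ContinuousLinearMap.fst ℝ _ _ ∘L ContinuousLinearMap.fst ℝ _ _)) q₀ :=
      c.hasFDerivAt.comp q₀ h1.fst
    refine (h1.prodMk ((h2.sub h11).sub (h12.smul hJ))).congr_fderiv ?_
    ext v <;> simp [Φ', q₀]
  obtain ⟨e, he₀, -, heΦ, he⟩ := exists_openPartialHomeomorph_contDiffOn_symm isOpen_univ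
    hΦ.contDiffOn (mem_univ q₀) hΦ'
  let φ : ℝ × E → E := fun p => (e.symm ((p.2, p.1), 0)).2 one
  have hι : ContDiff ℝ ∞ (fun p : ℝ × E => (((p.2, p.1), 0) : (E × ℝ) × C(I, E))) := by fun_prop
  have hφ : ContDiffOn ℝ ∞ φ ((fun p : ℝ × E => (((p.2, p.1), 0) : (E × ℝ) × C(I, E))) ⁻¹'
      e.target) := by
    have h1 : ContDiff ℝ ∞ (fun q : (E × ℝ) × C(I, E) => q.2 one) :=
      by
      have h0 : ContDiff ℝ ∞ (ContinuousMap.evalCLM (M := E) ℝ one) :=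
        ContinuousLinearMap.contDiff _
      exact h0.comp contDiff_snd
    exact h1.comp_contDiffOn (he.comp hι.contDiffOn fun _ h => h)
  have hΦq : Φ q₀ = ((x₀, 0), 0) := by simp [Φ, q₀]
  have htar : (fun p : ℝ × E => (((p.2, p.1), 0) : (E × ℝ) × C(I, E))) ⁻¹' e.target
      ∈ 𝓝 ((0 : ℝ), x₀) := by
    refine hι.continuous.continuousAt.preimage_mem_nhds (e.open_target.mem_nhds ?_)
    have := e.map_source he₀
    rwa [heΦ, hΦq] at this
  obtain ⟨ρ, hρ, hsource⟩ := Metric.isOpen_iff.1 e.open_source q₀ he₀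
  obtain ⟨r, hr, ε, hε, hpl⟩ := hV.contDiffAt
    |>.of_le (m := 1) (by simp)
    |>.exists_forall_mem_closedBall_exists_eq_forall_mem_Ioo_hasDerivAt (x₀ := x₀) 0
  obtain ⟨δ₁, hδ₁, hball⟩ := Metric.mem_nhds_iff.1 htar
  choose! β hβ0 hβ using hpl
  -- The inverse of `Φ` is identified with the Picard–Lindelöf solution `β`. The two bounds by `ρ /
  -- 4` keep the rescaled solution in the ball of radius `ρ` on which `e` is injective.
  have hφβ : ∀ δ > 0, δ ≤ r → δ ≤ ε → δ ≤ ρ / 4 → δ * L ≤ ρ / 4 → ∀ x ∈ Metric.ball x₀ δ,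
      ∀ s ∈ Metric.ball (0 : ℝ) δ, φ (s, x) = β x s := by
    intro δ hδ hδr hδε hδρ hδL x hx s hs
    have hxr : x ∈ Metric.closedBall x₀ r :=
      Metric.ball_subset_closedBall (Metric.ball_subset_ball hδr hx)
    have hs' : |s| < δ := by simpa using hs
    have hmem : ∀ t ∈ Icc (0 : ℝ) 1, s * t ∈ Metric.ball (0 : ℝ) δ := by
      intro t ht
      rw [mem_ball_zero_iff, Real.norm_eq_abs, abs_mul, abs_of_nonneg ht.1]
      exact (mul_le_of_le_one_right (abs_nonneg _) ht.2).trans_lt hs'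
    have hd : ∀ u ∈ Metric.ball (0 : ℝ) δ, HasDerivAt (β x) (V (β x u)) u := by
      intro u hu
      rw [mem_ball_zero_iff, Real.norm_eq_abs, abs_lt] at hu
      exact hβ x hxr u ⟨by linarith, by linarith⟩
    have hcont : ContinuousOn (β x) (Metric.ball (0 : ℝ) δ) :=
      fun u hu => (hd u hu).continuousAt.continuousWithinAt
    let a : C(I, E) := ⟨fun t => β x (s * t), hcont.comp_continuous (by fun_prop)
      fun t => hmem t t.2⟩
    have hbound : ∀ t : I, ‖β x (s * t) - x‖ ≤ ρ / 4 := by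
      intro t
      have := (convex_ball (0 : ℝ) δ).norm_image_sub_le_of_norm_hasDerivWithin_le (f := β x)
        (fun u hu => (hd u hu).hasDerivWithinAt) (fun u _ => hL _) (Metric.mem_ball_self hδ)
        (hmem t t.2)
      rw [hβ0 x hxr, sub_zero] at this
      have h2 : ‖s * (t : ℝ)‖ ≤ δ := by
        have := hmem t t.2
        rw [mem_ball_zero_iff] at this
        exact this.le
      nlinarith
    have hqs : ((x, s), a) ∈ e.source := by
      apply hsource
      rw [Metric.mem_ball, Prod.dist_eq, Prod.dist_eq]
      have hx' : dist x x₀ < ρ := by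
        have := Metric.mem_ball.1 hx
        linarith
      refine max_lt (max_lt hx' ?_) ?_
      · rw [Real.dist_eq, sub_zero]
        linarith
      · refine ((ContinuousMap.dist_le (C := ρ / 2) (by positivity)).2 fun t => ?_).trans_lt
          (by linarith)
        have h1 := hbound t
        have h2 := Metric.mem_ball.1 hx
        rw [← dist_eq_norm] at h1
        calc dist (β x (s * t)) x₀ ≤ dist (β x (s * t)) x + dist x x₀ := dist_triangle _ _ _
          _ ≤ ρ / 2 := by linarith
    have hint : Φ ((x, s), a) = ((x, s), 0) := by
      refine Prod.ext rfl ?_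
      ext t
      have hder : ∀ u ∈ uIcc (0 : ℝ) t,
          HasDerivAt (fun u => β x (s * u)) (s • V (β x (s * u))) u := by
        intro u hu
        rw [uIcc_of_le t.2.1] at hu
        have h := (hd (s * u) (hmem u ⟨hu.1, hu.2.trans t.2.2⟩)).scomp u
          ((hasDerivAt_id u).const_mul s)
        rw [mul_one] at h
        exact h
      have hcs : Continuous (IccExtend zero_le_one (W.comp a) : ℝ → E) :=
        (W.comp a).continuous.Icc_extend'
      have heq : ∀ u ∈ uIcc (0 : ℝ) t,
          s • V (β x (s * u)) = s • IccExtend zero_le_one (W.comp a) u := by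
        intro u hu
        rw [uIcc_of_le t.2.1] at hu
        rw [IccExtend_of_mem _ _ ⟨hu.1, hu.2.trans t.2.2⟩]
        rfl
      have hi := intervalIntegral.integral_eq_sub_of_hasDerivAt hder
        ((hcs.const_smul s).continuousOn.congr heq).intervalIntegrable
      rw [intervalIntegral.integral_congr heq, intervalIntegral.integral_smul, mul_zero,
        hβ0 x hxr] at hi
      change β x (s * t) - x - s • (∫ u in (0 : ℝ)..t, IccExtend zero_le_one (W.comp a) u) = 0
      rw [hi]
      abel
    have hsymm : e.symm ((x, s), 0) = ((x, s), a) := by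
      rw [← hint, ← heΦ, e.left_inv hqs]
    change (e.symm ((x, s), 0)).2 one = _
    rw [hsymm]
    change β x (s * 1) = _
    rw [mul_one]
  obtain ⟨δ, hδ, h1, h2, h3, h4, h5⟩ : ∃ δ > 0, δ ≤ r ∧ δ ≤ ε ∧ δ ≤ ρ / 4 ∧ δ * L ≤ ρ / 4 ∧
      δ ≤ δ₁ := by
    have hpos : 0 < ρ / (4 * (L + 1)) := by positivity
    refine ⟨min (min r ε) (min (ρ / 4) (min (ρ / (4 * (L + 1))) δ₁)), by positivity,
      by simp, by simp, by simp, ?_, by simp⟩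
    calc _ ≤ ρ / (4 * (L + 1)) * L := by
          gcongr
          simp
      _ ≤ ρ / (4 * (L + 1)) * (L + 1) := by
          gcongr
          linarith
      _ = ρ / 4 := by field_simp
  have key := hφβ δ hδ h1 h2 h3 h4
  refine ⟨φ, δ, hδ, hφ.mono fun p hp => hball ?_, fun x hx => ⟨?_, fun s hs => ?_⟩⟩
  · rw [Metric.mem_ball, Prod.dist_eq]
    exact max_lt ((Metric.mem_ball.1 hp.1).trans_le h5) ((Metric.mem_ball.1 hp.2).trans_le h5)
  · rw [key x hx 0 (Metric.mem_ball_self hδ)]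
    exact hβ0 x (Metric.ball_subset_closedBall (Metric.ball_subset_ball h1 hx))
  · rw [key x hx s hs]
    have hd : HasDerivAt (β x) (V (β x s)) s := by
      have hs' := hs
      rw [mem_ball_zero_iff, Real.norm_eq_abs, abs_lt] at hs'
      exact hβ x (Metric.ball_subset_closedBall (Metric.ball_subset_ball h1 hx)) s
        ⟨by linarith, by linarith⟩
    refine hd.congr_of_eventuallyEq ?_
    filter_upwards [Metric.isOpen_ball.mem_nhds hs] with u hu using key x hx u hu

/-- A vector field that is smooth on an open set has a smooth local flow at each of its points. -/
theorem exists_local_flow [FiniteDimensional ℝ E] {V : E → E} {Ω : Set E} (hΩ : IsOpen Ω)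
    (hV : ContDiffOn ℝ ∞ V Ω) {x₀ : E} (hx₀ : x₀ ∈ Ω) :
    ∃ (φ : ℝ × E → E) (δ : ℝ), 0 < δ ∧
      ContDiffOn ℝ ∞ φ (Metric.ball 0 δ ×ˢ Metric.ball x₀ δ) ∧
      ∀ x ∈ Metric.ball x₀ δ, φ (0, x) = x ∧ ∀ s ∈ Metric.ball (0 : ℝ) δ, φ (s, x) ∈ Ω ∧
        HasDerivAt (fun s => φ (s, x)) (V (φ (s, x))) s := by
  obtain ⟨R, hR, hball⟩ := Metric.isOpen_iff.1 hΩ x₀ hx₀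
  -- The cut-off equals 1 on the ball of radius `R / 4`, so solutions for `χ • V` that stay there
  -- are solutions for `V`.
  let χ : ContDiffBump x₀ := ⟨R / 4, R / 2, by positivity, by linarith⟩
  have hsupp : tsupport χ ⊆ Ω := by
    rw [χ.tsupport_eq]
    exact (Metric.closedBall_subset_ball (by change R / 2 < R; linarith)).trans hball
  let V₁ : E → E := fun x => χ x • V x
  have hV₁ : ContDiff ℝ ∞ V₁ := by
    refine contDiff_iff_contDiffAt.2 fun x => ?_
    by_cases hx : x ∈ Ω
    · exact χ.contDiffAt.smul (hV.contDiffAt (hΩ.mem_nhds hx))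
    · have : V₁ =ᶠ[𝓝 x] fun _ => 0 := by
        filter_upwards [(isClosed_tsupport χ).isOpen_compl.mem_nhds (fun h => hx (hsupp h))]
          with y hy
        change χ y • V y = 0
        rw [image_eq_zero_of_notMem_tsupport hy, zero_smul]
      exact contDiffAt_const.congr_of_eventuallyEq this
  have hcs : HasCompactSupport V₁ := χ.hasCompactSupport.smul_right
  obtain ⟨L, hL⟩ := hcs.exists_bound_of_continuous hV₁.continuous
  obtain ⟨φ, δ, hδ, hφ, h⟩ := exists_local_flow_of_bounded hV₁ hL x₀
  have hφc : ContinuousAt φ (0, x₀) := (hφ.contDiffAt (prod_mem_nhds (Metric.ball_mem_nhds _ hδ)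
    (Metric.ball_mem_nhds _ hδ))).continuousAt
  have hnhd : φ ⁻¹' Metric.ball x₀ (R / 4) ∈ 𝓝 ((0 : ℝ), x₀) := by
    refine hφc.preimage_mem_nhds (Metric.isOpen_ball.mem_nhds ?_)
    rw [(h x₀ (Metric.mem_ball_self hδ)).1]
    exact Metric.mem_ball_self (by positivity)
  obtain ⟨δ', hδ', hsub⟩ := Metric.mem_nhds_iff.1 hnhd
  have hm : Metric.ball (0 : ℝ) (min δ δ') ×ˢ Metric.ball x₀ (min δ δ') ⊆
      Metric.ball (0 : ℝ) δ ×ˢ Metric.ball x₀ δ :=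
    prod_mono (Metric.ball_subset_ball (min_le_left _ _))
      (Metric.ball_subset_ball (min_le_left _ _))
  refine ⟨φ, min δ δ', by positivity, hφ.mono hm, fun x hx => ?_⟩
  have hx' := Metric.ball_subset_ball (min_le_left _ _) hx
  refine ⟨(h x hx').1, fun s hs => ?_⟩
  have hs' := Metric.ball_subset_ball (min_le_left _ _) hs
  have hin : φ (s, x) ∈ Metric.ball x₀ (R / 4) := by
    apply hsub
    rw [Metric.mem_ball, Prod.dist_eq]
    exact max_lt (Metric.ball_subset_ball (min_le_right _ _) hs)
      (Metric.ball_subset_ball (min_le_right _ _) hx)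
  refine ⟨hball (Metric.ball_subset_ball (by linarith) hin), ?_⟩
  have hd := (h x hx').2 s hs'
  have h1 : V₁ (φ (s, x)) = V (φ (s, x)) := by
    change χ _ • V _ = _
    rw [χ.one_of_mem_closedBall (Metric.ball_subset_closedBall hin), one_smul]
  rwa [h1] at hd

end LocalFlow

/-! ### Derivatives of maps between manifolds as maps between the model spaces -/

section HasTD

variable {E : Type*} [NormedAddCommGroup E] [NormedSpace ℝ E]
  {H : Type*} [TopologicalSpace H] {I : ModelWithCorners ℝ E H}
  {M : Type*} [TopologicalSpace M] [ChartedSpace H M]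
  {E' : Type*} [NormedAddCommGroup E'] [NormedSpace ℝ E']
  {H' : Type*} [TopologicalSpace H'] {I' : ModelWithCorners ℝ E' H'}
  {M' : Type*} [TopologicalSpace M'] [ChartedSpace H' M']
  {E'' : Type*} [NormedAddCommGroup E''] [NormedSpace ℝ E'']
  {H'' : Type*} [TopologicalSpace H''] {I'' : ModelWithCorners ℝ E'' H''}
  {M'' : Type*} [TopologicalSpace M''] [ChartedSpace H'' M'']

/-- `f` has derivative `f'` at `x`, where `f'` is a linear map between the model spaces. -/
def HasTD (I : ModelWithCorners ℝ E H) (I' : ModelWithCorners ℝ E' H') (f : M → M') (x : M)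
    (f' : E →L[ℝ] E') : Prop := HasMFDerivAt I I' f x f'

/-- The derivative of a map between manifolds, as a linear map between the model spaces. -/
def tderiv (I : ModelWithCorners ℝ E H) (I' : ModelWithCorners ℝ E' H') (f : M → M') (x : M) :
    E →L[ℝ] E' := mfderiv I I' f x

theorem HasTD.comp {g : M' → M''} {f : M → M'} {x : M} {y : M'} {g' : E' →L[ℝ] E''}
    {f' : E →L[ℝ] E'} (hg : HasTD I' I'' g y g') (hf : HasTD I I' f x f') (h : f x = y) :
    HasTD I I'' (fun z => g (f z)) x (g' ∘L f') := by
  subst h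
  exact HasMFDerivAt.comp x hg hf

theorem HasTD.unique {f : M → M'} {x : M} {f' f'' : E →L[ℝ] E'}
    (h : HasTD I I' f x f') (h' : HasTD I I' f x f'') : f' = f'' :=
  hasMFDerivAt_unique h h'

theorem HasTD.tderiv {f : M → M'} {x : M} {f' : E →L[ℝ] E'}
    (h : HasTD I I' f x f') : tderiv I I' f x = f' := HasMFDerivAt.mfderiv h

theorem HasTD.congr {f g : M → M'} {x : M} {f' : E →L[ℝ] E'}
    (h : HasTD I I' f x f') (hg : g =ᶠ[𝓝 x] f) : HasTD I I' g x f' :=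
  HasMFDerivAt.congr_of_eventuallyEq h hg

theorem hasTD_tderiv {f : M → M'} {x : M} (h : MDifferentiableAt I I' f x) :
    HasTD I I' f x (tderiv I I' f x) := h.hasMFDerivAt

theorem HasTD.continuousAt {f : M → M'} {x : M} {f' : E →L[ℝ] E'}
    (h : HasTD I I' f x f') : ContinuousAt f x := HasMFDerivAt.continuousAt h

theorem hasTD_id (x : M) : HasTD I I (fun z : M => z) x (ContinuousLinearMap.id ℝ E) :=
  hasMFDerivAt_id x

theorem hasTD_const (c : M') (x : M) : HasTD I I' (fun _ : M => c) x (0 : E →L[ℝ] E') :=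
  hasMFDerivAt_const c x

theorem HasTD.prodMk {f : M → M'} {g : M → M''} {x : M} {f' : E →L[ℝ] E'} {g' : E →L[ℝ] E''}
    (hf : HasTD I I' f x f') (hg : HasTD I I'' g x g') :
    HasTD I (I'.prod I'') (fun z => (f z, g z)) x (f'.prod g') :=
  HasMFDerivAt.prodMk hf hg

theorem hasTD_iff_hasFDerivAt {f : E → E'} {x : E} {f' : E →L[ℝ] E'} :
    HasTD 𝓘(ℝ, E) 𝓘(ℝ, E') f x f' ↔ HasFDerivAt f f' x :=
  hasMFDerivAt_iff_hasFDerivAt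

theorem hasTD_of_contMDiffAt {n : WithTop ℕ∞} {f : M → M'} {x : M} (h : ContMDiffAt I I' n f x)
    (hn : n ≠ 0) : HasTD I I' f x (tderiv I I' f x) :=
  hasTD_tderiv (h.mdifferentiableAt hn)

end HasTD

/-! ### Charts -/

section Charts

variable {E : Type*} [NormedAddCommGroup E] [NormedSpace ℝ E]
  {M : Type*} [TopologicalSpace M] [ChartedSpace E M] [IsManifold 𝓘(ℝ, E) ∞ M]

local notation "ch" => extChartAt 𝓘(ℝ, E)

theorem contMDiffAt_chart {x₀ x : M} (hx : x ∈ (ch x₀).source) :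
    ContMDiffAt 𝓘(ℝ, E) 𝓘(ℝ, E) ∞ (ch x₀) x := by
  rw [extChartAt_source] at hx
  exact contMDiffAt_extChartAt' hx

theorem contMDiffAt_chart_symm {x₀ : M} {y : E} (hy : y ∈ (ch x₀).target) :
    ContMDiffAt 𝓘(ℝ, E) 𝓘(ℝ, E) ∞ (ch x₀).symm y :=
  (contMDiffOn_extChartAt_symm x₀).contMDiffAt ((isOpen_extChartAt_target x₀).mem_nhds hy)

theorem hasTD_chart {x₀ x : M} (hx : x ∈ (ch x₀).source) :
    HasTD 𝓘(ℝ, E) 𝓘(ℝ, E) (ch x₀) x (tderiv 𝓘(ℝ, E) 𝓘(ℝ, E) (ch x₀) x) :=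
  hasTD_of_contMDiffAt (contMDiffAt_chart hx) (by simp)

theorem hasTD_chart_symm {x₀ : M} {y : E} (hy : y ∈ (ch x₀).target) :
    HasTD 𝓘(ℝ, E) 𝓘(ℝ, E) (ch x₀).symm y (tderiv 𝓘(ℝ, E) 𝓘(ℝ, E) (ch x₀).symm y) :=
  hasTD_of_contMDiffAt (contMDiffAt_chart_symm hy) (by simp)

theorem tderiv_chart_comp_symm {x₀ : M} {y : E} (hy : y ∈ (ch x₀).target) :
    tderiv 𝓘(ℝ, E) 𝓘(ℝ, E) (ch x₀) ((ch x₀).symm y) ∘L tderiv 𝓘(ℝ, E) 𝓘(ℝ, E) (ch x₀).symm y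
      = ContinuousLinearMap.id ℝ E := by
  have h := (hasTD_chart ((ch x₀).map_target hy)).comp (hasTD_chart_symm hy) rfl
  refine h.unique ((hasTD_id y).congr ?_)
  filter_upwards [(isOpen_extChartAt_target x₀).mem_nhds hy] with z hz using (ch x₀).right_inv hz

theorem tderiv_chart_symm_comp {x₀ x : M} (hx : x ∈ (ch x₀).source) :
    tderiv 𝓘(ℝ, E) 𝓘(ℝ, E) (ch x₀).symm (ch x₀ x) ∘L tderiv 𝓘(ℝ, E) 𝓘(ℝ, E) (ch x₀) x
      = ContinuousLinearMap.id ℝ E := by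
  have h := (hasTD_chart_symm ((ch x₀).map_source hx)).comp (hasTD_chart hx) rfl
  refine h.unique ((hasTD_id x).congr ?_)
  filter_upwards [(isOpen_extChartAt_source x₀).mem_nhds hx] with z hz using (ch x₀).left_inv hz

/-- The derivative of the inverse of a chart. -/
def chartSymmDeriv {x₀ : M} {y : E} (hy : y ∈ (ch x₀).target) : E ≃L[ℝ] E :=
  ContinuousLinearEquiv.equivOfInverse (tderiv 𝓘(ℝ, E) 𝓘(ℝ, E) (ch x₀).symm y)
    (tderiv 𝓘(ℝ, E) 𝓘(ℝ, E) (ch x₀) ((ch x₀).symm y))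
    (fun v => DFunLike.congr_fun (tderiv_chart_comp_symm hy) v)
    (fun v => by
      have h := DFunLike.congr_fun (tderiv_chart_symm_comp ((ch x₀).map_target hy)) v
      rw [(ch x₀).right_inv hy] at h
      exact h)

/-- The expression of a vector field in a chart. -/
def chartField (X : ∀ x : M, TangentSpace 𝓘(ℝ, E) x) (x₀ : M) : E → E :=
  VectorField.mpullback 𝓘(ℝ, E) 𝓘(ℝ, E) (ch x₀).symm X

theorem chartField_apply (X : ∀ x : M, TangentSpace 𝓘(ℝ, E) x) {x₀ : M} {y : E}
    (hy : y ∈ (ch x₀).target) : chartField X x₀ y =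
      tderiv 𝓘(ℝ, E) 𝓘(ℝ, E) (ch x₀) ((ch x₀).symm y) (X ((ch x₀).symm y)) := by
  have h : (tderiv 𝓘(ℝ, E) 𝓘(ℝ, E) (ch x₀).symm y).inverse =
      tderiv 𝓘(ℝ, E) 𝓘(ℝ, E) (ch x₀) ((ch x₀).symm y) :=
    ContinuousLinearMap.inverse_equiv (chartSymmDeriv hy)
  exact DFunLike.congr_fun h (X ((ch x₀).symm y))

theorem tderiv_chart_symm_chartField (X : ∀ x : M, TangentSpace 𝓘(ℝ, E) x) {x₀ : M} {y : E}
    (hy : y ∈ (ch x₀).target) : tderiv 𝓘(ℝ, E) 𝓘(ℝ, E) (ch x₀).symm y (chartField X x₀ y) =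
      X ((ch x₀).symm y) := by
  rw [chartField_apply X hy]
  exact (chartSymmDeriv hy).right_inv (X ((ch x₀).symm y))

theorem contDiffOn_chartField [CompleteSpace E] {X : ∀ x : M, TangentSpace 𝓘(ℝ, E) x}
    (hX : ContMDiff 𝓘(ℝ, E) 𝓘(ℝ, E).tangent ∞
      (fun x => (⟨x, X x⟩ : TangentBundle 𝓘(ℝ, E) M))) (x₀ : M) :
    ContDiffOn ℝ ∞ (chartField X x₀) (ch x₀).target := by
  intro y hy
  refine ContDiffAt.contDiffWithinAt ?_
  refine contMDiffAt_vectorSpace_iff_contDiffAt.1 ?_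
  have hinv : (tderiv 𝓘(ℝ, E) 𝓘(ℝ, E) (ch x₀).symm y).IsInvertible := ⟨chartSymmDeriv hy, rfl⟩
  have h := ContMDiffWithinAt.mpullback_vectorField_preimage (t := univ) (m := ∞) (n := ∞)
    (hX ((ch x₀).symm y)).contMDiffWithinAt (contMDiffAt_chart_symm hy) hinv
    le_rfl
  rw [preimage_univ, contMDiffWithinAt_univ] at h
  exact h

end Charts

/-! ### The flow of a smooth vector field -/

section Flow

variable {E : Type*} [NormedAddCommGroup E] [NormedSpace ℝ E]
  {M : Type*} [TopologicalSpace M] [ChartedSpace E M]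

/-- The set of `(s, x)` such that the integral curve from `x` is defined on an interval around
`0` and `s`. -/
def flowDomain (X : ∀ x : M, TangentSpace 𝓘(ℝ, E) x) : Set (ℝ × M) :=
  {p | ∃ (γ : ℝ → M) (a b : ℝ), 0 ∈ Ioo a b ∧ p.1 ∈ Ioo a b ∧ γ 0 = p.2 ∧
    IsMIntegralCurveOn γ X (Ioo a b)}

open Classical in
/-- The flow of a vector field. -/
def fl (X : ∀ x : M, TangentSpace 𝓘(ℝ, E) x) (s : ℝ) (x : M) : M :=
  if h : (s, x) ∈ flowDomain X then h.choose s else x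

/-- The value of a vector field as an element of the model space. -/
def vec (X : ∀ x : M, TangentSpace 𝓘(ℝ, E) x) (x : M) : E := X x

/-- Smoothness of a vector field. -/
def SmoothField (X : ∀ x : M, TangentSpace 𝓘(ℝ, E) x) [IsManifold 𝓘(ℝ, E) ∞ M] : Prop :=
  ContMDiff 𝓘(ℝ, E) 𝓘(ℝ, E).tangent ∞ (fun x => (⟨x, X x⟩ : TangentBundle 𝓘(ℝ, E) M))

variable {X : ∀ x : M, TangentSpace 𝓘(ℝ, E) x}

theorem mem_flowDomain_of_curve {γ : ℝ → M} {a b s : ℝ} (h0 : 0 ∈ Ioo a b) (hs : s ∈ Ioo a b)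
    (hγ : IsMIntegralCurveOn γ X (Ioo a b)) : (s, γ 0) ∈ flowDomain X :=
  ⟨γ, a, b, h0, hs, rfl, hγ⟩

theorem isMIntegralCurveOn_congr {γ γ' : ℝ → M} {s : Set ℝ} (h : IsMIntegralCurveOn γ X s)
    (he : ∀ u ∈ s, γ' u = γ u) : IsMIntegralCurveOn γ' X s := by
  intro t ht
  have h1 := (h t ht).congr_of_eventuallyEq
    (Filter.eventuallyEq_of_mem self_mem_nhdsWithin he) (he t ht)
  have h2 : γ' t = γ t := he t ht
  rw [← h2] at h1
  exact h1

variable [IsManifold 𝓘(ℝ, E) ∞ M]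

theorem SmoothField.c1 (hX : SmoothField X) : ContMDiff 𝓘(ℝ, E) 𝓘(ℝ, E).tangent 1
    (fun x => (⟨x, X x⟩ : TangentBundle 𝓘(ℝ, E) M)) := ContMDiff.of_le hX (by simp)

variable [T2Space M]

/-- Uniqueness of integral curves on the intersection of two intervals makes the choice in `fl`
harmless. -/
theorem fl_eq_of_curve (hX : SmoothField X) {γ : ℝ → M} {a b s : ℝ} (h0 : 0 ∈ Ioo a b)
    (hs : s ∈ Ioo a b) (hγ : IsMIntegralCurveOn γ X (Ioo a b)) : fl X s (γ 0) = γ s := by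
  have h : (s, γ 0) ∈ flowDomain X := mem_flowDomain_of_curve h0 hs hγ
  rw [fl, dif_pos h]
  obtain ⟨a', b', h0', hs', hγ0', hγ'⟩ := h.choose_spec
  have := IsManifold.of_le (m := 1) (n := ∞) (I := 𝓘(ℝ, E)) (M := M) (by simp)
  refine isMIntegralCurveOn_Ioo_eqOn_of_contMDiff_boundaryless (a := max a a') (b := min b b')
    (t₀ := 0) ⟨max_lt h0.1 h0'.1, lt_min h0.2 h0'.2⟩ hX.c1
    (hγ'.mono ?_) (hγ.mono ?_) hγ0' ⟨max_lt hs.1 hs'.1, lt_min hs.2 hs'.2⟩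
  · exact Ioo_subset_Ioo (le_max_right _ _) (min_le_right _ _)
  · exact Ioo_subset_Ioo (le_max_left _ _) (min_le_left _ _)

theorem exists_curve_fl (hX : SmoothField X) {s : ℝ} {x : M} (h : (s, x) ∈ flowDomain X) :
    ∃ a b, 0 ∈ Ioo a b ∧ s ∈ Ioo a b ∧ (∀ u ∈ Ioo a b, (u, x) ∈ flowDomain X) ∧ fl X 0 x = x ∧
      IsMIntegralCurveOn (fun u => fl X u x) X (Ioo a b) := by
  obtain ⟨γ, a, b, h0, hs, hγ0, hγ⟩ := h
  have h0' : γ 0 = x := hγ0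
  subst h0'
  refine ⟨a, b, h0, hs, fun u hu => mem_flowDomain_of_curve h0 hu hγ,
    fl_eq_of_curve hX h0 h0 hγ, isMIntegralCurveOn_congr hγ fun u hu => ?_⟩
  exact fl_eq_of_curve hX h0 hu hγ

theorem flowDomain_add (hX : SmoothField X) {s r : ℝ} {x : M} (hs : (s, x) ∈ flowDomain X)
    (hr : (r, fl X s x) ∈ flowDomain X) :
    (s + r, x) ∈ flowDomain X ∧ fl X (s + r) x = fl X r (fl X s x) := by
  obtain ⟨a, b, h0, hs', -, hx0, hγ⟩ := exists_curve_fl hX hs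
  obtain ⟨a', b', h0', hr', -, hy0, hγ'⟩ := exists_curve_fl hX hr
  have := IsManifold.of_le (m := 1) (n := ∞) (I := 𝓘(ℝ, E)) (M := M) (by simp)
  have hγ'' : IsMIntegralCurveOn (fun u => fl X (u - s) (fl X s x)) X (Ioo (a' + s) (b' + s)) := by
    have h := hγ'.comp_add (-s)
    refine IsMIntegralCurveOn.mono h fun u hu => ?_
    change u + -s ∈ Ioo a' b'
    exact ⟨by linarith [hu.1], by linarith [hu.2]⟩
  have hs'' : s ∈ Ioo (a' + s) (b' + s) := ⟨by linarith [h0'.1], by linarith [h0'.2]⟩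
  have heq : fl X s x = fl X (s - s) (fl X s x) := by rw [sub_self, hy0]
  have hp := isMIntegralCurveOn_piecewise hX.c1 hγ hγ'' ⟨hs', hs''⟩ heq
  have hpe := eqOn_piecewise_of_isMIntegralCurveOn_Ioo hX.c1 hγ hγ'' ⟨hs', hs''⟩ heq
  rw [Ioo_union_Ioo' (by linarith [hs'.2, hs''.1]) (by linarith [hs'.1, hs''.2])] at hp
  have hm0 : (0 : ℝ) ∈ Ioo (min a (a' + s)) (max b (b' + s)) :=
    ⟨(min_le_left _ _).trans_lt h0.1, h0.2.trans_le (le_max_left _ _)⟩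
  have hmr : s + r ∈ Ioo (min a (a' + s)) (max b (b' + s)) :=
    ⟨(min_le_right _ _).trans_lt (by linarith [hr'.1]),
      lt_of_lt_of_le (by linarith [hr'.2]) (le_max_right _ _)⟩
  have hsr : s + r ∈ Ioo (a' + s) (b' + s) := ⟨by linarith [hr'.1], by linarith [hr'.2]⟩
  have hz := mem_flowDomain_of_curve hm0 hmr hp
  have hz' := fl_eq_of_curve hX hm0 hmr hp
  rw [piecewise_eq_of_mem _ _ _ h0, hx0] at hz hz'
  refine ⟨hz, hz'.trans ?_⟩
  rw [hpe hsr]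
  simp

theorem flowDomain_neg (hX : SmoothField X) {s : ℝ} {x : M} (hs : (s, x) ∈ flowDomain X) :
    (-s, fl X s x) ∈ flowDomain X ∧ fl X (-s) (fl X s x) = x := by
  obtain ⟨a, b, h0, hs', -, hx0, hγ⟩ := exists_curve_fl hX hs
  have h : IsMIntegralCurveOn (fun u => fl X (u + s) x) X (Ioo (a - s) (b - s)) := by
    refine IsMIntegralCurveOn.mono (hγ.comp_add s) fun u hu => ?_
    change u + s ∈ Ioo a b
    exact ⟨by linarith [hu.1], by linarith [hu.2]⟩
  have h0' : (0 : ℝ) ∈ Ioo (a - s) (b - s) := ⟨by linarith [hs'.1], by linarith [hs'.2]⟩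
  have hs'' : -s ∈ Ioo (a - s) (b - s) := ⟨by linarith [h0.1], by linarith [h0.2]⟩
  have h1 := mem_flowDomain_of_curve h0' hs'' h
  have h2 := fl_eq_of_curve hX h0' hs'' h
  simp only [zero_add, neg_add_cancel] at h1 h2
  exact ⟨h1, h2.trans hx0⟩

theorem flowDomain_sub (hX : SmoothField X) {s u : ℝ} {x : M} (hs : (s, x) ∈ flowDomain X)
    (hu : (u, x) ∈ flowDomain X) :
    (u - s, fl X s x) ∈ flowDomain X ∧ fl X (u - s) (fl X s x) = fl X u x := by
  obtain ⟨h1, h2⟩ := flowDomain_neg hX hs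
  have h := flowDomain_add hX h1 (r := u) (by rwa [h2])
  rw [h2, neg_add_eq_sub] at h
  exact h

/-- Smooth local flow on a manifold. -/
theorem exists_local_fl [FiniteDimensional ℝ E] (hX : SmoothField X) (x₀ : M) :
    ∃ δ > 0, ∃ N : Set M, IsOpen N ∧ x₀ ∈ N ∧
      (∀ x ∈ N, ∀ s ∈ Ioo (-δ) δ, (s, x) ∈ flowDomain X) ∧
      ContMDiffOn (𝓘(ℝ, ℝ).prod 𝓘(ℝ, E)) 𝓘(ℝ, E) ∞ (Function.uncurry (fl X))
        (Ioo (-δ) δ ×ˢ N) := by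
  let c := extChartAt 𝓘(ℝ, E) x₀
  have htar : IsOpen c.target := isOpen_extChartAt_target x₀
  obtain ⟨φ, δ, hδ, hφ, h⟩ := exists_local_flow htar (contDiffOn_chartField hX x₀)
    (mem_extChartAt_target x₀)
  have hN : IsOpen (c.source ∩ c ⁻¹' Metric.ball (c x₀) δ) :=
    (continuousOn_extChartAt x₀).isOpen_inter_preimage (isOpen_extChartAt_source x₀)
      Metric.isOpen_ball
  have hball : Metric.ball (0 : ℝ) δ = Ioo (-δ) δ := by rw [Real.ball_eq_Ioo]; simp
  have hint : ∀ x ∈ c.source ∩ c ⁻¹' Metric.ball (c x₀) δ,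
      IsMIntegralCurveOn (fun s => c.symm (φ (s, c x))) X (Ioo (-δ) δ) := by
    intro x hx s hs
    obtain ⟨hmem, hd⟩ := (h (c x) hx.2).2 s (by rwa [hball])
    refine HasMFDerivAt.hasMFDerivWithinAt ?_
    have hd' : HasTD 𝓘(ℝ, ℝ) 𝓘(ℝ, E) (fun s => φ (s, c x)) s
        ((1 : ℝ →L[ℝ] ℝ).smulRight (chartField X x₀ (φ (s, c x)))) := by
      refine hasTD_iff_hasFDerivAt.2 (hd.hasFDerivAt.congr_fderiv ?_)
      ext
      simp
    have h2 := (hasTD_chart_symm hmem).comp hd' rfl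
    have h3 : tderiv 𝓘(ℝ, E) 𝓘(ℝ, E) c.symm (φ (s, c x)) ∘L
        ((1 : ℝ →L[ℝ] ℝ).smulRight (chartField X x₀ (φ (s, c x)))) =
        (1 : ℝ →L[ℝ] ℝ).smulRight (X (c.symm (φ (s, c x))) : E) := by
      ext
      change tderiv 𝓘(ℝ, E) 𝓘(ℝ, E) c.symm (φ (s, c x))
        ((1 : ℝ) • chartField X x₀ (φ (s, c x))) = (1 : ℝ) • (X (c.symm (φ (s, c x))) : E)
      rw [one_smul, one_smul]
      exact tderiv_chart_symm_chartField X hmem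
    rw [h3] at h2
    exact h2
  have h0 : (0 : ℝ) ∈ Ioo (-δ) δ := ⟨by linarith, hδ⟩
  have hzero : ∀ x ∈ c.source ∩ c ⁻¹' Metric.ball (c x₀) δ, c.symm (φ (0, c x)) = x := by
    intro x hx
    rw [(h (c x) hx.2).1]
    exact c.left_inv hx.1
  refine ⟨δ, hδ, _, hN, ⟨mem_extChartAt_source x₀, Metric.mem_ball_self hδ⟩, ?_, ?_⟩
  · intro x hx s hs
    have := mem_flowDomain_of_curve h0 hs (hint x hx)
    rwa [hzero x hx] at this
  · have heq : ∀ p ∈ Ioo (-δ) δ ×ˢ (c.source ∩ c ⁻¹' Metric.ball (c x₀) δ),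
        Function.uncurry (fl X) p = c.symm (φ (p.1, c p.2)) := by
      rintro ⟨s, x⟩ ⟨hs, hx⟩
      have := fl_eq_of_curve hX h0 hs (hint x hx)
      rw [hzero x hx] at this
      exact this
    refine ContMDiffOn.congr ?_ heq
    rintro ⟨s, x⟩ ⟨hs, hx⟩
    refine ContMDiffAt.contMDiffWithinAt ?_
    have hs' : s ∈ Metric.ball (0 : ℝ) δ := by rwa [hball]
    have h1 : ContMDiffAt (𝓘(ℝ, ℝ).prod 𝓘(ℝ, E)) 𝓘(ℝ, E) ∞ (fun p : ℝ × M => c p.2) (s, x) :=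
      ContMDiffAt.comp (s, x) (contMDiffAt_chart hx.1) contMDiffAt_snd
    have h2 : ContMDiffAt (𝓘(ℝ, ℝ).prod 𝓘(ℝ, E)) 𝓘(ℝ, ℝ × E) ∞
        (fun p : ℝ × M => (p.1, c p.2)) (s, x) := contMDiffAt_fst.prodMk_space h1
    have h3 : ContMDiffAt 𝓘(ℝ, ℝ × E) 𝓘(ℝ, E) ∞ φ (s, c x) :=
      (hφ.contDiffAt (prod_mem_nhds (Metric.isOpen_ball.mem_nhds hs')
        (Metric.isOpen_ball.mem_nhds hx.2))).contMDiffAt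
    exact ContMDiffAt.comp (s, x) (contMDiffAt_chart_symm ((h (c x) hx.2).2 s hs').1)
      (ContMDiffAt.comp (s, x) h3 h2)

/-- Being good, i.e. `fl` being defined and smooth near `(s, x₀)`, propagates in `s`. Near the point
reached at time `y`, the local flow has a uniform lifetime `δ`, and composing with it transfers
goodness between `y` and nearby times in both directions. Connectedness of the interval carries it
from `0` to `s`. -/
theorem eventually_mem_flowDomain_contMDiffAt [FiniteDimensional ℝ E] (hX : SmoothField X)
    {s : ℝ} {x₀ : M} (hs : (s, x₀) ∈ flowDomain X) :
    ∀ᶠ q in 𝓝 (s, x₀), q ∈ flowDomain X ∧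
      ContMDiffAt (𝓘(ℝ, ℝ).prod 𝓘(ℝ, E)) 𝓘(ℝ, E) ∞ (Function.uncurry (fl X)) q := by
  obtain ⟨a, b, h0, hs', hD, hx0, hγ⟩ := exists_curve_fl hX hs
  let R : ℝ → Prop := fun s => ∀ᶠ q in 𝓝 (s, x₀), q ∈ flowDomain X ∧
      ContMDiffAt (𝓘(ℝ, ℝ).prod 𝓘(ℝ, E)) 𝓘(ℝ, E) ∞ (Function.uncurry (fl X)) q
  have hR0 : R 0 := by
    obtain ⟨δ, hδ, N, hN, hx₀, hmem, hsm⟩ := exists_local_fl hX x₀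
    have ho : IsOpen (Ioo (-δ) δ ×ˢ N) := isOpen_Ioo.prod hN
    filter_upwards [ho.mem_nhds ⟨⟨by simpa using hδ, hδ⟩, hx₀⟩] with q hq
    exact ⟨hmem q.2 hq.2 q.1 hq.1, hsm.contMDiffAt (ho.mem_nhds hq)⟩
  have key : ∀ y ∈ Ioo a b, ∀ᶠ z in 𝓝[Ioo a b] y, (R y → R z) ∧ (R z → R y) := by
    intro y hy
    obtain ⟨δ, hδ, N, hN, hyN, hmem, hsm⟩ := exists_local_fl hX (fl X y x₀)
    have hcont : ContinuousWithinAt (fun u => fl X u x₀) (Ioo a b) y := hγ.continuousOn y hy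
    have step : ∀ u v : ℝ, fl X u x₀ ∈ N → v - u ∈ Ioo (-δ) δ → R u → R v := by
      intro u v hu huv hRu
      have hmap : Filter.Tendsto (fun q : ℝ × M => (q.1 - (v - u), q.2)) (𝓝 (v, x₀))
          (𝓝 (u, x₀)) := by
        have : Continuous (fun q : ℝ × M => (q.1 - (v - u), q.2)) := by fun_prop
        simpa using this.tendsto (v, x₀)
      have hfc : ContinuousAt (Function.uncurry (fl X)) (u, x₀) :=
        hRu.self_of_nhds.2.continuousAt
      filter_upwards [hmap.eventually hRu,
        hmap.eventually (hfc.preimage_mem_nhds (hN.mem_nhds hu)),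
        hmap.eventually hRu.eventually_nhds] with q hq1 hq2 hq3
      have hq2' : fl X (q.1 - (v - u)) q.2 ∈ N := hq2
      have hadd : ∀ p : ℝ × M, (p.1 - (v - u), p.2) ∈ flowDomain X →
          fl X (p.1 - (v - u)) p.2 ∈ N → p ∈ flowDomain X ∧
          fl X p.1 p.2 = fl X (v - u) (fl X (p.1 - (v - u)) p.2) := by
        intro p hp hpN
        have := flowDomain_add hX hp (hmem _ hpN _ huv)
        rwa [sub_add_cancel] at this
      refine ⟨(hadd q hq1.1 hq2').1, ?_⟩
      have hg : ContMDiffAt (𝓘(ℝ, ℝ).prod 𝓘(ℝ, E)) (𝓘(ℝ, ℝ).prod 𝓘(ℝ, E)) ∞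
          (fun p : ℝ × M => (p.1 - (v - u), p.2)) q :=
        ContMDiffAt.prodMk (contMDiffAt_fst.sub contMDiffAt_const) contMDiffAt_snd
      have hinner : ContMDiffAt (𝓘(ℝ, ℝ).prod 𝓘(ℝ, E)) 𝓘(ℝ, E) ∞
          (fun p : ℝ × M => fl X (p.1 - (v - u)) p.2) q := ContMDiffAt.comp q hq1.2 hg
      have hpair : ContMDiffAt (𝓘(ℝ, ℝ).prod 𝓘(ℝ, E)) (𝓘(ℝ, ℝ).prod 𝓘(ℝ, E)) ∞
          (fun p : ℝ × M => (v - u, fl X (p.1 - (v - u)) p.2)) q :=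
        contMDiffAt_const.prodMk hinner
      have houter : ContMDiffAt (𝓘(ℝ, ℝ).prod 𝓘(ℝ, E)) 𝓘(ℝ, E) ∞ (Function.uncurry (fl X))
          (v - u, fl X (q.1 - (v - u)) q.2) :=
        hsm.contMDiffAt ((isOpen_Ioo.prod hN).mem_nhds ⟨huv, hq2'⟩)
      refine (ContMDiffAt.comp q houter hpair).congr_of_eventuallyEq ?_
      have hev : ∀ᶠ p in 𝓝 q, (p.1 - (v - u), p.2) ∈ flowDomain X := by
        have hc : Continuous (fun q : ℝ × M => (q.1 - (v - u), q.2)) := by fun_prop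
        filter_upwards [hc.continuousAt.eventually hq3] with p hp using hp.1
      filter_upwards [hev, hinner.continuousAt.preimage_mem_nhds (hN.mem_nhds hq2')] with p hp1 hp2
      exact (hadd p hp1 hp2).2
    have hnear : ∀ᶠ z in 𝓝[Ioo a b] y, z ∈ Ioo (y - δ) (y + δ) :=
      mem_nhdsWithin_of_mem_nhds (isOpen_Ioo.mem_nhds ⟨by linarith, by linarith⟩)
    filter_upwards [hcont.preimage_mem_nhdsWithin (hN.mem_nhds hyN), hnear] with z hz1 hz2
    refine ⟨step y z hyN ⟨by linarith [hz2.1], by linarith [hz2.2]⟩,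
      step z y hz1 ⟨by linarith [hz2.2], by linarith [hz2.1]⟩⟩
  exact isPreconnected_Ioo.induction₂' (fun u v => R u → R v) key
    (fun _ _ _ _ _ _ h1 h2 h => h2 (h1 h)) h0 hs' hR0

theorem isOpen_flowDomain [FiniteDimensional ℝ E] (hX : SmoothField X) :
    IsOpen (flowDomain X) :=
  isOpen_iff_mem_nhds.2 fun _ hp =>
    (eventually_mem_flowDomain_contMDiffAt hX hp).mono fun _ hq => hq.1

theorem contMDiffAt_fl [FiniteDimensional ℝ E] (hX : SmoothField X) {s : ℝ} {x : M}
    (h : (s, x) ∈ flowDomain X) :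
    ContMDiffAt (𝓘(ℝ, ℝ).prod 𝓘(ℝ, E)) 𝓘(ℝ, E) ∞ (Function.uncurry (fl X)) (s, x) :=
  (eventually_mem_flowDomain_contMDiffAt hX h).self_of_nhds.2

theorem flowDomain_zero [FiniteDimensional ℝ E] (hX : SmoothField X) (x : M) :
    (0, x) ∈ flowDomain X ∧ fl X 0 x = x := by
  obtain ⟨δ, hδ, N, -, hxN, hmem, -⟩ := exists_local_fl hX x
  have h := hmem x hxN 0 ⟨by linarith, hδ⟩
  obtain ⟨-, -, -, -, -, h0, -⟩ := exists_curve_fl hX h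
  exact ⟨h, h0⟩

/-- An integral curve on a closed interval extends to a neighbourhood of that interval. -/
theorem fl_eq_of_curve_Icc [FiniteDimensional ℝ E] (hX : SmoothField X) {γ : ℝ → M} {t : ℝ}
    (ht : 0 ≤ t) (hγ : IsMIntegralCurveOn γ X (Icc 0 t)) :
    ∀ s ∈ Icc 0 t, (s, γ 0) ∈ flowDomain X ∧ fl X s (γ 0) = γ s := by
  rcases ht.eq_or_lt with rfl | ht
  · intro s hs
    obtain rfl : s = 0 := le_antisymm hs.2 hs.1
    exact flowDomain_zero hX _
  obtain ⟨a, b, hab0, -, -, hx0, hβ⟩ := exists_curve_fl hX (flowDomain_zero hX (γ 0)).1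
  obtain ⟨a', b', hab0', -, -, hy0, hβ'⟩ := exists_curve_fl hX (flowDomain_zero hX (γ t)).1
  have hβ'' : IsMIntegralCurveOn (fun u => fl X (u - t) (γ t)) X (Ioo (a' + t) (b' + t)) := by
    have h := hβ'.comp_add (-t)
    refine IsMIntegralCurveOn.mono h fun u hu => ?_
    change u + -t ∈ Ioo a' b'
    exact ⟨by linarith [hu.1], by linarith [hu.2]⟩
  -- The curve is continued at both ends by the flow of its end points, so that the one-sided
  -- derivatives at `0` and `t` become two-sided.
  let Γ : ℝ → M := fun s => if s ≤ 0 then fl X s (γ 0) else if s ≤ t then γ s else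
    fl X (s - t) (γ t)
  have hΓ1 : ∀ s ∈ Ioc a 0, Γ s = fl X s (γ 0) := fun s hs => if_pos hs.2
  have hΓ2 : ∀ s ∈ Icc 0 t, Γ s = γ s := by
    intro s hs
    rcases hs.1.eq_or_lt with rfl | h
    · exact (if_pos le_rfl).trans hx0
    · exact (if_neg h.not_ge).trans (if_pos hs.2)
  have hΓ3 : ∀ s ∈ Ico t (b' + t), Γ s = fl X (s - t) (γ t) := by
    intro s hs
    rcases hs.1.eq_or_lt with rfl | h
    · rw [hΓ2 _ ⟨ht.le, le_rfl⟩, sub_self, hy0]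
    · exact (if_neg (ht.trans h).not_ge).trans (if_neg h.not_ge)
  have h1 := isMIntegralCurveOn_congr (hβ.mono (Ioc_subset_Ioo_right hab0.2)) hΓ1
  have h2 := isMIntegralCurveOn_congr hγ hΓ2
  have h3 := isMIntegralCurveOn_congr (hβ''.mono (Ico_subset_Ioo_left (by linarith [hab0'.1]))) hΓ3
  have hint : IsMIntegralCurveOn Γ X (Ioo a (b' + t)) := by
    intro s hs
    refine HasMFDerivAt.hasMFDerivWithinAt ?_
    refine hasMFDerivWithinAt_univ.1 ?_
    rcases lt_trichotomy s 0 with h | rfl | h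
    · exact (h1 s ⟨hs.1, h.le⟩).mono_of_mem_nhdsWithin
        (by rw [nhdsWithin_univ]; exact Ioc_mem_nhds hs.1 h)
    · refine ((h1 0 ⟨hs.1, le_rfl⟩).union (h2 0 ⟨le_rfl, ht.le⟩)).mono_of_mem_nhdsWithin ?_
      rw [nhdsWithin_univ, Ioc_union_Icc_eq_Ioc hab0.1 ht.le]
      exact Ioc_mem_nhds hs.1 ht
    · rcases lt_trichotomy s t with h' | rfl | h'
      · exact (h2 s ⟨h.le, h'.le⟩).mono_of_mem_nhdsWithin
          (by rw [nhdsWithin_univ]; exact Icc_mem_nhds h h')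
      · refine ((h2 s ⟨h.le, le_rfl⟩).union (h3 s ⟨le_rfl, hs.2⟩)).mono_of_mem_nhdsWithin ?_
        rw [nhdsWithin_univ, Icc_union_Ico_eq_Ico h.le (by linarith [hab0'.2])]
        exact Ico_mem_nhds h hs.2
      · exact (h3 s ⟨h'.le, hs.2⟩).mono_of_mem_nhdsWithin
          (by rw [nhdsWithin_univ]; exact Ico_mem_nhds h' hs.2)
  have h0Γ : Γ 0 = γ 0 := hΓ2 0 ⟨le_rfl, ht.le⟩
  intro s hs
  have hm0 : (0 : ℝ) ∈ Ioo a (b' + t) := ⟨hab0.1, by linarith [hab0'.2]⟩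
  have hms : s ∈ Ioo a (b' + t) := ⟨hab0.1.trans_le hs.1, by linarith [hs.2, hab0'.2]⟩
  have h4 := mem_flowDomain_of_curve hm0 hms hint
  have h5 := fl_eq_of_curve hX hm0 hms hint
  rw [h0Γ] at h4 h5
  exact ⟨h4, h5.trans (hΓ2 s hs)⟩

/-! ### Derivatives of the flow -/

theorem hasTD_fl_time (hX : SmoothField X) {s : ℝ} {x : M} (h : (s, x) ∈ flowDomain X) :
    HasTD 𝓘(ℝ, ℝ) 𝓘(ℝ, E) (fun u => fl X u x) s
      ((1 : ℝ →L[ℝ] ℝ).smulRight (vec X (fl X s x))) := by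
  obtain ⟨a, b, -, hs, -, -, hγ⟩ := exists_curve_fl hX h
  exact (hγ s hs).hasMFDerivAt (isOpen_Ioo.mem_nhds hs)

/-- The derivative of the flow at a fixed time. -/
def dfl (X : ∀ x : M, TangentSpace 𝓘(ℝ, E) x) (s : ℝ) (x : M) : E →L[ℝ] E :=
  tderiv 𝓘(ℝ, E) 𝓘(ℝ, E) (fl X s) x

theorem contMDiffAt_fl_right [FiniteDimensional ℝ E] (hX : SmoothField X) {s : ℝ} {x : M}
    (h : (s, x) ∈ flowDomain X) : ContMDiffAt 𝓘(ℝ, E) 𝓘(ℝ, E) ∞ (fl X s) x := by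
  have h2 : ContMDiffAt 𝓘(ℝ, E) (𝓘(ℝ, ℝ).prod 𝓘(ℝ, E)) ∞ (fun z : M => (s, z)) x :=
    contMDiffAt_const.prodMk contMDiffAt_id
  exact ContMDiffAt.comp x (contMDiffAt_fl hX h) h2

theorem hasTD_fl_right [FiniteDimensional ℝ E] (hX : SmoothField X) {s : ℝ} {x : M}
    (h : (s, x) ∈ flowDomain X) : HasTD 𝓘(ℝ, E) 𝓘(ℝ, E) (fl X s) x (dfl X s x) :=
  hasTD_of_contMDiffAt (contMDiffAt_fl_right hX h) (by simp)

theorem hasTD_fl [FiniteDimensional ℝ E] (hX : SmoothField X) {s : ℝ} {x : M}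
    (h : (s, x) ∈ flowDomain X) :
    HasTD (𝓘(ℝ, ℝ).prod 𝓘(ℝ, E)) 𝓘(ℝ, E) (Function.uncurry (fl X)) (s, x)
      (((1 : ℝ →L[ℝ] ℝ).smulRight (vec X (fl X s x))).coprod (dfl X s x)) := by
  have hL := hasTD_of_contMDiffAt (contMDiffAt_fl hX h) (by simp)
  convert hL using 1
  have h1 := hL.comp ((hasTD_id s).prodMk (hasTD_const x s)) rfl
  have h2 := hL.comp ((hasTD_const s x).prodMk (hasTD_id x)) rfl
  have e1 := (hasTD_fl_time hX h).unique h1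
  have e2 := (hasTD_fl_right hX h).unique h2
  rw [e1, e2]
  ext <;> simp

theorem HasTD.fl_comp [FiniteDimensional ℝ E] (hX : SmoothField X)
    {E' : Type*} [NormedAddCommGroup E'] [NormedSpace ℝ E']
    {H' : Type*} [TopologicalSpace H'] {I' : ModelWithCorners ℝ E' H'}
    {N : Type*} [TopologicalSpace N] [ChartedSpace H' N] {θ : N → ℝ} {G : N → M} {z : N}
    {θ' : E' →L[ℝ] ℝ} {G' : E' →L[ℝ] E} (hθ : HasTD I' 𝓘(ℝ, ℝ) θ z θ')
    (hG : HasTD I' 𝓘(ℝ, E) G z G') (h : (θ z, G z) ∈ flowDomain X) :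
    HasTD I' 𝓘(ℝ, E) (fun w => fl X (θ w) (G w)) z
      (θ'.smulRight (vec X (fl X (θ z) (G z))) + dfl X (θ z) (G z) ∘L G') := by
  have := (hasTD_fl hX h).comp (hθ.prodMk hG) rfl
  have he : θ'.smulRight (vec X (fl X (θ z) (G z))) + dfl X (θ z) (G z) ∘L G' =
      ((1 : ℝ →L[ℝ] ℝ).smulRight (vec X (fl X (θ z) (G z)))).coprod (dfl X (θ z) (G z)) ∘L
        θ'.prod G' := by
    ext v
    simp
  rw [he]
  exact this

theorem dfl_add [FiniteDimensional ℝ E] (hX : SmoothField X) {s r : ℝ} {x : M}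
    (hs : (s, x) ∈ flowDomain X) (hr : (r, fl X s x) ∈ flowDomain X) :
    dfl X (s + r) x = dfl X r (fl X s x) ∘L dfl X s x := by
  have h := (hasTD_fl_right hX hr).comp (hasTD_fl_right hX hs) rfl
  refine (hasTD_fl_right hX (flowDomain_add hX hs hr).1).unique (h.congr ?_)
  have hc1 : Continuous (fun z : M => (s, z)) := by fun_prop
  have hc2 : ContinuousAt (fun z : M => (r, fl X s z)) x :=
    continuousAt_const.prodMk (contMDiffAt_fl_right hX hs).continuousAt
  filter_upwards [hc1.continuousAt.preimage_mem_nhds ((isOpen_flowDomain hX).mem_nhds hs),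
    hc2.preimage_mem_nhds ((isOpen_flowDomain hX).mem_nhds hr)] with z hz1 hz2
  exact (flowDomain_add hX hz1 hz2).2

theorem dfl_zero [FiniteDimensional ℝ E] (hX : SmoothField X) (x : M) :
    dfl X 0 x = ContinuousLinearMap.id ℝ E := by
  refine (hasTD_fl_right hX (flowDomain_zero hX x).1).unique ((hasTD_id x).congr ?_)
  exact Filter.Eventually.of_forall fun z => (flowDomain_zero hX z).2

/-- The flow preserves the vector field. -/
theorem dfl_field [FiniteDimensional ℝ E] (hX : SmoothField X) {s : ℝ} {x : M}
    (hs : (s, x) ∈ flowDomain X) : dfl X s x (vec X x) = vec X (fl X s x) := by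
  have h0 := (flowDomain_zero hX x)
  have hc1 : Continuous (fun u : ℝ => (u, x)) := by fun_prop
  have hd0 := hasTD_fl_time hX h0.1
  have h1 := (hasTD_fl_right hX hs).comp hd0 h0.2
  have hsum : HasTD 𝓘(ℝ, ℝ) 𝓘(ℝ, ℝ) (fun u : ℝ => u + s) 0 (ContinuousLinearMap.id ℝ ℝ) :=
    hasTD_iff_hasFDerivAt.2 ((hasFDerivAt_id (0 : ℝ)).add_const s)
  have h2 := (hasTD_fl_time hX hs).comp hsum (zero_add s)
  have heq : (fun u => fl X s (fl X u x)) =ᶠ[𝓝 0] fun u => fl X (u + s) x := by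
    have hc2 : ContinuousAt (fun u : ℝ => (s, fl X u x)) 0 :=
      continuousAt_const.prodMk hd0.continuousAt
    filter_upwards [hc1.continuousAt.preimage_mem_nhds ((isOpen_flowDomain hX).mem_nhds h0.1),
      hc2.preimage_mem_nhds ((isOpen_flowDomain hX).mem_nhds (by rwa [h0.2]))] with u hu1 hu2
    exact (flowDomain_add hX hu1 hu2).2.symm
  have h3 := DFunLike.congr_fun (h1.unique (h2.congr heq)) 1
  simpa [h0.2] using h3

end Flow

/-! ### The Lie derivative and invariance under the flow -/

section Lie

variable {E : Type*} [NormedAddCommGroup E] [NormedSpace ℝ E]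

theorem hasDerivAt_alternating_apply {m : ℕ} {g : ℝ → E [⋀^Fin m]→L[ℝ] ℝ}
    {g' : E [⋀^Fin m]→L[ℝ] ℝ} {u : Fin m → ℝ → E} {u' : Fin m → E} {t : ℝ}
    (hg : HasDerivAt g g' t) (hu : ∀ i, HasDerivAt (u i) (u' i) t) :
    HasDerivAt (fun s => g s (fun i => u i s))
      (g' (fun i => u i t) + ∑ i, g t (Function.update (fun j => u j t) i (u' i))) t := by
  have h1 : HasFDerivAt
      (fun s => ContinuousAlternatingMap.toContinuousMultilinearMapCLM ℝ (g s)) _ t :=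
    (ContinuousLinearMap.hasFDerivAt _).comp t hg.hasFDerivAt
  have h2 := (h1.continuousMultilinearMap_apply fun i => (hu i).hasFDerivAt).hasDerivAt
  refine h2.congr_deriv ?_
  simp [ContinuousMultilinearMap.toContinuousLinearMap]

variable {M : Type*} [TopologicalSpace M] [ChartedSpace E M]

/-- The value of a form as an alternating map on the model space. -/
def frm {m : ℕ} (α : Form E M m) (x : M) : E [⋀^Fin m]→L[ℝ] ℝ := α x

local notation "ch" => extChartAt 𝓘(ℝ, E)

variable [IsManifold 𝓘(ℝ, E) ∞ M]

theorem frm_apply_eq_inChart {m : ℕ} (α : Form E M m) {x₀ x : M} (hx : x ∈ (ch x₀).source)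
    (v : Fin m → E) :
    frm α x v = α.inChart x₀ (ch x₀ x) (fun i => tderiv 𝓘(ℝ, E) 𝓘(ℝ, E) (ch x₀) x (v i)) := by
  have h : α.inChart x₀ (ch x₀ x) (fun i => tderiv 𝓘(ℝ, E) 𝓘(ℝ, E) (ch x₀) x (v i)) =
      frm α ((ch x₀).symm (ch x₀ x)) (fun i => tderiv 𝓘(ℝ, E) 𝓘(ℝ, E) (ch x₀).symm (ch x₀ x)
        (tderiv 𝓘(ℝ, E) 𝓘(ℝ, E) (ch x₀) x (v i))) := rfl
  rw [h, (ch x₀).left_inv hx]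
  congr 1
  ext i
  exact (DFunLike.congr_fun (tderiv_chart_symm_comp hx) (v i)).symm

variable [T2Space M] [FiniteDimensional ℝ E] {X : ∀ x : M, TangentSpace 𝓘(ℝ, E) x}

/-- In a chart this is the product rule together with symmetry of second derivatives. The chart is
centred at an arbitrary `x₀`, although `lieDeriv` uses the one at the point itself: a fixed chart is
needed to pass to limits of points. -/
theorem hasDerivAt_frm_fl_zero (hX : SmoothField X) {m : ℕ} {α : Form E M m} (hα : α.IsSmooth)
    {x₀ x : M} (hx : x ∈ (ch x₀).source) (v : Fin m → E) :
    HasDerivAt (fun s => frm α (fl X s x) (fun i => dfl X s x (v i)))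
      (flatLieDeriv (chartField X x₀) (α.inChart x₀) (ch x₀ x)
        (fun i => tderiv 𝓘(ℝ, E) 𝓘(ℝ, E) (ch x₀) x (v i))) 0 := by
  let c := ch x₀
  let y := c x
  have hy : y ∈ c.target := c.map_source hx
  let ψ : ℝ × E → E := fun p => c (fl X p.1 (c.symm p.2))
  have hctar : IsOpen c.target := isOpen_extChartAt_target x₀
  have hcsrc : IsOpen c.source := isOpen_extChartAt_source x₀
  -- a neighbourhood on which everything is defined
  have hx0 := flowDomain_zero hX x
  have hin : ContinuousAt (fun p : ℝ × E => (p.1, c.symm p.2)) (0, y) :=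
    continuousAt_fst.prodMk
      (ContinuousAt.comp' (contMDiffAt_chart_symm hy).continuousAt continuousAt_snd)
  have hyx : c.symm y = x := c.left_inv hx
  have hev1 : ∀ᶠ p in 𝓝 ((0 : ℝ), y), (p.1, c.symm p.2) ∈ flowDomain X := by
    refine hin.eventually_mem ((isOpen_flowDomain hX).mem_nhds ?_)
    change (0, c.symm y) ∈ _
    rw [hyx]
    exact hx0.1
  have hflc : ContinuousAt (Function.uncurry (fl X)) (0, x) := (contMDiffAt_fl hX hx0.1).continuousAt
  have hev2 : ∀ᶠ p in 𝓝 ((0 : ℝ), y), fl X p.1 (c.symm p.2) ∈ c.source := by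
    have h1 : ContinuousAt (Function.uncurry (fl X)) ((0 : ℝ), c.symm y) := by rwa [hyx]
    refine (ContinuousAt.comp' (f := fun p : ℝ × E => (p.1, c.symm p.2)) (x := ((0 : ℝ), y))
      h1 hin).eventually_mem (hcsrc.mem_nhds ?_)
    change fl X 0 (c.symm y) ∈ _
    rw [hyx, hx0.2]
    exact hx
  have hev3 : ∀ᶠ p in 𝓝 ((0 : ℝ), y), p.2 ∈ c.target :=
    continuousAt_snd.eventually_mem (hctar.mem_nhds hy)
  have hev := hev1.and (hev2.and hev3)
  have hψ : ∀ᶠ p in 𝓝 ((0 : ℝ), y), ContDiffAt ℝ ∞ ψ p := by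
    filter_upwards [hev] with p hp
    refine contMDiffAt_iff_contDiffAt.1 ?_
    have h1 : ContMDiffAt 𝓘(ℝ, ℝ × E) 𝓘(ℝ, E) ∞ (fun p : ℝ × E => c.symm p.2) p :=
      ContMDiffAt.comp p (contMDiffAt_chart_symm hp.2.2) contDiffAt_snd.contMDiffAt
    have h2 : ContMDiffAt 𝓘(ℝ, ℝ × E) (𝓘(ℝ, ℝ).prod 𝓘(ℝ, E)) ∞
        (fun p : ℝ × E => (p.1, c.symm p.2)) p := contDiffAt_fst.contMDiffAt.prodMk h1
    exact ContMDiffAt.comp p (contMDiffAt_chart hp.2.1) (ContMDiffAt.comp p (contMDiffAt_fl hX hp.1) h2)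
  have hψ0 : ContDiffAt ℝ ∞ ψ (0, y) := hψ.self_of_nhds
  have hψfix : ∀ᶠ z in 𝓝 y, ψ (0, z) = z := by
    filter_upwards [hctar.mem_nhds hy] with z hz
    change c (fl X 0 (c.symm z)) = z
    rw [(flowDomain_zero hX _).2]
    exact c.right_inv hz
  have hψy : ψ (0, y) = y := hψfix.self_of_nhds
  -- time derivative
  have htime : ∀ᶠ p in 𝓝 ((0 : ℝ), y),
      HasDerivAt (fun s => ψ (s, p.2)) (chartField X x₀ (ψ p)) p.1 := by
    filter_upwards [hev] with p hp
    have h1 := (hasTD_chart hp.2.1).comp (hasTD_fl_time hX hp.1) rfl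
    have h2 := (hasTD_iff_hasFDerivAt.1 h1).hasDerivAt
    refine h2.congr_deriv ?_
    rw [chartField_apply X (c.map_source hp.2.1)]
    have h3 : c.symm (ψ p) = fl X p.1 (c.symm p.2) := c.left_inv hp.2.1
    change tderiv 𝓘(ℝ, E) 𝓘(ℝ, E) c (fl X p.1 (c.symm p.2))
      ((1 : ℝ) • vec X (fl X p.1 (c.symm p.2))) =
      tderiv 𝓘(ℝ, E) 𝓘(ℝ, E) c (c.symm (ψ p)) (vec X (c.symm (ψ p)))
    rw [h3, one_smul]
  have hpart : ∀ᶠ p in 𝓝 ((0 : ℝ), y), fderiv ℝ ψ p (1, 0) = chartField X x₀ (ψ p) := by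
    filter_upwards [htime, hψ] with p hp1 hp2
    have h1 : HasFDerivAt ψ (fderiv ℝ ψ p) (p.1, p.2) :=
      (hp2.differentiableAt (by simp)).hasFDerivAt
    have h2 := h1.comp_hasDerivAt p.1 ((hasDerivAt_id p.1).prodMk (hasDerivAt_const p.1 p.2))
    exact h2.unique hp1
  -- second derivatives
  have hψ1 : DifferentiableAt ℝ (fderiv ℝ ψ) (0, y) :=
    (hψ0.fderiv_right (m := ∞) (by simp)).differentiableAt (by simp)
  -- Exchanging the time and space derivatives of `ψ` gives `∂ₛ D_y ψ (w) = D (∂ₛ ψ) (w) = DV (w)`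
  -- at `s = 0`.
  have hsymm : IsSymmSndFDerivAt ℝ ψ (0, y) :=
    hψ0.isSymmSndFDerivAt (by simp only [minSmoothness_of_isRCLikeNormedField]; exact WithTop.coe_le_coe.2 (le_top : (2 : ℕ∞) ≤ ⊤))
  have hV : DifferentiableAt ℝ (chartField X x₀) y :=
    ((contDiffOn_chartField hX x₀).contDiffAt (hctar.mem_nhds hy)).differentiableAt (by simp)
  have hmixed : ∀ w : E, HasDerivAt (fun s => fderiv ℝ ψ (s, y) (0, w))
      (fderiv ℝ (chartField X x₀) y w) 0 := by
    intro w
    have h1 := hψ1.hasFDerivAt.comp_hasDerivAt (0 : ℝ)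
      ((hasDerivAt_id (0 : ℝ)).prodMk (hasDerivAt_const (0 : ℝ) y))
    have h2 := (ContinuousLinearMap.apply ℝ E ((0 : ℝ), w)).hasFDerivAt.comp_hasDerivAt (0 : ℝ) h1
    refine h2.congr_deriv ?_
    change fderiv ℝ (fderiv ℝ ψ) (0, y) (1, 0) (0, w) = _
    rw [hsymm.eq]
    have h3 : HasFDerivAt (fun z => fderiv ℝ ψ (0, z) (1, 0))
        ((ContinuousLinearMap.apply ℝ E ((1 : ℝ), (0 : E))) ∘L
          (fderiv ℝ (fderiv ℝ ψ) (0, y) ∘L ContinuousLinearMap.inr ℝ ℝ E)) y :=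
      (ContinuousLinearMap.apply ℝ E ((1 : ℝ), (0 : E))).hasFDerivAt.comp y
        (hψ1.hasFDerivAt.comp y (hasFDerivAt_prodMk_right (0 : ℝ) y))
    have h4 : (fun z => fderiv ℝ ψ (0, z) (1, 0)) =ᶠ[𝓝 y] chartField X x₀ := by
      have hc : ContinuousAt (fun z : E => ((0 : ℝ), z)) y := by fun_prop
      filter_upwards [hc.eventually hpart, hψfix] with z hz1 hz2
      rw [hz1, hz2]
    have h5 := h3.unique (hV.hasFDerivAt.congr_of_eventuallyEq h4)
    exact DFunLike.congr_fun h5 w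
  -- the curve
  have hcurve : HasDerivAt (fun s => ψ (s, y)) (chartField X x₀ y) 0 := by
    have h := htime.self_of_nhds
    rwa [hψy] at h
  have hη : DifferentiableAt ℝ (α.inChart x₀) y :=
    ((hα x₀).contDiffAt (hctar.mem_nhds hy)).differentiableAt (by simp)
  have hη' : HasDerivAt (fun s => α.inChart x₀ (ψ (s, y)))
      (fderiv ℝ (α.inChart x₀) y (chartField X x₀ y)) 0 := by
    have h : HasFDerivAt (α.inChart x₀) (fderiv ℝ (α.inChart x₀) y) (ψ (0, y)) := by
      rw [hψy]; exact hη.hasFDerivAt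
    exact h.comp_hasDerivAt (0 : ℝ) hcurve
  let w : Fin m → E := fun i => tderiv 𝓘(ℝ, E) 𝓘(ℝ, E) c x (v i)
  have hid : ∀ u : E, fderiv ℝ ψ (0, y) (0, u) = u := by
    intro u
    have h1 : HasFDerivAt ψ (fderiv ℝ ψ (0, y)) (0, y) :=
      (hψ0.differentiableAt (by simp)).hasFDerivAt
    have h2 := h1.comp y (hasFDerivAt_prodMk_right (0 : ℝ) y)
    have h3 := h2.unique ((hasFDerivAt_id y).congr_of_eventuallyEq hψfix)
    exact DFunLike.congr_fun h3 u
  have hmain := hasDerivAt_alternating_apply hη' (fun i => hmixed (w i))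
  have hderiv : fderiv ℝ (α.inChart x₀) y (chartField X x₀ y)
      (fun i => fderiv ℝ ψ (0, y) (0, w i)) + ∑ i, α.inChart x₀ (ψ (0, y))
        (Function.update (fun j => fderiv ℝ ψ (0, y) (0, w j)) i
          (fderiv ℝ (chartField X x₀) y (w i))) =
      flatLieDeriv (chartField X x₀) (α.inChart x₀) y w := by
    simp only [hid, hψy, flatLieDeriv]
  rw [hderiv] at hmain
  refine hmain.congr_of_eventuallyEq ?_
  have hc : ContinuousAt (fun s : ℝ => (s, y)) 0 := by fun_prop
  filter_upwards [hc.eventually hev, hc.eventually hψ] with s hs1 hs2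
  have hsD : (s, x) ∈ flowDomain X := by
    have := hs1.1
    rwa [show c.symm ((s, y) : ℝ × E).2 = x from hyx] at this
  have hsS : fl X s x ∈ c.source := by
    have := hs1.2.1
    rwa [show c.symm ((s, y) : ℝ × E).2 = x from hyx] at this
  have hψs : ψ (s, y) = c (fl X s x) := by
    change c (fl X s (c.symm y)) = _
    rw [hyx]
  rw [frm_apply_eq_inChart α hsS, hψs]
  congr 1
  ext i
  have h1 := (hasTD_chart hsS).comp (hasTD_fl_right hX hsD) rfl
  have h2 : HasTD 𝓘(ℝ, E) 𝓘(ℝ, E) (fun z => ψ (s, z)) y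
      (fderiv ℝ ψ (s, y) ∘L ContinuousLinearMap.inr ℝ ℝ E) :=
    hasTD_iff_hasFDerivAt.2 ((hs2.differentiableAt (by simp)).hasFDerivAt.comp y
      (hasFDerivAt_prodMk_right s y))
  have h3 := h2.comp (hasTD_chart hx) rfl
  have h4 : (fun z => c (fl X s z)) =ᶠ[𝓝 x] fun z => ψ (s, c z) := by
    filter_upwards [hcsrc.mem_nhds hx] with z hz
    change _ = c (fl X s (c.symm (c z)))
    rw [c.left_inv hz]
  exact DFunLike.congr_fun (h1.unique (h3.congr h4)) (v i)

theorem hasDerivAt_frm_fl (hX : SmoothField X) {m : ℕ} {α : Form E M m} (hα : α.IsSmooth)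
    {s : ℝ} {x : M} (hs : (s, x) ∈ flowDomain X) (v : Fin m → E) :
    HasDerivAt (fun u => frm α (fl X u x) (fun i => dfl X u x (v i)))
      (lieDeriv X α (fl X s x) (fun i => dfl X s x (v i))) s := by
  have h := hasDerivAt_frm_fl_zero hX hα (mem_extChartAt_source (I := 𝓘(ℝ, E)) (fl X s x))
    (fun i => dfl X s x (v i))
  have h' : HasDerivAt (fun r => frm α (fl X r (fl X s x))
      (fun i => dfl X r (fl X s x) (dfl X s x (v i))))
      (lieDeriv X α (fl X s x) (fun i => dfl X s x (v i))) (s - s) := by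
    rw [sub_self]
    exact h
  have h2 := h'.comp_sub_const s s
  refine h2.congr_of_eventuallyEq ?_
  have hc : ContinuousAt (fun u : ℝ => (u, x)) s := by fun_prop
  filter_upwards [hc.eventually_mem ((isOpen_flowDomain hX).mem_nhds hs)] with u hu
  have hsub := flowDomain_sub hX hs hu
  have hadd := dfl_add hX hs hsub.1
  rw [add_sub_cancel] at hadd
  rw [hsub.2, hadd]
  rfl

/-- If the Lie derivative vanishes, then the form is invariant under the flow. -/
theorem frm_fl_eq (hX : SmoothField X) {m : ℕ} {α : Form E M m} (hα : α.IsSmooth)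
    (hL : ∀ (x : M) (v : Fin m → TangentSpace 𝓘(ℝ, E) x), lieDeriv X α x v = 0)
    {s : ℝ} {x : M} (hs : (s, x) ∈ flowDomain X) (v : Fin m → E) :
    frm α (fl X s x) (fun i => dfl X s x (v i)) = frm α x v := by
  obtain ⟨a, b, h0, hs', hD, hx0, -⟩ := exists_curve_fl hX hs
  have hd : ∀ u ∈ Ioo a b, HasDerivAt (fun u => frm α (fl X u x) (fun i => dfl X u x (v i))) 0 u := by
    intro u hu
    have h := hasDerivAt_frm_fl hX hα (hD u hu) v
    exact h.congr_deriv (hL _ _)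
  have h := (isOpen_Ioo (a := a) (b := b)).is_const_of_deriv_eq_zero isPreconnected_Ioo
    (fun u hu => (hd u hu).differentiableAt.differentiableWithinAt)
    (fun u hu => (hd u hu).deriv) hs' h0
  simpa [hx0, dfl_zero hX] using h

end Lie

/-! ### Flow boxes at the surface -/

section FlowBoxes

variable {E : Type*} [NormedAddCommGroup E] [NormedSpace ℝ E]
  {M : Type*} [TopologicalSpace M] [ChartedSpace E M] [IsManifold 𝓘(ℝ, E) ∞ M]
  {F : Type*} [NormedAddCommGroup F] [NormedSpace ℝ F]
  {S : Type*} [TopologicalSpace S] [ChartedSpace F S]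

/-- A neighbourhood `O` of a point of the surface whose points `x` reach the surface at the time
`θ x` in the point `π x`, and at no other time in `(-δ, δ)`. -/
structure FlowBox (H : HybridSystem E M F S) (p : S) where
  O : Set M
  isOpen_O : IsOpen O
  mem_O : H.emb p ∈ O
  δ : ℝ
  δ_pos : 0 < δ
  θ : M → ℝ
  π : M → S
  contMDiffOn_θ : ContMDiffOn 𝓘(ℝ, E) 𝓘(ℝ, ℝ) ∞ θ O
  contMDiffOn_π : ContMDiffOn 𝓘(ℝ, E) 𝓘(ℝ, F) ∞ π O
  abs_θ_lt : ∀ x ∈ O, |θ x| < δ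
  mem_flowDomain : ∀ x ∈ O, ∀ s, |s| < δ → (s, x) ∈ flowDomain H.field
  fl_θ : ∀ x ∈ O, fl H.field (θ x) x = H.emb (π x)
  eq_θ : ∀ x ∈ O, ∀ s, |s| < δ → fl H.field s x ∈ H.surface → s = θ x

theorem HybridSystem.smoothField (H : HybridSystem E M F S) : SmoothField H.field :=
  H.contMDiff_field

variable [FiniteDimensional ℝ E] [FiniteDimensional ℝ F] [IsManifold 𝓘(ℝ, F) ∞ S]
  {H : HybridSystem E M F S}

/-- The map is `split` composed with the isomorphisms given by the charts; in this form it is the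
derivative of the parametrisation used for flow boxes. -/
theorem HybridSystem.IsSmooth.bijective_split_chart (hH : H.IsSmooth) (p : S) :
    Function.Bijective (tderiv 𝓘(ℝ, E) 𝓘(ℝ, E) (extChartAt 𝓘(ℝ, E) (H.emb p)) (H.emb p) ∘L
      (tderiv 𝓘(ℝ, F) 𝓘(ℝ, E) H.emb p ∘L
        tderiv 𝓘(ℝ, F) 𝓘(ℝ, F) (extChartAt 𝓘(ℝ, F) p).symm (extChartAt 𝓘(ℝ, F) p p)).coprod
          ((1 : ℝ →L[ℝ] ℝ).smulRight (vec H.field (H.emb p)))) := by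
  let a := chartSymmDeriv (mem_extChartAt_target (I := 𝓘(ℝ, F)) p)
  let b := chartSymmDeriv (mem_extChartAt_target (I := 𝓘(ℝ, E)) (H.emb p))
  have h1 : Function.Bijective (Prod.map a id : F × ℝ → F × ℝ) :=
    a.bijective.prodMap Function.bijective_id
  have h3 := (b.symm.bijective.comp (hH.bijective_split p)).comp h1
  refine (iff_of_eq (congrArg Function.Bijective ?_)).2 h3
  funext w
  have hb : tderiv 𝓘(ℝ, E) 𝓘(ℝ, E) (extChartAt 𝓘(ℝ, E) (H.emb p)) (H.emb p) =
      tderiv 𝓘(ℝ, E) 𝓘(ℝ, E) (extChartAt 𝓘(ℝ, E) (H.emb p))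
        ((extChartAt 𝓘(ℝ, E) (H.emb p)).symm (extChartAt 𝓘(ℝ, E) (H.emb p) (H.emb p))) := by
    rw [extChartAt_to_inv]
  rw [hb]
  rfl

variable [T2Space M]

/-- The map `(q, s) ↦ fl s (emb q)` has an invertible derivative at `(p, 0)` by transversality, so
it gives coordinates around `emb p` in which the flow is a translation and `S` is the slice `s = 0`.
-/
theorem HybridSystem.IsSmooth.nonempty_flowBox (hH : H.IsSmooth) (p : S) :
    Nonempty (FlowBox H p) := by
  have hX := H.smoothField
  let c := extChartAt 𝓘(ℝ, E) (H.emb p)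
  let cS := extChartAt 𝓘(ℝ, F) p
  have hsrc : IsOpen c.source := isOpen_extChartAt_source (H.emb p)
  have hsrcS : IsOpen cS.source := isOpen_extChartAt_source p
  have htarS : IsOpen cS.target := isOpen_extChartAt_target p
  have hp : p ∈ cS.source := mem_extChartAt_source p
  have hep : H.emb p ∈ c.source := mem_extChartAt_source (H.emb p)
  let u₀ := cS p
  have hu₀ : u₀ ∈ cS.target := cS.map_source hp
  have hu₀p : cS.symm u₀ = p := cS.left_inv hp
  have hemb : ContMDiff 𝓘(ℝ, F) 𝓘(ℝ, E) ∞ H.emb := H.isSmoothEmbedding_emb.contMDiff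
  have hDfl := flowDomain_zero hX (H.emb p)
  let Ψ : F × ℝ → E := fun w => c (fl H.field w.2 (H.emb (cS.symm w.1)))
  let P : F × ℝ → Prop := fun w => w.1 ∈ cS.target ∧
    (w.2, H.emb (cS.symm w.1)) ∈ flowDomain H.field ∧
    fl H.field w.2 (H.emb (cS.symm w.1)) ∈ c.source
  have hin : ContinuousAt (fun w : F × ℝ => (w.2, H.emb (cS.symm w.1))) (u₀, 0) :=
    continuousAt_snd.prodMk (hemb.continuous.continuousAt.comp'
      (ContinuousAt.comp' (f := fun w : F × ℝ => w.1) (x := (u₀, (0 : ℝ)))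
        (contMDiffAt_chart_symm hu₀).continuousAt continuousAt_fst))
  have hPev : ∀ᶠ w in 𝓝 (u₀, (0 : ℝ)), P w := by
    refine (continuousAt_fst.eventually_mem (htarS.mem_nhds hu₀)).and (.and ?_ ?_)
    · refine hin.eventually_mem ((isOpen_flowDomain hX).mem_nhds ?_)
      change (0, H.emb (cS.symm u₀)) ∈ _
      rw [hu₀p]
      exact hDfl.1
    · have h1 : ContinuousAt (Function.uncurry (fl H.field)) ((0 : ℝ), H.emb (cS.symm u₀)) := by
        rw [hu₀p]
        exact (contMDiffAt_fl hX hDfl.1).continuousAt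
      refine (ContinuousAt.comp' (f := fun w : F × ℝ => (w.2, H.emb (cS.symm w.1)))
        (x := (u₀, (0 : ℝ))) h1 hin).eventually_mem (hsrc.mem_nhds ?_)
      change fl H.field 0 (H.emb (cS.symm u₀)) ∈ _
      rw [hu₀p, hDfl.2]
      exact hep
  let U : Set (F × ℝ) := interior {w | P w}
  have hU0 : (u₀, (0 : ℝ)) ∈ U := mem_interior_iff_mem_nhds.2 hPev
  have hΨ : ContDiffOn ℝ ∞ Ψ U := by
    intro w hw
    obtain ⟨hw1, hw2, hw3⟩ : P w := interior_subset (s := {w | P w}) hw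
    refine ContDiffAt.contDiffWithinAt (contMDiffAt_iff_contDiffAt.1 ?_)
    have h1 : ContMDiffAt 𝓘(ℝ, F × ℝ) 𝓘(ℝ, E) ∞ (fun w : F × ℝ => H.emb (cS.symm w.1)) w :=
      ContMDiffAt.comp w hemb.contMDiffAt
        (ContMDiffAt.comp w (contMDiffAt_chart_symm hw1) contDiffAt_fst.contMDiffAt)
    have h2 : ContMDiffAt 𝓘(ℝ, F × ℝ) (𝓘(ℝ, ℝ).prod 𝓘(ℝ, E)) ∞
        (fun w : F × ℝ => (w.2, H.emb (cS.symm w.1))) w :=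
      contDiffAt_snd.contMDiffAt.prodMk h1
    exact ContMDiffAt.comp w (contMDiffAt_chart hw3) (ContMDiffAt.comp w (contMDiffAt_fl hX hw2) h2)
  let L : F × ℝ →L[ℝ] E := tderiv 𝓘(ℝ, E) 𝓘(ℝ, E) c (H.emb p) ∘L
      (tderiv 𝓘(ℝ, F) 𝓘(ℝ, E) H.emb p ∘L tderiv 𝓘(ℝ, F) 𝓘(ℝ, F) cS.symm u₀).coprod
          ((1 : ℝ →L[ℝ] ℝ).smulRight (vec H.field (H.emb p)))
  have hL : HasFDerivAt Ψ L (u₀, 0) := by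
    refine hasTD_iff_hasFDerivAt.1 ?_
    have hfst : HasTD 𝓘(ℝ, F × ℝ) 𝓘(ℝ, F) (Prod.fst : F × ℝ → F) (u₀, 0)
        (ContinuousLinearMap.fst ℝ F ℝ) := hasTD_iff_hasFDerivAt.2 hasFDerivAt_fst
    have hsnd : HasTD 𝓘(ℝ, F × ℝ) 𝓘(ℝ, ℝ) (Prod.snd : F × ℝ → ℝ) (u₀, 0)
        (ContinuousLinearMap.snd ℝ F ℝ) := hasTD_iff_hasFDerivAt.2 hasFDerivAt_snd
    have h1 := (hasTD_of_contMDiffAt hemb.contMDiffAt (by simp)).comp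
      ((hasTD_chart_symm hu₀).comp hfst rfl) hu₀p
    have h2 := HasTD.fl_comp hX hsnd h1 (by
      change (0, H.emb (cS.symm u₀)) ∈ _
      rw [hu₀p]
      exact hDfl.1)
    have h3 : fl H.field ((u₀, (0 : ℝ)) : F × ℝ).2 (H.emb (cS.symm ((u₀, (0 : ℝ)) : F × ℝ).1)) =
        H.emb p := by
      change fl H.field 0 (H.emb (cS.symm u₀)) = _
      rw [hu₀p, hDfl.2]
    have h4 := (hasTD_chart hep).comp h2 h3
    have h5 : dfl H.field ((u₀, (0 : ℝ)) : F × ℝ).2 (H.emb (cS.symm ((u₀, (0 : ℝ)) : F × ℝ).1)) =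
        ContinuousLinearMap.id ℝ E := dfl_zero hX _
    rw [h3, h5] at h4
    have he : L = tderiv 𝓘(ℝ, E) 𝓘(ℝ, E) c (H.emb p) ∘L
        ((ContinuousLinearMap.snd ℝ F ℝ).smulRight (vec H.field (H.emb p)) +
          ContinuousLinearMap.id ℝ E ∘L (tderiv 𝓘(ℝ, F) 𝓘(ℝ, E) H.emb p ∘L
            (tderiv 𝓘(ℝ, F) 𝓘(ℝ, F) cS.symm u₀ ∘L ContinuousLinearMap.fst ℝ F ℝ))) := by
      ext w <;> simp [L]
    rw [he]
    exact h4
  have hLb : Function.Bijective L := hH.bijective_split_chart p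
  let L' : (F × ℝ) ≃L[ℝ] E := (LinearEquiv.ofBijective L.toLinearMap hLb).toContinuousLinearEquiv
  have hL' : HasFDerivAt Ψ (L' : F × ℝ →L[ℝ] E) (u₀, 0) := by
    have : (L' : F × ℝ →L[ℝ] E) = L := by ext <;> rfl
    rw [this]
    exact hL
  obtain ⟨e, he0, heU, heΨ, hes⟩ :=
    exists_openPartialHomeomorph_contDiffOn_symm isOpen_interior hΨ hU0 hL'
  have heP : ∀ w ∈ e.source, P w := fun w hw => interior_subset (s := {w | P w}) (heU hw)
  -- points of the surface near `p`
  have hev1 : ∀ᶠ z in 𝓝 ((0 : ℝ), p), z.2 ∈ cS.source ∧ (cS z.2, -z.1) ∈ e.source := by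
    refine (continuousAt_snd.eventually_mem (hsrcS.mem_nhds hp)).and ?_
    have h1 : ContinuousAt (fun z : ℝ × S => (cS z.2, -z.1)) (0, p) :=
      ((contMDiffAt_chart hp).continuousAt.comp' continuousAt_snd).prodMk continuousAt_fst.neg
    refine h1.eventually_mem (e.open_source.mem_nhds ?_)
    simpa using he0
  obtain ⟨I₁, hI₁, W, hW, hIW⟩ := mem_nhds_prod_iff.1 hev1
  -- Here `S` must carry the induced topology: a point of the surface near `emb p` in `M` has its
  -- parameter near `p`. Otherwise another sheet of `S` could accumulate at `p` and produce further
  -- hits.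
  obtain ⟨V, hV, hVW⟩ : ∃ V ∈ 𝓝 (H.emb p), H.emb ⁻¹' V ⊆ W := by
    have h := H.isSmoothEmbedding_emb.isEmbedding.isInducing.nhds_eq_comap p
    rw [h] at hW
    exact Filter.mem_comap.1 hW
  have hev2 : ∀ᶠ z in 𝓝 ((0 : ℝ), H.emb p), z ∈ flowDomain H.field ∧
      Function.uncurry (fl H.field) z ∈ V := by
    refine .and ((isOpen_flowDomain hX).mem_nhds hDfl.1) ?_
    refine (contMDiffAt_fl hX hDfl.1).continuousAt.eventually_mem ?_
    change V ∈ 𝓝 (fl H.field 0 (H.emb p))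
    rwa [hDfl.2]
  obtain ⟨I₂, hI₂, O₂, hO₂, hprod⟩ := mem_nhds_prod_iff.1 hev2
  obtain ⟨δ, hδ, hball⟩ := Metric.mem_nhds_iff.1 (Filter.inter_mem hI₁ hI₂)
  have hδI : ∀ s : ℝ, |s| < δ → s ∈ I₁ ∩ I₂ := fun s hs => hball (by simpa using hs)
  have hΨ0 : e (u₀, 0) = c (H.emb p) := by
    rw [heΨ]
    change c (fl H.field 0 (H.emb (cS.symm u₀))) = _
    rw [hu₀p, hDfl.2]
  have hctar : c (H.emb p) ∈ e.target := by
    rw [← hΨ0]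
    exact e.map_source he0
  have hes0 : e.symm (c (H.emb p)) = (u₀, 0) := by
    rw [← hΨ0]
    exact e.left_inv he0
  let A : Set M := {x | x ∈ c.source ∧ c x ∈ e.target ∧ |(e.symm (c x)).2| < δ ∧ x ∈ O₂}
  have hA : A ∈ 𝓝 (H.emb p) := by
    have hc := (contMDiffAt_chart hep).continuousAt
    refine Filter.inter_mem (hsrc.mem_nhds hep) (Filter.inter_mem
      (hc.preimage_mem_nhds (e.open_target.mem_nhds hctar)) (Filter.inter_mem ?_ hO₂))
    have h1 : ContinuousAt (fun x => |(e.symm (c x)).2|) (H.emb p) :=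
      (continuousAt_snd.comp' ((e.continuousAt_symm hctar).comp' hc)).abs
    refine h1.eventually_lt continuousAt_const ?_
    rw [hes0]
    simpa using hδ
  have hsm : ∀ x ∈ interior A, ContMDiffAt 𝓘(ℝ, E) 𝓘(ℝ, F × ℝ) ∞ (fun x => e.symm (c x)) x := by
    intro x hx
    obtain ⟨h1, h2, -, -⟩ : x ∈ A := interior_subset hx
    exact ContMDiffAt.comp x (hes.contDiffAt (e.open_target.mem_nhds h2)).contMDiffAt
      (contMDiffAt_chart h1)
  have hrec : ∀ x ∈ A, P (e.symm (c x)) ∧ fl H.field (e.symm (c x)).2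
      (H.emb (cS.symm (e.symm (c x)).1)) = x := by
    rintro x ⟨h1, h2, -, -⟩
    have h3 := heP _ (e.map_target h2)
    refine ⟨h3, c.injOn h3.2.2 h1 ?_⟩
    have h4 := e.right_inv h2
    rw [heΨ] at h4
    exact h4
  -- A point with coordinates `(q, s)` has left the surface for the time `s`, hence reaches it at
  -- the time `-s`.
  refine ⟨⟨interior A, isOpen_interior, mem_interior_iff_mem_nhds.2 hA, δ, hδ,
    fun x => -(e.symm (c x)).2, fun x => cS.symm (e.symm (c x)).1, ?_, ?_, ?_, ?_, ?_, ?_⟩⟩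
  · intro x hx
    have h : ContMDiffAt 𝓘(ℝ, F × ℝ) 𝓘(ℝ, ℝ) ∞ (fun w : F × ℝ => -w.2) (e.symm (c x)) :=
      contDiff_snd.neg.contDiffAt.contMDiffAt
    exact (ContMDiffAt.comp x h (hsm x hx)).contMDiffWithinAt
  · intro x hx
    have h : ContMDiffAt 𝓘(ℝ, F × ℝ) 𝓘(ℝ, F) ∞ (fun w : F × ℝ => cS.symm w.1) (e.symm (c x)) :=
      ContMDiffAt.comp _ (contMDiffAt_chart_symm (hrec x (interior_subset hx)).1.1)
        contDiff_fst.contDiffAt.contMDiffAt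
    exact (ContMDiffAt.comp x h (hsm x hx)).contMDiffWithinAt
  · intro x hx
    rw [abs_neg]
    exact (interior_subset hx : x ∈ A).2.2.1
  · intro x hx s hs
    exact (hprod (mk_mem_prod (hδI s hs).2 (interior_subset hx : x ∈ A).2.2.2)).1
  · intro x hx
    obtain ⟨h1, h2⟩ := hrec x (interior_subset hx)
    have h3 := flowDomain_neg hX h1.2.1
    rw [h2] at h3
    exact h3.2
  · rintro x hx s hs ⟨q, hq⟩
    have hxA : x ∈ A := interior_subset hx
    have h1 := hprod (mk_mem_prod (hδI s hs).2 hxA.2.2.2)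
    have hqW : q ∈ W := by
      refine hVW ?_
      change H.emb q ∈ V
      rw [hq]
      exact h1.2
    have h2 : q ∈ cS.source ∧ (cS q, -s) ∈ e.source := hIW (mk_mem_prod (hδI s hs).1 hqW)
    have h3 := (flowDomain_neg hX h1.1).2
    have h4 : e (cS q, -s) = c x := by
      rw [heΨ]
      change c (fl H.field (-s) (H.emb (cS.symm (cS q)))) = _
      rw [cS.left_inv h2.1, hq, h3]
    rw [← h4, e.left_inv h2.2, neg_neg]

end FlowBoxes

/-! ### Continuity of the values of a smooth form -/

section Continuity

variable {E : Type*} [NormedAddCommGroup E] [NormedSpace ℝ E]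
  {M : Type*} [TopologicalSpace M] [ChartedSpace E M] [IsManifold 𝓘(ℝ, E) ∞ M]
  {E' : Type*} [NormedAddCommGroup E'] [NormedSpace ℝ E']
  {N : Type*} [TopologicalSpace N]

local notation "ch" => extChartAt 𝓘(ℝ, E)

/-- The identification of tangent spaces with `E` uses the preferred chart of each point, which may
jump. Continuity of vectors is therefore required after reading them in the single chart at `f z₀`,
where the form has a smooth expression. -/
theorem continuousAt_frm {m : ℕ} {α : Form E M m} (hα : α.IsSmooth) {f : N → M}
    {A : Fin m → N → E} {z₀ : N} (hf : ContinuousAt f z₀)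
    (hA : ∀ i, ContinuousAt (fun z => tderiv 𝓘(ℝ, E) 𝓘(ℝ, E) (ch (f z₀)) (f z) (A i z)) z₀) :
    ContinuousAt (fun z => frm α (f z) (fun i => A i z)) z₀ := by
  have hsrc := isOpen_extChartAt_source (I := 𝓘(ℝ, E)) (f z₀)
  have hmem := mem_extChartAt_source (I := 𝓘(ℝ, E)) (f z₀)
  have hev : (fun z => frm α (f z) (fun i => A i z)) =ᶠ[𝓝 z₀] fun z =>
      α.inChart (f z₀) (ch (f z₀) (f z))
        (fun i => tderiv 𝓘(ℝ, E) 𝓘(ℝ, E) (ch (f z₀)) (f z) (A i z)) := by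
    filter_upwards [hf.eventually_mem (hsrc.mem_nhds hmem)] with z hz
    exact frm_apply_eq_inChart α hz _
  refine ContinuousAt.congr ?_ hev.symm
  have h1 : ContinuousAt (fun z => α.inChart (f z₀) (ch (f z₀) (f z))) z₀ := by
    have h := ((hα (f z₀)).contDiffAt ((isOpen_extChartAt_target (f z₀)).mem_nhds
      ((ch (f z₀)).map_source hmem))).continuousAt
    exact ContinuousAt.comp' (f := fun z => ch (f z₀) (f z)) h
      (ContinuousAt.comp' (f := f) (contMDiffAt_chart hmem).continuousAt hf)
  exact h1.eval (continuousAt_pi.2 hA)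

theorem continuousAt_tderiv_chart_vec [CompleteSpace E] {X : ∀ x : M, TangentSpace 𝓘(ℝ, E) x}
    (hX : SmoothField X) {f : N → M} {z₀ : N} (hf : ContinuousAt f z₀) :
    ContinuousAt (fun z => tderiv 𝓘(ℝ, E) 𝓘(ℝ, E) (ch (f z₀)) (f z) (vec X (f z))) z₀ := by
  have hsrc := isOpen_extChartAt_source (I := 𝓘(ℝ, E)) (f z₀)
  have hmem := mem_extChartAt_source (I := 𝓘(ℝ, E)) (f z₀)
  have hev : (fun z => tderiv 𝓘(ℝ, E) 𝓘(ℝ, E) (ch (f z₀)) (f z) (vec X (f z))) =ᶠ[𝓝 z₀]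
      fun z => chartField X (f z₀) (ch (f z₀) (f z)) := by
    filter_upwards [hf.eventually_mem (hsrc.mem_nhds hmem)] with z hz
    rw [chartField_apply X ((ch (f z₀)).map_source hz), (ch (f z₀)).left_inv hz]
    rfl
  refine ContinuousAt.congr ?_ hev.symm
  have h := ((contDiffOn_chartField hX (f z₀)).contDiffAt
    ((isOpen_extChartAt_target (f z₀)).mem_nhds ((ch (f z₀)).map_source hmem))).continuousAt
  exact ContinuousAt.comp' (f := fun z => ch (f z₀) (f z)) h
    (ContinuousAt.comp' (f := f) (contMDiffAt_chart hmem).continuousAt hf)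

variable [ChartedSpace E' N] [IsManifold 𝓘(ℝ, E') ∞ N]

/-- The vector field near `z₀` that is constant in the preferred chart, with value `u` at `z₀`. -/
def chartConst (z₀ : N) (u : E') (z : N) : E' :=
  tderiv 𝓘(ℝ, E') 𝓘(ℝ, E') (extChartAt 𝓘(ℝ, E') z₀).symm (extChartAt 𝓘(ℝ, E') z₀ z)
    (tderiv 𝓘(ℝ, E') 𝓘(ℝ, E') (extChartAt 𝓘(ℝ, E') z₀) z₀ u)

theorem chartConst_self (z₀ : N) (u : E') : chartConst z₀ u z₀ = u :=
  DFunLike.congr_fun (tderiv_chart_symm_comp (mem_extChartAt_source (I := 𝓘(ℝ, E')) z₀)) u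

/-- Read in charts, the vector is the derivative of the smooth local expression of `f` at `z`,
applied to a vector that does not depend on `z`. -/
theorem continuousAt_tderiv_chart_tderiv {f : N → M} {z₀ : N}
    (hf : ContMDiffAt 𝓘(ℝ, E') 𝓘(ℝ, E) ∞ f z₀) (u : E') :
    ContinuousAt (fun z => tderiv 𝓘(ℝ, E) 𝓘(ℝ, E) (ch (f z₀)) (f z)
      (tderiv 𝓘(ℝ, E') 𝓘(ℝ, E) f z (chartConst z₀ u z))) z₀ := by
  let c := ch (f z₀)
  let cN := extChartAt 𝓘(ℝ, E') z₀
  have hsrc : IsOpen c.source := isOpen_extChartAt_source (f z₀)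
  have hmem : f z₀ ∈ c.source := mem_extChartAt_source (f z₀)
  have hsrcN : IsOpen cN.source := isOpen_extChartAt_source z₀
  have hmemN : z₀ ∈ cN.source := mem_extChartAt_source z₀
  let h : E' → E := fun y => c (f (cN.symm y))
  let u' : E' := tderiv 𝓘(ℝ, E') 𝓘(ℝ, E') cN z₀ u
  have hh : ContDiffAt ℝ ∞ h (cN z₀) := by
    refine contMDiffAt_iff_contDiffAt.1 ?_
    have h1 : ContMDiffAt 𝓘(ℝ, E') 𝓘(ℝ, E) ∞ f (cN.symm (cN z₀)) := by
      rwa [cN.left_inv hmemN]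
    have h2 : f (cN.symm (cN z₀)) ∈ c.source := by rwa [cN.left_inv hmemN]
    exact ContMDiffAt.comp _ (contMDiffAt_chart h2)
      (ContMDiffAt.comp _ h1 (contMDiffAt_chart_symm (cN.map_source hmemN)))
  have hev : (fun z => tderiv 𝓘(ℝ, E) 𝓘(ℝ, E) c (f z)
      (tderiv 𝓘(ℝ, E') 𝓘(ℝ, E) f z (chartConst z₀ u z))) =ᶠ[𝓝 z₀]
      fun z => fderiv ℝ h (cN z) u' := by
    have hfe : ∀ᶠ z in 𝓝 z₀, ContMDiffAt 𝓘(ℝ, E') 𝓘(ℝ, E) 1 f z := by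
      have := IsManifold.of_le (m := 1) (n := ∞) (I := 𝓘(ℝ, E)) (M := M) (by simp)
      have := IsManifold.of_le (m := 1) (n := ∞) (I := 𝓘(ℝ, E')) (M := N) (by simp)
      exact (contMDiffAt_iff_contMDiffAt_nhds (by simp)).1 (hf.of_le (by simp))
    filter_upwards [hf.continuousAt.eventually_mem (hsrc.mem_nhds hmem), hsrcN.mem_nhds hmemN,
      hfe] with z hz1 hz2 hz3
    have h1 := (hasTD_chart hz1).comp ((hasTD_of_contMDiffAt hz3 (by simp)).comp
      (hasTD_chart_symm (cN.map_source hz2)) (cN.left_inv hz2)) (by rw [cN.left_inv hz2])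
    rw [(hasTD_iff_hasFDerivAt.1 h1).fderiv]
    rfl
  refine ContinuousAt.congr ?_ hev.symm
  have h1 : ContinuousAt (fderiv ℝ h) (cN z₀) :=
    (hh.fderiv_right (m := ∞) (by simp)).continuousAt
  exact (h1.comp' (contMDiffAt_chart hmemN).continuousAt).clm_apply continuousAt_const

end Continuity

/-! ### Continuity points of upper semicontinuous functions -/

/-- A discontinuity in `V` lies on the frontier of one of the open sets `{ρ < q}` with `q` rational,
and such a frontier is nowhere dense. -/
theorem exists_continuousAt_of_upperSemicontinuous {M : Type*} [TopologicalSpace M] [BaireSpace M]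
    {V W : Set M} (hV : IsOpen V) (hW : IsOpen W) (hWV : W ⊆ V) (hne : W.Nonempty) {ρ : M → ℝ}
    (hρ : ∀ x ∈ V, ∀ c, ρ x < c → ∀ᶠ y in 𝓝 x, ρ y < c) : ∃ x ∈ W, ContinuousAt ρ x := by
  let A : ℚ → Set M := fun q => {x | x ∈ V ∧ ρ x < q}
  have hA : ∀ q, IsOpen (A q) := fun q => isOpen_iff_mem_nhds.2 fun x hx =>
    Filter.inter_mem (hV.mem_nhds hx.1) (hρ x hx.1 q hx.2)
  have hd : Dense (⋂ q, (frontier (A q))ᶜ) := by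
    refine dense_iInter_of_isOpen (fun q => isClosed_frontier.isOpen_compl) fun q => ?_
    rw [← interior_eq_empty_iff_dense_compl]
    exact interior_frontier (hA q).isClosed_compl |> fun h => by rwa [frontier_compl] at h
  obtain ⟨x, hxW, hx⟩ := hd.inter_open_nonempty W hW hne
  refine ⟨x, hxW, tendsto_order.2 ⟨fun a ha => ?_, fun a ha => hρ x (hWV hxW) a ha⟩⟩
  obtain ⟨q, hq1, hq2⟩ := exists_rat_btwn ha
  have hxq : x ∉ closure (A q) := by
    rw [closure_eq_self_union_frontier]
    rintro (h | h)
    · exact (h.2.trans hq2).false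
    · exact mem_iInter.1 hx q h
  filter_upwards [isClosed_closure.isOpen_compl.mem_nhds hxq, hV.mem_nhds (hWV hxW)] with y hy1 hy2
  refine hq1.trans_le (not_lt.1 fun h => hy1 (subset_closure ⟨hy2, h⟩))

section Sufficiency

variable {E : Type*} [NormedAddCommGroup E] [NormedSpace ℝ E]
  {M : Type*} [TopologicalSpace M] [ChartedSpace E M] [IsManifold 𝓘(ℝ, E) ∞ M]
  {F : Type*} [NormedAddCommGroup F] [NormedSpace ℝ F]
  {S : Type*} [TopologicalSpace S] [ChartedSpace F S]
  {H : HybridSystem E M F S}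

/-! ### The hybrid flow with a given number of impacts -/

/-- The trajectory of `x` under the continuous flow does not meet the surface before time `τ`. -/
def NoHit (H : HybridSystem E M F S) (x : M) (τ : ℝ) : Prop :=
  ∀ s ∈ Ico 0 τ, fl H.field s x ∉ H.surface

/-- The hybrid flow, with exactly `n` impacts before time `t`. -/
def FlowN (H : HybridSystem E M F S) : ℕ → ℝ → M → M → Prop
  | 0, t, x, y => 0 ≤ t ∧ (t, x) ∈ flowDomain H.field ∧ NoHit H x t ∧ fl H.field t x = y
  | n + 1, t, x, y => ∃ (τ : ℝ) (p : S), 0 ≤ τ ∧ τ < t ∧ (τ, x) ∈ flowDomain H.field ∧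
      NoHit H x τ ∧ fl H.field τ x = H.emb p ∧ FlowN H n (t - τ) (H.reset p) y

/-- The time `T` is the first impact time, or `t` if no impact occurs before `t`; this treats all
values of `n` together. -/
theorem FlowN.exists_event {n : ℕ} {t : ℝ} {x y : M} (h : FlowN H n t x y) :
    ∃ T, 0 ≤ T ∧ T ≤ t ∧ (T, x) ∈ flowDomain H.field ∧ NoHit H x T ∧
      (T < t → fl H.field T x ∈ H.surface) := by
  cases n with
  | zero => exact ⟨t, h.1, le_rfl, h.2.1, h.2.2.1, fun h => absurd h (lt_irrefl t)⟩
  | succ n =>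
    obtain ⟨τ, p, h0, ht, hD, hN, hp, -⟩ := h
    exact ⟨τ, h0, ht.le, hD, hN, fun _ => ⟨p, hp.symm⟩⟩

theorem FlowN.of_noHit {n : ℕ} {t : ℝ} {x y : M} (h : FlowN H n t x y) (hx : NoHit H x t) :
    (t, x) ∈ flowDomain H.field ∧ fl H.field t x = y := by
  cases n with
  | zero => exact ⟨h.2.1, h.2.2.2⟩
  | succ n =>
    obtain ⟨τ, p, h0, ht, -, -, hp, -⟩ := h
    exact absurd ⟨p, hp.symm⟩ (hx τ ⟨h0, ht⟩)

/-- The first impact time is determined by the trajectory, and the impact parameter too because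
`emb` is injective. -/
theorem FlowN.of_hit {n : ℕ} {t τ : ℝ} {x y : M} {p : S} (h : FlowN H n t x y)
    (hx : NoHit H x τ) (hτ : 0 ≤ τ) (hτt : τ < t) (hp : fl H.field τ x = H.emb p) :
    ∃ k, n = k + 1 ∧ FlowN H k (t - τ) (H.reset p) y := by
  cases n with
  | zero => exact absurd ⟨p, hp.symm⟩ (h.2.2.1 τ ⟨hτ, hτt⟩)
  | succ n =>
    obtain ⟨τ', q, h0, ht, -, hN, hq, hy⟩ := h
    rcases lt_trichotomy τ τ' with hlt | rfl | hlt
    · exact absurd ⟨p, hp.symm⟩ (hN τ ⟨hτ, hlt⟩)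
    · obtain rfl : p = q := H.isSmoothEmbedding_emb.isEmbedding.injective (hp.symm.trans hq)
      exact ⟨n, rfl, hy⟩
    · exact absurd ⟨q, hq.symm⟩ (hx τ' ⟨h0, hlt⟩)

/-! ### Maps that respect a form up to the motion along the field -/

/-- `G` would preserve the form `α` at `x` after a correction by the flow for the time `-σ`. -/
def Adapted {m : ℕ} (α : Form E M m) (X : ∀ x : M, TangentSpace 𝓘(ℝ, E) x) (G : M → M)
    (σ : M → ℝ) (x : M) : Prop :=
  ∃ (G' : E →L[ℝ] E) (σ' : E →L[ℝ] ℝ), HasTD 𝓘(ℝ, E) 𝓘(ℝ, E) G x G' ∧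
    HasTD 𝓘(ℝ, E) 𝓘(ℝ, ℝ) σ x σ' ∧
    ∀ v : Fin m → E, frm α (G x) (fun i => G' (v i) - σ' (v i) • vec X (G x)) = frm α x v

variable {m : ℕ} {α : Form E M m} {X : ∀ x : M, TangentSpace 𝓘(ℝ, E) x} {G : M → M} {σ : M → ℝ}
  {x : M}

theorem hasTD_add {f g : M → ℝ} {f' g' : E →L[ℝ] ℝ} (hf : HasTD 𝓘(ℝ, E) 𝓘(ℝ, ℝ) f x f')
    (hg : HasTD 𝓘(ℝ, E) 𝓘(ℝ, ℝ) g x g') :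
    HasTD 𝓘(ℝ, E) 𝓘(ℝ, ℝ) (fun z => f z + g z) x (f' + g') :=
  HasMFDerivAt.add hf hg

theorem Adapted.congr {G₁ : M → M} {σ₁ : M → ℝ} (h : Adapted α X G σ x) (hG : G₁ =ᶠ[𝓝 x] G)
    (hσ : σ₁ =ᶠ[𝓝 x] σ) : Adapted α X G₁ σ₁ x := by
  obtain ⟨G', σ', h1, h2, h3⟩ := h
  refine ⟨G', σ', h1.congr hG, h2.congr hσ, ?_⟩
  rw [hG.self_of_nhds]
  exact h3

variable [FiniteDimensional ℝ E] [FiniteDimensional ℝ F]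

/-- The condition on the reset map in terms of tangent vectors of the surface and multiples of the
vector field. -/
theorem HybridSystem.IsSmooth.frm_reset_iff (hH : H.IsSmooth) (p : S) :
    (∀ v : Fin m → TangentSpace 𝓘(ℝ, E) (H.emb p),
        α (H.reset p) (fun i => hH.augmentedDifferential p (v i)) = α (H.emb p) v) ↔
    ∀ (u : Fin m → F) (a : Fin m → ℝ),
      frm α (H.reset p) (fun i => tderiv 𝓘(ℝ, F) 𝓘(ℝ, E) H.reset p (u i) +
        a i • vec H.field (H.reset p)) =
      frm α (H.emb p) (fun i => tderiv 𝓘(ℝ, F) 𝓘(ℝ, E) H.emb p (u i) +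
        a i • vec H.field (H.emb p)) := by
  have key : ∀ (u : F) (a : ℝ), hH.augmentedDifferential p
      (tderiv 𝓘(ℝ, F) 𝓘(ℝ, E) H.emb p u + a • vec H.field (H.emb p) : E) =
      tderiv 𝓘(ℝ, F) 𝓘(ℝ, E) H.reset p u + a • vec H.field (H.reset p) := by
    intro u a
    refine (map_add (hH.augmentedDifferential p) _ _).trans ?_
    exact congrArg₂ (· + ·) (hH.augmentedDifferential_tangent p u)
      ((map_smul (hH.augmentedDifferential p) a _).trans
        (congrArg (a • ·) (hH.augmentedDifferential_field p)))
  constructor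
  · intro h u a
    have h1 := h (fun i => (tderiv 𝓘(ℝ, F) 𝓘(ℝ, E) H.emb p (u i) +
      a i • vec H.field (H.emb p) : E))
    refine Eq.trans ?_ h1
    exact congrArg (frm α (H.reset p)) (funext fun i => (key (u i) (a i)).symm)
  · intro h v
    choose w hw using fun i => (hH.bijective_split p).2 (v i)
    have h1 := h (fun i => (w i).1) (fun i => (w i).2)
    have hv : v = fun i => (tderiv 𝓘(ℝ, F) 𝓘(ℝ, E) H.emb p (w i).1 +
      (w i).2 • vec H.field (H.emb p) : E) := funext fun i => (hw i).symm
    rw [hv]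
    refine Eq.trans ?_ h1
    exact congrArg (frm α (H.reset p)) (funext fun i => key (w i).1 (w i).2)

variable [T2Space M]

theorem HybridSystem.Flow.exists_flowN {t : ℝ} {x y : M} (h : H.Flow t x y) :
    ∃ n, FlowN H n t x y := by
  induction h with
  | @continuous t x y γ ht hx hy hγ hS =>
    subst hx
    have hc := fl_eq_of_curve_Icc H.smoothField ht hγ
    refine ⟨0, ht, (hc t ⟨ht, le_rfl⟩).1, fun s hs => ?_, (hc t ⟨ht, le_rfl⟩).2.trans hy⟩
    rw [(hc s ⟨hs.1, hs.2.le⟩).2]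
    exact hS s hs
  | @impact t r x y p γ ht hx hp hγ hS hr hy ih =>
    subst hx
    obtain ⟨n, hn⟩ := ih
    have hc := fl_eq_of_curve_Icc H.smoothField ht hγ
    refine ⟨n + 1, t, p, ht, by linarith, (hc t ⟨ht, le_rfl⟩).1, fun s hs => ?_,
      (hc t ⟨ht, le_rfl⟩).2.trans hp, by rwa [add_sub_cancel_left]⟩
    rw [(hc s ⟨hs.1, hs.2.le⟩).2]
    exact hS s hs

/-- The new derivative is `dfl ∘ G' + τ' • X`, and the new correction cancels `τ' • X`. As `dfl`
maps `X` to `X`, what remains is `dfl` applied to the old corrected derivative, and the flow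
preserves `α`. -/
theorem Adapted.fl (hX : SmoothField X) (hα : α.IsSmooth)
    (hL : ∀ (x : M) (v : Fin m → TangentSpace 𝓘(ℝ, E) x), lieDeriv X α x v = 0)
    (h : Adapted α X G σ x) {τ : M → ℝ} {τ' : E →L[ℝ] ℝ} (hτ : HasTD 𝓘(ℝ, E) 𝓘(ℝ, ℝ) τ x τ')
    (hD : (τ x, G x) ∈ flowDomain X) :
    Adapted α X (fun z => fl X (τ z) (G z)) (fun z => σ z + τ z) x := by
  obtain ⟨G', σ', hG, hσ, hv⟩ := h
  refine ⟨_, _, HasTD.fl_comp hX hτ hG hD, hasTD_add hσ hτ, fun v => ?_⟩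
  rw [← hv v, ← frm_fl_eq hX hα hL hD]
  congr 1
  ext i
  rw [map_sub, map_smul, dfl_field hX hD]
  simp only [_root_.add_apply, ContinuousLinearMap.smulRight_apply,
    ContinuousLinearMap.comp_apply, add_smul]
  abel

/-- On the surface `G' = emb_* ∘ P'`, so the corrected derivative is a tangent vector of `S` plus
the multiple `-σ'` of the field. This is the form in which `frm_reset_iff` applies. -/
theorem Adapted.reset (hH : H.IsSmooth)
    (hJ : ∀ (p : S) (v : Fin m → TangentSpace 𝓘(ℝ, E) (H.emb p)),
        α (H.reset p) (fun i => hH.augmentedDifferential p (v i)) = α (H.emb p) v)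
    (h : Adapted α H.field G σ x) {P : M → S} {P' : E →L[ℝ] F}
    (hP : HasTD 𝓘(ℝ, E) 𝓘(ℝ, F) P x P') (hGP : G =ᶠ[𝓝 x] fun z => H.emb (P z)) :
    Adapted α H.field (fun z => H.reset (P z)) σ x := by
  obtain ⟨G', σ', hG, hσ, hv⟩ := h
  have h1 : HasTD 𝓘(ℝ, F) 𝓘(ℝ, E) H.emb (P x) _ :=
    hasTD_of_contMDiffAt H.isSmoothEmbedding_emb.contMDiff.contMDiffAt (by simp)
  have h2 : HasTD 𝓘(ℝ, F) 𝓘(ℝ, E) H.reset (P x) _ :=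
    hasTD_of_contMDiffAt H.contMDiff_reset.contMDiffAt (by simp)
  refine ⟨_, σ', h2.comp hP rfl, hσ, fun v => ?_⟩
  have hG' := hG.unique ((h1.comp hP rfl).congr hGP)
  have h3 := (hH.frm_reset_iff (α := α) (P x)).1 (hJ (P x)) (fun i => P' (v i))
    (fun i => -σ' (v i))
  rw [← hv v, hG', hGP.self_of_nhds]
  simpa [sub_eq_add_neg] using h3

end Sufficiency

/-! ### Following a trajectory impact by impact, and Baire arguments -/

section Sufficiency

variable {E : Type*} [NormedAddCommGroup E] [NormedSpace ℝ E] [FiniteDimensional ℝ E]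
  {M : Type*} [TopologicalSpace M] [T2Space M] [ChartedSpace E M] [IsManifold 𝓘(ℝ, E) ∞ M]
  {F : Type*} [NormedAddCommGroup F] [NormedSpace ℝ F] [FiniteDimensional ℝ F]
  {S : Type*} [TopologicalSpace S] [ChartedSpace F S] [IsManifold 𝓘(ℝ, F) ∞ S]
  {H : HybridSystem E M F S} {m : ℕ} {α : Form E M m}

theorem FlowBox.hasTD_θ {p : S} (B : FlowBox H p) {x : M} (hx : x ∈ B.O) :
    HasTD 𝓘(ℝ, E) 𝓘(ℝ, ℝ) B.θ x (tderiv 𝓘(ℝ, E) 𝓘(ℝ, ℝ) B.θ x) :=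
  hasTD_of_contMDiffAt (B.contMDiffOn_θ.contMDiffAt (B.isOpen_O.mem_nhds hx)) (by simp)

theorem FlowBox.hasTD_π {p : S} (B : FlowBox H p) {x : M} (hx : x ∈ B.O) :
    HasTD 𝓘(ℝ, E) 𝓘(ℝ, F) B.π x (tderiv 𝓘(ℝ, E) 𝓘(ℝ, F) B.π x) :=
  hasTD_of_contMDiffAt (B.contMDiffOn_π.contMDiffAt (B.isOpen_O.mem_nhds hx)) (by simp)

theorem FlowBox.θ_emb {p q : S} (B : FlowBox H p) (hq : H.emb q ∈ B.O) : B.θ (H.emb q) = 0 :=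
  (B.eq_θ _ hq 0 (by simpa using B.δ_pos)
    ⟨q, (flowDomain_zero H.smoothField (H.emb q)).2.symm⟩).symm

/-- If the trajectory of `G x₀` meets the surface at the time `T > 0`, then those of nearby points
meet it at the time `T + θ (fl T (G x))`. -/
theorem FlowBox.eventually_hit {p : S} (B : FlowBox H p) {G : M → M} {x₀ : M}
    (hG : ContinuousAt G x₀) {T : ℝ} (hD : (T, G x₀) ∈ flowDomain H.field)
    (hp : fl H.field T (G x₀) = H.emb p) :
    (∀ᶠ x in 𝓝 x₀, (T, G x) ∈ flowDomain H.field ∧ fl H.field T (G x) ∈ B.O ∧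
      fl H.field (T + B.θ (fl H.field T (G x))) (G x) = H.emb (B.π (fl H.field T (G x)))) ∧
    Filter.Tendsto (fun x => B.θ (fl H.field T (G x))) (𝓝 x₀) (𝓝 0) := by
  have hX := H.smoothField
  have hfl : ContinuousAt (fun x => fl H.field T (G x)) x₀ :=
    ContinuousAt.comp' (contMDiffAt_fl_right hX hD).continuousAt hG
  have hO : H.emb p ∈ B.O := B.mem_O
  refine ⟨?_, ?_⟩
  · have h1 : ContinuousAt (fun x => (T, G x)) x₀ := continuousAt_const.prodMk hG
    filter_upwards [h1.eventually_mem ((isOpen_flowDomain hX).mem_nhds hD),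
      hfl.eventually_mem (B.isOpen_O.mem_nhds (by rw [hp]; exact hO))] with x hx1 hx2
    refine ⟨hx1, hx2, ?_⟩
    rw [(flowDomain_add hX hx1 (B.mem_flowDomain _ hx2 _ (B.abs_θ_lt _ hx2))).2]
    exact B.fl_θ _ hx2
  · have h1 : ContinuousAt B.θ (fl H.field T (G x₀)) := by
      rw [hp]
      exact (B.hasTD_θ hO).continuousAt
    have h2 := ContinuousAt.comp' (f := fun x => fl H.field T (G x)) h1 hfl
    have h3 : B.θ (fl H.field T (G x₀)) = 0 := by rw [hp, B.θ_emb hO]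
    have h4 := h2.tendsto
    rwa [h3] at h4

/-- Either the pullback of `α` under `f` is `α` at some point, or the data can be followed through
the next impact, on a smaller open set. -/
theorem exists_frm_pullback_eq_or_reset [BaireSpace M] (hH : H.IsSmooth) (hα : α.IsSmooth)
    (hL : ∀ (x : M) (v : Fin m → TangentSpace 𝓘(ℝ, E) x), lieDeriv H.field α x v = 0)
    (hJ : ∀ (p : S) (v : Fin m → TangentSpace 𝓘(ℝ, E) (H.emb p)),
        α (H.reset p) (fun i => hH.augmentedDifferential p (v i)) = α (H.emb p) v)
    {t : ℝ} {f : M → M} {V : Set M} {G : M → M} {σ : M → ℝ} (hV : IsOpen V) (hne : V.Nonempty)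
    (hA : ∀ x ∈ V, Adapted α H.field G σ x) (hS : ∀ x ∈ V, G x ∉ H.surface)
    (hf : ∀ x ∈ V, ∃ n, FlowN H n (t - σ x) (G x) (f x)) :
    (∃ x ∈ V, ∃ f' : E →L[ℝ] E, HasTD 𝓘(ℝ, E) 𝓘(ℝ, E) f x f' ∧
      ∀ v : Fin m → E, frm α (f x) (fun i => f' (v i)) = frm α x v) ∨
    ∃ (V' : Set M) (G' : M → M) (σ' : M → ℝ), IsOpen V' ∧ V'.Nonempty ∧ V' ⊆ V ∧
      (∀ x ∈ V', Adapted α H.field G' σ' x) ∧ (∀ x ∈ V', G' x ∉ H.surface) ∧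
      ∀ x ∈ V', ∀ n, FlowN H n (t - σ x) (G x) (f x) →
        ∃ k, n = k + 1 ∧ FlowN H k (t - σ' x) (G' x) (f x) := by
  have hX := H.smoothField
  have hcG : ∀ x ∈ V, ContinuousAt G x := fun x hx => by
    obtain ⟨_, _, h1, -⟩ := hA x hx
    exact h1.continuousAt
  have hcσ : ∀ x ∈ V, ContinuousAt σ x := fun x hx => by
    obtain ⟨_, _, -, h1, -⟩ := hA x hx
    exact h1.continuousAt
  have hT : ∀ x, ∃ T, x ∈ V → 0 ≤ T ∧ T ≤ t - σ x ∧ (T, G x) ∈ flowDomain H.field ∧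
      NoHit H (G x) T ∧ (T < t - σ x → fl H.field T (G x) ∈ H.surface) := by
    intro x
    by_cases hx : x ∈ V
    · obtain ⟨n, hn⟩ := hf x hx
      obtain ⟨T, h⟩ := hn.exists_event
      exact ⟨T, fun _ => h⟩
    · exact ⟨0, fun h => absurd h hx⟩
  choose T hT using hT
  -- Positivity of the first impact time matters for nearby points: their flow-box hit must still
  -- lie in the future.
  have hpos : ∀ x ∈ V, T x < t - σ x → 0 < T x := by
    intro x hx hlt
    obtain ⟨h0, -, -, -, hs⟩ := hT x hx
    refine h0.lt_of_ne fun h => hS x hx ?_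
    have h1 := hs hlt
    rwa [← h, (flowDomain_zero hX (G x)).2] at h1
  let ρ : M → ℝ := fun x => σ x + T x
  -- If there is an impact before `t`, nearby trajectories hit `S` at almost the same time, perhaps
  -- after an earlier hit of their own. Otherwise `ρ x = t`, the largest possible value of `ρ`.
  have husc : ∀ x ∈ V, ∀ c, ρ x < c → ∀ᶠ y in 𝓝 x, ρ y < c := by
    intro x hx c hc
    obtain ⟨-, hle, hD, -, hs⟩ := hT x hx
    rcases hle.lt_or_eq with hlt | heq
    · obtain ⟨p, hp⟩ := hs hlt
      obtain ⟨B⟩ := hH.nonempty_flowBox p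
      obtain ⟨h1, h2⟩ := B.eventually_hit (hcG x hx) hD hp.symm
      have h3 : Filter.Tendsto (fun y => σ y + (T x + B.θ (fl H.field (T x) (G y)))) (𝓝 x)
          (𝓝 (σ x + (T x + 0))) := (hcσ x hx).tendsto.add (h2.const_add (T x))
      have h4 := h2.const_add (T x)
      rw [add_zero] at h3 h4
      filter_upwards [h1, h3.eventually_lt_const hc, h4.eventually_const_lt (hpos x hx hlt),
        hV.mem_nhds hx] with y hy1 hy2 hy3 hy4
      refine lt_of_le_of_lt (add_le_add_right (not_lt.1 fun h => ?_) _) hy2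
      exact (hT y hy4).2.2.2.1 _ ⟨hy3.le, h⟩ ⟨_, hy1.2.2.symm⟩
    · filter_upwards [hV.mem_nhds hx] with y hy
      have h1 := (hT y hy).2.1
      have h2 : σ x + T x < c := hc
      change σ y + T y < c
      linarith
  by_cases hW : ∃ x ∈ V, ρ x < t
  · right
    have hWo : IsOpen {x | x ∈ V ∧ ρ x < t} := isOpen_iff_mem_nhds.2 fun x hx =>
      Filter.inter_mem (hV.mem_nhds hx.1) (husc x hx.1 t hx.2)
    -- Continuity of `ρ` at `x₀` forces nearby first impact times into the window of length `δ` on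
    -- either side of `T x₀`, where the flow box sees every hit.
    obtain ⟨x₀, ⟨hx₀, hx₀t⟩, hcρ⟩ := exists_continuousAt_of_upperSemicontinuous hV hWo
      (fun x hx => hx.1) hW husc
    obtain ⟨-, -, hD, -, hs⟩ := hT x₀ hx₀
    have hlt : ∀ x, ρ x < t → T x < t - σ x := fun x hx => by
      have h : σ x + T x < t := hx
      linarith
    obtain ⟨p, hp⟩ := hs (hlt x₀ hx₀t)
    obtain ⟨B⟩ := hH.nonempty_flowBox p
    obtain ⟨h1, -⟩ := B.eventually_hit (hcG x₀ hx₀) hD hp.symm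
    have hcT : Filter.Tendsto (fun x => |T x - T x₀|) (𝓝 x₀) (𝓝 0) := by
      have h : ContinuousAt (fun x => |ρ x - σ x - T x₀|) x₀ :=
        ((hcρ.sub (hcσ x₀ hx₀)).sub continuousAt_const).abs
      have h' := h.tendsto
      simpa [ρ] using h'
    let A : Set M := {x | ((T x₀, G x) ∈ flowDomain H.field ∧ fl H.field (T x₀) (G x) ∈ B.O) ∧
      (x ∈ V ∧ ρ x < t) ∧ |T x - T x₀| < B.δ}
    have hAn : A ∈ 𝓝 x₀ := by
      filter_upwards [h1, hWo.mem_nhds ⟨hx₀, hx₀t⟩, hcT.eventually_lt_const B.δ_pos] with x h1 h2 h3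
      exact ⟨⟨h1.1, h1.2.1⟩, h2, h3⟩
    refine ⟨interior A, fun x => H.reset (B.π (fl H.field (T x₀) (G x))),
      fun x => σ x + T x₀ + B.θ (fl H.field (T x₀) (G x)), isOpen_interior,
      ⟨x₀, mem_interior_iff_mem_nhds.2 hAn⟩, fun x hx => (interior_subset hx).2.1.1, ?_, ?_, ?_⟩
    · intro x hx
      obtain ⟨⟨hxD, hxO⟩, ⟨hxV, -⟩, -⟩ := interior_subset hx
      have a1 := (hA x hxV).fl hX hα hL (hasTD_const (T x₀) x) hxD
      obtain ⟨G₁', -, hG₁, -⟩ := id a1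
      have a2 := a1.fl hX hα hL ((B.hasTD_θ hxO).comp hG₁ rfl)
        (B.mem_flowDomain _ hxO _ (B.abs_θ_lt _ hxO))
      refine a2.reset hH hJ ((B.hasTD_π hxO).comp hG₁ rfl) ?_
      filter_upwards [hG₁.continuousAt.eventually_mem (B.isOpen_O.mem_nhds hxO)] with z hz
      exact B.fl_θ _ hz
    · intro x _ hxS
      exact disjoint_left.1 H.disjoint_range hxS ⟨_, rfl⟩
    · intro x hx n hn
      obtain ⟨⟨hxD, hxO⟩, ⟨hxV, hxt⟩, hxδ⟩ := interior_subset hx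
      obtain ⟨g0, -, gD, gN, gS⟩ := hT x hxV
      have hsub := flowDomain_sub hX hxD gD
      -- Both sides are hit times of the same point of the box within `(-δ, δ)`, and the box allows
      -- only one.
      have hTθ : T x - T x₀ = B.θ (fl H.field (T x₀) (G x)) := by
        refine B.eq_θ _ hxO _ hxδ ?_
        rw [hsub.2]
        exact gS (hlt x hxt)
      have hit : fl H.field (T x) (G x) = H.emb (B.π (fl H.field (T x₀) (G x))) := by
        rw [← hsub.2, hTθ]
        exact B.fl_θ _ hxO
      obtain ⟨k, hk, hkf⟩ := hn.of_hit gN g0 (hlt x hxt) hit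
      refine ⟨k, hk, ?_⟩
      have he : t - (σ x + T x₀ + B.θ (fl H.field (T x₀) (G x))) = t - σ x - T x := by
        rw [← hTθ]
        ring
      rw [he]
      exact hkf
  · left
    push Not at hW
    have hfl : ∀ x ∈ V, (t - σ x, G x) ∈ flowDomain H.field ∧ fl H.field (t - σ x) (G x) = f x := by
      intro x hx
      obtain ⟨-, g1, -, gN, -⟩ := hT x hx
      have g2 : t ≤ σ x + T x := hW x hx
      have g3 : T x = t - σ x := by linarith
      obtain ⟨n, hn⟩ := hf x hx
      exact hn.of_noHit (g3 ▸ gN)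
    obtain ⟨x, hx⟩ := hne
    obtain ⟨-, σ', -, hσ, -⟩ := id (hA x hx)
    have hτ : HasTD 𝓘(ℝ, E) 𝓘(ℝ, ℝ) (fun z => t - σ z) x (0 - σ') :=
      HasMFDerivAt.sub (hasTD_const t x) hσ
    have a1 := (hA x hx).fl hX hα hL hτ (hfl x hx).1
    -- The accumulated time is `σ + (t - σ)`, a constant, so the correction term vanishes.
    have a2 : Adapted α H.field f (fun _ => t) x := by
      refine a1.congr ?_ (Filter.Eventually.of_forall fun z => by ring)
      filter_upwards [hV.mem_nhds hx] with z hz using (hfl z hz).2.symm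
    obtain ⟨f', σ'', hf', hσ'', hv⟩ := a2
    have hσ0 : σ'' = 0 := hσ''.unique (hasTD_const t x)
    refine ⟨x, hx, f', hf', fun v => ?_⟩
    simpa [hσ0] using hv v

/-- Each passage through an impact lowers the bound `N` by one, and density of the points with at
most `N` impacts survives restriction to an open subset. With `N = 0`, such a passage would
contradict density. -/
theorem exists_frm_pullback_eq [BaireSpace M] (hH : H.IsSmooth) (hα : α.IsSmooth)
    (hL : ∀ (x : M) (v : Fin m → TangentSpace 𝓘(ℝ, E) x), lieDeriv H.field α x v = 0)
    (hJ : ∀ (p : S) (v : Fin m → TangentSpace 𝓘(ℝ, E) (H.emb p)),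
        α (H.reset p) (fun i => hH.augmentedDifferential p (v i)) = α (H.emb p) v)
    {t : ℝ} {f : M → M} (N : ℕ) : ∀ (V : Set M) (G : M → M) (σ : M → ℝ), IsOpen V → V.Nonempty →
      (∀ x ∈ V, Adapted α H.field G σ x) → (∀ x ∈ V, G x ∉ H.surface) →
      (∀ x ∈ V, ∃ n, FlowN H n (t - σ x) (G x) (f x)) →
      V ⊆ closure {x | x ∈ V ∧ ∃ n ≤ N, FlowN H n (t - σ x) (G x) (f x)} →
      ∃ x ∈ V, ∃ f' : E →L[ℝ] E, HasTD 𝓘(ℝ, E) 𝓘(ℝ, E) f x f' ∧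
        ∀ v : Fin m → E, frm α (f x) (fun i => f' (v i)) = frm α x v := by
  induction N with
  | zero =>
    intro V G σ hV hne hA hS hf hN
    refine (exists_frm_pullback_eq_or_reset hH hα hL hJ hV hne hA hS hf).resolve_right ?_
    rintro ⟨V', G', σ', hV', ⟨x, hx⟩, hVV, -, -, hn⟩
    obtain ⟨y, hy, -, n, hn0, hny⟩ := mem_closure_iff.1 (hN (hVV hx)) V' hV' hx
    obtain ⟨k, rfl, -⟩ := hn y hy n hny
    omega
  | succ N ih =>
    intro V G σ hV hne hA hS hf hN
    rcases exists_frm_pullback_eq_or_reset hH hα hL hJ hV hne hA hS hf with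
      h | ⟨V', G', σ', hV', hne', hVV, hA', hS', hn⟩
    · exact h
    obtain ⟨x, hx, h⟩ := ih V' G' σ' hV' hne' hA' hS' (fun x hx => by
      obtain ⟨n, hnx⟩ := hf x (hVV hx)
      obtain ⟨k, -, hk⟩ := hn x hx n hnx
      exact ⟨k, hk⟩) (fun x hx => mem_closure_iff.2 fun W hW hxW => by
      obtain ⟨y, ⟨hyW, hyV⟩, -, n, hnN, hny⟩ :=
        mem_closure_iff.1 (hN (hVV hx)) (W ∩ V') (hW.inter hV') ⟨hxW, hx⟩
      obtain ⟨k, rfl, hk⟩ := hn y hyV n hny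
      exact ⟨y, hyW, hyV, k, by omega, hk⟩)
    exact ⟨x, hVV hx, h⟩

/-- A countable cover of a nonempty open set by an increasing sequence of sets contains a set that
is dense in some nonempty open subset. -/
theorem exists_subset_closure_of_iUnion {M : Type*} [TopologicalSpace M] [BaireSpace M]
    {ι : Type*} [Countable ι] {U : Set M} (hU : IsOpen U) (hne : U.Nonempty) {D : ι → Set M}
    (hD : ∀ x ∈ U, ∃ n, x ∈ D n) : ∃ n, ∃ V ⊆ U, IsOpen V ∧ V.Nonempty ∧ V ⊆ closure (V ∩ D n) := by
  by_contra! h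
  have hd : Dense (⋂ n, (closure (U ∩ D n))ᶜ) := by
    refine dense_iInter_of_isOpen (fun n => isClosed_closure.isOpen_compl) fun n => ?_
    rw [← interior_eq_empty_iff_dense_compl]
    by_contra hn
    obtain ⟨x, hx⟩ := nonempty_iff_ne_empty.2 hn
    obtain ⟨y, hy, hyU, hyD⟩ := mem_closure_iff.1 (interior_subset hx) _ isOpen_interior hx
    refine h n (interior (closure (U ∩ D n)) ∩ U) inter_subset_right (isOpen_interior.inter hU)
      ⟨y, hy, hyU⟩ ?_
    rintro z ⟨hz, hzU⟩
    refine mem_closure_iff.2 fun W hW hzW => ?_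
    obtain ⟨w, ⟨hwW, hw⟩, hwU, hwD⟩ := mem_closure_iff.1 (interior_subset hz)
      (W ∩ interior (closure (U ∩ D n))) (hW.inter isOpen_interior) ⟨hzW, hz⟩
    exact ⟨w, hwW, ⟨hw, hwU⟩, hwD⟩
  obtain ⟨x, hxU, hx⟩ := hd.inter_open_nonempty U hU hne
  obtain ⟨n, hn⟩ := hD x hxU
  exact mem_iInter.1 hx n (subset_closure ⟨hxU, hn⟩)

/-- The induction starts from the identity with elapsed time `0`, allowed because `U` avoids the
surface. It yields equality at a dense set of points of `U`; both sides, evaluated on vectors that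
are constant in a chart, are continuous. -/
theorem isInvariant_of_lieDeriv_eq_zero [BaireSpace M] (hH : H.IsSmooth) (hα : α.IsSmooth)
    (hL : ∀ (x : M) (v : Fin m → TangentSpace 𝓘(ℝ, E) x), lieDeriv H.field α x v = 0)
    (hJ : ∀ (p : S) (v : Fin m → TangentSpace 𝓘(ℝ, E) (H.emb p)),
        α (H.reset p) (fun i => hH.augmentedDifferential p (v i)) = α (H.emb p) v) :
    H.IsInvariant α := by
  intro t ht U f hU hdisj hflow hf x₀ hx₀ _ v
  revert v
  suffices h : ∀ v : Fin m → E, frm α (f x₀) (fun i => tderiv 𝓘(ℝ, E) 𝓘(ℝ, E) f x₀ (v i)) =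
      frm α x₀ v from h
  intro v
  have hfat : ∀ x ∈ U, ContMDiffAt 𝓘(ℝ, E) 𝓘(ℝ, E) ∞ f x := fun x hx =>
    hf.contMDiffAt (hU.mem_nhds hx)
  have hdense : ∀ W : Set M, IsOpen W → W ⊆ U → W.Nonempty → ∃ x ∈ W, ∀ w : Fin m → E,
      frm α (f x) (fun i => tderiv 𝓘(ℝ, E) 𝓘(ℝ, E) f x (w i)) = frm α x w := by
    intro W hW hWU hne
    have hfn : ∀ x ∈ U, ∃ n, FlowN H n t x (f x) := fun x hx => (hflow x hx).exists_flowN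
    obtain ⟨n, V, hVW, hV, hVne, hVd⟩ := exists_subset_closure_of_iUnion hW hne
      (D := fun n => {x | FlowN H n t x (f x)}) fun x hx => hfn x (hWU hx)
    obtain ⟨x, hx, f', hf', hv⟩ := exists_frm_pullback_eq hH hα hL hJ (t := t) (f := f) n V
      (fun z => z) (fun _ => 0) hV hVne
      (fun x _ => ⟨_, 0, hasTD_id x, hasTD_const 0 x, fun v => by simp⟩)
      (fun x hx => disjoint_left.1 hdisj (hWU (hVW hx)))
      (fun x hx => by simpa using hfn x (hWU (hVW hx)))
      (hVd.trans (closure_mono fun x hx => ⟨hx.1, n, le_rfl, by simpa using hx.2⟩))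
    refine ⟨x, hVW hx, fun w => ?_⟩
    rw [hf'.tderiv]
    exact hv w
  have h1 : ContinuousAt (fun z => frm α (f z) (fun i =>
      tderiv 𝓘(ℝ, E) 𝓘(ℝ, E) f z (chartConst (E' := E) x₀ (v i) z))) x₀ :=
    continuousAt_frm hα (hfat x₀ hx₀).continuousAt fun i =>
      continuousAt_tderiv_chart_tderiv (hfat x₀ hx₀) (v i)
  have hid : ∀ z : M, tderiv 𝓘(ℝ, E) 𝓘(ℝ, E) (fun z : M => z) z = ContinuousLinearMap.id ℝ E :=
    fun z => (hasTD_id z).tderiv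
  have h2 : ContinuousAt (fun z => frm α z (fun i => chartConst (E' := E) x₀ (v i) z)) x₀ := by
    refine continuousAt_frm hα continuousAt_id fun i => ?_
    have h := continuousAt_tderiv_chart_tderiv (f := fun z : M => z) (z₀ := x₀)
      contMDiffAt_id (v i)
    simp only [hid] at h
    exact h
  have hfreq : ∃ᶠ z in 𝓝 x₀, frm α (f z) (fun i =>
      tderiv 𝓘(ℝ, E) 𝓘(ℝ, E) f z (chartConst (E' := E) x₀ (v i) z)) =
      frm α z (fun i => chartConst (E' := E) x₀ (v i) z) := by
    rw [frequently_nhds_iff]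
    intro W hxW hW
    obtain ⟨x, hx, h⟩ := hdense (W ∩ U) (hW.inter hU) inter_subset_right ⟨x₀, hxW, hx₀⟩
    exact ⟨x, hx.1, h _⟩
  have h3 := tendsto_nhds_unique_of_frequently_eq h1.tendsto h2.tendsto hfreq
  have h4 : ∀ i, chartConst (E' := E) x₀ (v i) x₀ = v i := fun i => chartConst_self x₀ (v i)
  simp only [h4] at h3
  exact h3

end Sufficiency

/-! ### Hybrid trajectories from the continuous flow, and consequences of invariance -/

section Necessity

variable {E : Type*} [NormedAddCommGroup E] [NormedSpace ℝ E] [FiniteDimensional ℝ E]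
  {M : Type*} [TopologicalSpace M] [T2Space M] [ChartedSpace E M] [IsManifold 𝓘(ℝ, E) ∞ M]
  {F : Type*} [NormedAddCommGroup F] [NormedSpace ℝ F] [FiniteDimensional ℝ F]
  {S : Type*} [TopologicalSpace S] [ChartedSpace F S] [IsManifold 𝓘(ℝ, F) ∞ S]
  {H : HybridSystem E M F S} {m : ℕ} {α : Form E M m}

theorem isMIntegralCurveOn_fl {X : ∀ x : M, TangentSpace 𝓘(ℝ, E) x} (hX : SmoothField X) {x : M}
    {s : Set ℝ} (h : ∀ u ∈ s, (u, x) ∈ flowDomain X) :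
    IsMIntegralCurveOn (fun u => fl X u x) X s := by
  intro u hu
  obtain ⟨a, b, -, hs, -, -, hγ⟩ := exists_curve_fl hX (h u hu)
  exact ((hγ u hs).hasMFDerivAt (isOpen_Ioo.mem_nhds hs)).hasMFDerivWithinAt

theorem mem_flowDomain_of_le {X : ∀ x : M, TangentSpace 𝓘(ℝ, E) x} (hX : SmoothField X) {x : M}
    {t : ℝ} (h : (t, x) ∈ flowDomain X) {s : ℝ} (hs : s ∈ Icc 0 t) : (s, x) ∈ flowDomain X := by
  obtain ⟨a, b, h0, ht, hD, -⟩ := exists_curve_fl hX h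
  exact hD s ⟨h0.1.trans_le hs.1, hs.2.trans_lt ht.2⟩

theorem flow_fl {t : ℝ} {x : M} (ht : 0 ≤ t) (h : (t, x) ∈ flowDomain H.field)
    (hx : NoHit H x t) : H.Flow t x (fl H.field t x) :=
  .continuous (fun u => fl H.field u x) ht (flowDomain_zero H.smoothField x).2 rfl
    (isMIntegralCurveOn_fl H.smoothField fun _ hu => mem_flowDomain_of_le H.smoothField h hu) hx

theorem flow_impact {τ r : ℝ} {x y : M} {p : S} (hτ : 0 ≤ τ) (h : (τ, x) ∈ flowDomain H.field)
    (hx : NoHit H x τ) (hp : fl H.field τ x = H.emb p) (hr : 0 < r) (hy : H.Flow r (H.reset p) y) :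
    H.Flow (τ + r) x y :=
  .impact (fun u => fl H.field u x) hτ (flowDomain_zero H.smoothField x).2 hp
    (isMIntegralCurveOn_fl H.smoothField fun _ hu => mem_flowDomain_of_le H.smoothField h hu)
    hx hr hy

/-- The closure of the surface has empty interior. -/
theorem HybridSystem.IsSmooth.dense_compl_closure_surface (hH : H.IsSmooth) :
    Dense (closure H.surface)ᶜ := by
  have hX := H.smoothField
  rw [← interior_eq_empty_iff_dense_compl]
  by_contra hne
  obtain ⟨x, hx⟩ := nonempty_iff_ne_empty.2 hne
  obtain ⟨_, hy, p, rfl⟩ := mem_closure_iff.1 (interior_subset hx) _ isOpen_interior hx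
  obtain ⟨B⟩ := hH.nonempty_flowBox p
  have hD := flowDomain_zero hX (H.emb p)
  have hO : interior (closure H.surface) ∩ B.O ∈ 𝓝 (H.emb p) :=
    Filter.inter_mem (isOpen_interior.mem_nhds hy) (B.isOpen_O.mem_nhds B.mem_O)
  have hev : ∀ᶠ s in 𝓝 (0 : ℝ), (s, H.emb p) ∈ flowDomain H.field ∧
      fl H.field s (H.emb p) ∈ interior (closure H.surface) ∩ B.O ∧ |s| < B.δ := by
    have hc : ContinuousAt (fun s : ℝ => (s, H.emb p)) 0 := by fun_prop
    have hc2 := (hasTD_fl_time hX hD.1).continuousAt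
    refine (hc.eventually_mem ((isOpen_flowDomain hX).mem_nhds hD.1)).and
      ((hc2.eventually_mem (by rwa [hD.2])).and ?_)
    exact continuous_abs.continuousAt.eventually_lt continuousAt_const (by simpa using B.δ_pos)
  obtain ⟨s, hs, hs0⟩ : ∃ s : ℝ, ((s, H.emb p) ∈ flowDomain H.field ∧
      fl H.field s (H.emb p) ∈ interior (closure H.surface) ∩ B.O ∧ |s| < B.δ) ∧ s ≠ 0 :=
    ((hev.filter_mono nhdsWithin_le_nhds).and (eventually_mem_nhdsWithin (s := {0}ᶜ))).exists
  obtain ⟨hsD, ⟨hsI, hsO⟩, hsδ⟩ := hs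
  have hback := flowDomain_neg hX hsD
  -- A point that has left `S` for the time `s ≠ 0` has a nonzero hit time, and so do its neighbours
  -- in the box. Points of `S` in the box have hit time `0`, so none of them is close.
  have hθ : -s = B.θ (fl H.field s (H.emb p)) := by
    refine B.eq_θ _ hsO _ (by rwa [abs_neg]) ?_
    rw [hback.2]
    exact ⟨p, rfl⟩
  have hne' : ∀ᶠ z in 𝓝 (fl H.field s (H.emb p)), B.θ z ≠ 0 :=
    (B.hasTD_θ hsO).continuousAt.eventually_ne (by rw [← hθ]; simpa using hs0)
  obtain ⟨W, hW, hWo, hWm⟩ := mem_nhds_iff.1 (Filter.inter_mem hne' (B.isOpen_O.mem_nhds hsO))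
  obtain ⟨_, hz, q, rfl⟩ := mem_closure_iff.1 (interior_subset hsI) W hWo hWm
  exact (hW hz).1 (B.θ_emb (hW hz).2)

/-! ### The Lie derivative of an invariant form -/

/-- Near `x` the hybrid flow agrees with `fl` for a short time, so the pulled-back form is constant
on `[0, ε)`. Its one-sided derivative at `0` determines the Lie derivative. -/
theorem flatLieDeriv_eq_zero_of_notMem_closure (hα : α.IsSmooth) (hI : H.IsInvariant α)
    {x₀ x : M} (hx : x ∈ (extChartAt 𝓘(ℝ, E) x₀).source) (hxS : x ∉ closure H.surface)
    (v : Fin m → E) :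
    flatLieDeriv (chartField H.field x₀) (α.inChart x₀) (extChartAt 𝓘(ℝ, E) x₀ x)
        (fun i => tderiv 𝓘(ℝ, E) 𝓘(ℝ, E) (extChartAt 𝓘(ℝ, E) x₀) x (v i)) = 0 := by
  have hX := H.smoothField
  have hD := flowDomain_zero hX x
  have hev : ∀ᶠ q in 𝓝 ((0 : ℝ), x), q ∈ flowDomain H.field ∧
      Function.uncurry (fl H.field) q ∈ (closure H.surface)ᶜ := by
    refine .and ((isOpen_flowDomain hX).mem_nhds hD.1) ?_
    refine (contMDiffAt_fl hX hD.1).continuousAt.eventually_mem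
      (isClosed_closure.isOpen_compl.mem_nhds ?_)
    change fl H.field 0 x ∉ _
    rwa [hD.2]
  obtain ⟨I, hI0, U, hU, hIU⟩ := mem_nhds_prod_iff.1 hev
  obtain ⟨ε, hε, hball⟩ := Metric.mem_nhds_iff.1 hI0
  have hgood : ∀ s ∈ Ico 0 ε, ∀ z ∈ U, (s, z) ∈ flowDomain H.field ∧
      fl H.field s z ∉ closure H.surface := fun s hs z hz =>
    hIU (mk_mem_prod (hball (by simpa [abs_of_nonneg hs.1] using hs.2)) hz)
  have hconst : ∀ s ∈ Ico 0 ε,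
      frm α (fl H.field s x) (fun i => dfl H.field s x (v i)) = frm α x v := by
    intro s hs
    have h0 : (0 : ℝ) ∈ Ico 0 ε := ⟨le_rfl, hε⟩
    refine hI s hs.1 (interior U) (fl H.field s) isOpen_interior ?_ ?_ ?_ x
      (mem_interior_iff_mem_nhds.2 hU) ?_ v
    · refine disjoint_left.2 fun z hz hzS => (hgood 0 h0 z (interior_subset hz)).2 ?_
      rw [(flowDomain_zero hX z).2]
      exact subset_closure hzS
    · intro z hz
      refine flow_fl hs.1 (hgood s hs z (interior_subset hz)).1 fun u hu huS => ?_
      exact (hgood u ⟨hu.1, hu.2.trans hs.2⟩ z (interior_subset hz)).2 (subset_closure huS)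
    · exact fun z hz =>
        (contMDiffAt_fl_right hX (hgood s hs z (interior_subset hz)).1).contMDiffWithinAt
    · exact fun h => (hgood s hs x (mem_of_mem_nhds hU)).2 (subset_closure h)
  have hd := (hasDerivAt_frm_fl_zero hX hα hx v).hasDerivWithinAt (s := Ico 0 ε)
  have hd0 : HasDerivWithinAt (fun s => frm α (fl H.field s x) (fun i => dfl H.field s x (v i)))
      0 (Ico 0 ε) 0 :=
    (hasDerivWithinAt_const (0 : ℝ) (Ico 0 ε) (frm α x v)).congr hconst (hconst 0 ⟨le_rfl, hε⟩)
  exact (uniqueDiffOn_Ico 0 ε 0 ⟨le_rfl, hε⟩).eq_deriv _ hd hd0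

theorem continuousAt_flatLieDeriv {V : E → E} {η : E → E [⋀^Fin m]→L[ℝ] ℝ} {y : E}
    (hV : ContDiffAt ℝ ∞ V y) (hη : ContDiffAt ℝ ∞ η y) (w : Fin m → E) :
    ContinuousAt (fun z => flatLieDeriv V η z w) y := by
  have h1 : ContinuousAt (fderiv ℝ V) y := (hV.fderiv_right (m := ∞) (by simp)).continuousAt
  have h2 : ContinuousAt (fderiv ℝ η) y := (hη.fderiv_right (m := ∞) (by simp)).continuousAt
  have h3 : ContinuousAt (fun z => fderiv ℝ η z (V z)) y := h2.clm_apply hV.continuousAt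
  refine (h3.eval continuousAt_const).add (tendsto_finsetSum _ fun i _ => ?_)
  refine hη.continuousAt.eval ?_
  exact continuousAt_const.update i (h1.clm_apply continuousAt_const)

/-- The expression is continuous in a fixed chart and vanishes on the complement of the closure of
the surface, which is dense. -/
theorem lieDeriv_eq_zero_of_isInvariant (hH : H.IsSmooth) (hα : α.IsSmooth)
    (hI : H.IsInvariant α) (x : M) (v : Fin m → TangentSpace 𝓘(ℝ, E) x) :
    lieDeriv H.field α x v = 0 := by
  let c := extChartAt 𝓘(ℝ, E) x
  have hmem : x ∈ c.source := mem_extChartAt_source x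
  have hctar : c.target ∈ 𝓝 (c x) := (isOpen_extChartAt_target x).mem_nhds (c.map_source hmem)
  let w : Fin m → E := fun i => tderiv 𝓘(ℝ, E) 𝓘(ℝ, E) c x (v i)
  have hc := continuousAt_flatLieDeriv (m := m)
    ((contDiffOn_chartField H.smoothField x).contDiffAt hctar) ((hα x).contDiffAt hctar) w
  have hc' : ContinuousAt (fun z => flatLieDeriv (chartField H.field x) (α.inChart x) (c z) w) x :=
    ContinuousAt.comp' (f := c) hc (contMDiffAt_chart hmem).continuousAt
  have hfreq : ∃ᶠ z in 𝓝 x,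
      flatLieDeriv (chartField H.field x) (α.inChart x) (c z) w = 0 := by
    have h1 : ∃ᶠ z in 𝓝 x, z ∈ (closure H.surface)ᶜ :=
      mem_closure_iff_frequently.1 (hH.dense_compl_closure_surface x)
    refine (h1.and_eventually ((isOpen_extChartAt_source (I := 𝓘(ℝ, E)) x).mem_nhds hmem)).mono ?_
    rintro z ⟨hz, hzc⟩
    -- The tangent vectors at `z` are chosen so that their components in the fixed chart are the
    -- constant `w`.
    have h2 := flatLieDeriv_eq_zero_of_notMem_closure hα hI hzc hz
      (fun i => tderiv 𝓘(ℝ, E) 𝓘(ℝ, E) c.symm (c z) (w i))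
    have h3 : (fun i => tderiv 𝓘(ℝ, E) 𝓘(ℝ, E) c z
        (tderiv 𝓘(ℝ, E) 𝓘(ℝ, E) c.symm (c z) (w i))) = w := by
      funext i
      have h4 := DFunLike.congr_fun (tderiv_chart_comp_symm (c.map_source hzc)) (w i)
      rw [c.left_inv hzc] at h4
      exact h4
    rw [h3] at h2
    exact h2
  exact tendsto_nhds_unique_of_frequently_eq hc'.tendsto tendsto_const_nhds hfreq

end Necessity

section Necessity

variable {E : Type*} [NormedAddCommGroup E] [NormedSpace ℝ E] [FiniteDimensional ℝ E]
  {M : Type*} [TopologicalSpace M] [T2Space M] [ChartedSpace E M] [IsManifold 𝓘(ℝ, E) ∞ M]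
  {F : Type*} [NormedAddCommGroup F] [NormedSpace ℝ F] [FiniteDimensional ℝ F]
  {S : Type*} [TopologicalSpace S] [ChartedSpace F S] [IsManifold 𝓘(ℝ, F) ∞ S]
  {H : HybridSystem E M F S} {m : ℕ} {α : Form E M m}

/-! ### The behaviour of an invariant form under the reset map -/

/-- Up to and including its first hit, the hybrid flow is `fl`, since the value at an impact is the
state before the reset. A first hit inside `(0, ε)` would thus be a hybrid state on the surface. -/
theorem notMem_surface_of_flow {x : M} {ε : ℝ} (hx : x ∉ H.surface)
    (h : ∀ s ∈ Ioo 0 ε, ∃ z, H.Flow s x z ∧ z ∉ H.surface) :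
    ∀ s ∈ Ico 0 ε, (s, x) ∈ flowDomain H.field → fl H.field s x ∉ H.surface := by
  have hX := H.smoothField
  have key : ∀ s ∈ Ioo 0 ε, NoHit H x s → fl H.field s x ∉ H.surface := by
    intro s hs hN
    obtain ⟨z, hz, hzS⟩ := h s hs
    obtain ⟨n, hn⟩ := hz.exists_flowN
    rwa [(hn.of_noHit hN).2]
  intro s hs hD hS
  rcases hs.1.eq_or_lt with rfl | h0
  · rw [(flowDomain_zero hX x).2] at hS
    exact hx hS
  obtain ⟨z, hz, hzS⟩ := h s ⟨h0, hs.2⟩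
  obtain ⟨n, hn⟩ := hz.exists_flowN
  obtain ⟨T, hT0, hTs, -, hTN, hTS⟩ := hn.exists_event
  rcases hTs.lt_or_eq with hlt | rfl
  · rcases hT0.eq_or_lt with rfl | hT0
    · have h1 := hTS hlt
      rw [(flowDomain_zero hX x).2] at h1
      exact hx h1
    · exact key T ⟨hT0, hlt.trans hs.2⟩ hTN (hTS hlt)
  · exact key T ⟨h0, hs.2⟩ hTN hS

theorem HybridSystem.reset_notMem_surface (q : S) : H.reset q ∉ H.surface := fun h =>
  disjoint_left.1 H.disjoint_range h ⟨q, rfl⟩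

/-- After a reset, the surface is avoided for some time. -/
theorem HybridSystem.IsSmooth.exists_avoid (hH : H.IsSmooth) (q : S) :
    ∃ ε > 0, ∀ s ∈ Ico 0 ε, (s, H.reset q) ∈ flowDomain H.field →
      fl H.field s (H.reset q) ∉ H.surface := by
  have hX := H.smoothField
  have hD := flowDomain_zero hX (H.reset q)
  by_cases hq : H.reset q ∈ closure H.surface
  · have hflow : H.Flow 0 (H.reset q) (H.reset q) := by
      have h := flow_fl (H := H) le_rfl hD.1 fun s hs => absurd hs (by simp)
      rwa [hD.2] at h
    obtain ⟨ε, hε, h⟩ := hH.avoid 0 _ _ hflow ⟨hq, H.reset_notMem_surface q⟩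
    refine ⟨ε, hε, notMem_surface_of_flow (H.reset_notMem_surface q) fun s hs => ?_⟩
    simpa using h s hs
  · have hc := (hasTD_fl_time hX hD.1).continuousAt
    have hev : ∀ᶠ s in 𝓝 (0 : ℝ), fl H.field s (H.reset q) ∈ (closure H.surface)ᶜ :=
      hc.eventually_mem (isClosed_closure.isOpen_compl.mem_nhds (by rwa [hD.2]))
    obtain ⟨ε, hε, hball⟩ := Metric.mem_nhds_iff.1 hev
    refine ⟨ε, hε, fun s hs _ hS => ?_⟩
    exact hball (by simpa [abs_of_nonneg hs.1] using hs.2) (subset_closure hS)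

/-- On a dense set of impact points, the surface is avoided after the reset for a locally uniform
time. -/
theorem HybridSystem.IsSmooth.exists_uniform_avoid [BaireSpace S] (hH : H.IsSmooth) {W : Set S}
    (hW : IsOpen W) (hne : W.Nonempty) :
    ∃ q ∈ W, ∃ ε > 0, ∀ᶠ q' in 𝓝 q, ∀ s ∈ Ico 0 ε, (s, H.reset q') ∈ flowDomain H.field ∧
      fl H.field s (H.reset q') ∉ H.surface := by
  have hX := H.smoothField
  have hΔ : Continuous H.reset := H.contMDiff_reset.continuous
  -- Every impact point avoids the surface for some time `1 / (k + 1)` after its reset; by Baire,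
  -- one `k` serves a dense subset of an open set `V`.
  obtain ⟨k, V, hVW, hV, ⟨q, hq⟩, hVd⟩ := exists_subset_closure_of_iUnion hW hne
    (D := fun k : ℕ => {q | ∀ s ∈ Ico 0 (1 / ((k : ℝ) + 1)),
      (s, H.reset q) ∈ flowDomain H.field → fl H.field s (H.reset q) ∉ H.surface})
    (fun q _ => by
      obtain ⟨ε, hε, h⟩ := hH.exists_avoid q
      obtain ⟨k, hk⟩ := exists_nat_one_div_lt hε
      exact ⟨k, fun s hs => h s ⟨hs.1, hs.2.trans hk⟩⟩)
  have hev : ∀ᶠ z in 𝓝 ((0 : ℝ), q), (z.1, H.reset z.2) ∈ flowDomain H.field := by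
    have hc : ContinuousAt (fun z : ℝ × S => (z.1, H.reset z.2)) (0, q) := by fun_prop
    exact hc.eventually_mem ((isOpen_flowDomain hX).mem_nhds (flowDomain_zero hX _).1)
  obtain ⟨I, hI0, Q, hQ, hIQ⟩ := mem_nhds_prod_iff.1 hev
  obtain ⟨ε, hε, hball⟩ := Metric.mem_nhds_iff.1 hI0
  have hk : (0 : ℝ) < 1 / ((k : ℝ) + 1) := by positivity
  refine ⟨q, hVW hq, min ε (1 / ((k : ℝ) + 1)), lt_min hε hk, ?_⟩
  filter_upwards [hQ, hV.mem_nhds hq] with q' hq'Q hq'V s hs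
  have hD : (s, H.reset q') ∈ flowDomain H.field := hIQ (mk_mem_prod
    (hball (by simpa [abs_of_nonneg hs.1] using hs.2.trans_le (min_le_left _ _))) hq'Q)
  refine ⟨hD, ?_⟩
  rintro ⟨p, hp⟩
  rcases hs.1.eq_or_lt with rfl | hs0
  · rw [(flowDomain_zero hX _).2] at hp
    exact H.reset_notMem_surface q' ⟨p, hp⟩
  -- A hit after `q'` would be transverse, so it would persist at almost the same time after nearby
  -- points, including points of the dense subset. Hence the bound holds on all of `V`.
  obtain ⟨B⟩ := hH.nonempty_flowBox p
  have hfl : ContinuousAt (fun z => fl H.field s (H.reset z)) q' :=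
    ContinuousAt.comp' (contMDiffAt_fl_right hX hD).continuousAt hΔ.continuousAt
  have hθ : ContinuousAt (fun z => s + B.θ (fl H.field s (H.reset z))) q' := by
    refine continuousAt_const.add (ContinuousAt.comp' (f := fun z => fl H.field s (H.reset z)) ?_ hfl)
    rw [← hp]
    exact (B.hasTD_θ B.mem_O).continuousAt
  have hθ0 : s + B.θ (fl H.field s (H.reset q')) = s := by
    rw [← hp, B.θ_emb B.mem_O, add_zero]
  have hDc : ContinuousAt (fun z => (s, H.reset z)) q' := by fun_prop
  have hev' : ∀ᶠ z in 𝓝 q', (s, H.reset z) ∈ flowDomain H.field ∧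
      fl H.field s (H.reset z) ∈ B.O ∧
      s + B.θ (fl H.field s (H.reset z)) ∈ Ioo 0 (1 / ((k : ℝ) + 1)) := by
    refine (hDc.eventually_mem ((isOpen_flowDomain hX).mem_nhds hD)).and
      ((hfl.eventually_mem (B.isOpen_O.mem_nhds (by rw [← hp]; exact B.mem_O))).and
      (hθ.eventually_mem (isOpen_Ioo.mem_nhds ?_)))
    rw [hθ0]
    exact ⟨hs0, hs.2.trans_le (min_le_right _ _)⟩
  obtain ⟨Z, hZ, hZo, hqZ⟩ := mem_nhds_iff.1 hev'
  obtain ⟨z, hzZ, -, hz⟩ := mem_closure_iff.1 (hVd hq'V) Z hZo hqZ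
  obtain ⟨hz1, hz2, hz3⟩ := hZ hzZ
  have hadd := flowDomain_add hX hz1 (B.mem_flowDomain _ hz2 _ (B.abs_θ_lt _ hz2))
  refine hz _ ⟨hz3.1.le, hz3.2⟩ hadd.1 ?_
  rw [hadd.2, B.fl_θ _ hz2]
  exact ⟨_, rfl⟩

/-- The reset condition at impact points after which the surface is avoided for a locally uniform
time. -/
theorem frm_reset_eq_of_uniform_avoid (hH : H.IsSmooth) (hα : α.IsSmooth) (hI : H.IsInvariant α)
    {q : S} {ε : ℝ} (hε : 0 < ε)
    (hq : ∀ᶠ q' in 𝓝 q, ∀ s ∈ Ico 0 ε, (s, H.reset q') ∈ flowDomain H.field ∧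
      fl H.field s (H.reset q') ∉ H.surface) (u : Fin m → F) (a : Fin m → ℝ) :
    frm α (H.reset q) (fun i => tderiv 𝓘(ℝ, F) 𝓘(ℝ, E) H.reset q (u i) +
        a i • vec H.field (H.reset q)) =
      frm α (H.emb q) (fun i => tderiv 𝓘(ℝ, F) 𝓘(ℝ, E) H.emb q (u i) +
        a i • vec H.field (H.emb q)) := by
  have hX := H.smoothField
  have hL := lieDeriv_eq_zero_of_isInvariant hH hα hI
  have hemb : ContMDiff 𝓘(ℝ, F) 𝓘(ℝ, E) ∞ H.emb := H.isSmoothEmbedding_emb.contMDiff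
  obtain ⟨B⟩ := hH.nonempty_flowBox q
  -- the backward motion from the surface, and its impact data
  have hk : ∀ q' : S, ∀ r : ℝ, |r| < B.δ → (-r, H.emb q') ∈ flowDomain H.field →
      fl H.field (-r) (H.emb q') ∈ B.O →
      B.θ (fl H.field (-r) (H.emb q')) = r ∧ B.π (fl H.field (-r) (H.emb q')) = q' := by
    intro q' r hr hD hO
    have h1 := (flowDomain_neg hX hD).2
    rw [neg_neg] at h1
    have h2 := B.eq_θ _ hO r hr (by rw [h1]; exact ⟨q', rfl⟩)
    refine ⟨h2.symm, ?_⟩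
    have h3 := B.fl_θ _ hO
    rw [← h2, h1] at h3
    exact (H.isSmoothEmbedding_emb.isEmbedding.injective h3).symm
  obtain ⟨r, hr0, hrε, hrδ, hrD, hrO⟩ : ∃ r : ℝ, 0 < r ∧ r < ε ∧ |r| < B.δ ∧
      (-r, H.emb q) ∈ flowDomain H.field ∧ fl H.field (-r) (H.emb q) ∈ B.O := by
    have hD := flowDomain_zero hX (H.emb q)
    have hc : ContinuousAt (fun r : ℝ => (-r, H.emb q)) 0 := by fun_prop
    have hD' : (-(0 : ℝ), H.emb q) ∈ flowDomain H.field := by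
      rw [neg_zero]
      exact hD.1
    have hc2 : ContinuousAt (fun r : ℝ => fl H.field (-r) (H.emb q)) 0 :=
      ContinuousAt.comp' (f := fun r : ℝ => -r) (hasTD_fl_time hX hD').continuousAt
        continuousAt_neg
    have hev : ∀ᶠ r in 𝓝 (0 : ℝ), r < ε ∧ |r| < B.δ ∧
        (-r, H.emb q) ∈ flowDomain H.field ∧ fl H.field (-r) (H.emb q) ∈ B.O := by
      refine (eventually_lt_nhds hε).and (.and ?_ (.and ?_ ?_))
      · exact continuous_abs.continuousAt.eventually_lt continuousAt_const
          (by simpa using B.δ_pos)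
      · exact hc.eventually_mem ((isOpen_flowDomain hX).mem_nhds hD')
      · refine hc2.eventually_mem (B.isOpen_O.mem_nhds ?_)
        rw [neg_zero, hD.2]
        exact B.mem_O
    obtain ⟨r, hr, hr0⟩ := ((hev.filter_mono nhdsWithin_le_nhds).and
      (eventually_mem_nhdsWithin (s := Ioi (0 : ℝ)))).exists
    exact ⟨r, hr0, hr.1, hr.2.1, hr.2.2.1, hr.2.2.2⟩
  let x₁ := fl H.field (-r) (H.emb q)
  obtain ⟨hθ₁, hπ₁⟩ := hk q r hrδ hrD hrO
  -- The motion spends about `r` before the impact and about `r` after it; `r < ε` keeps the second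
  -- part away from the surface.
  let t := 2 * r
  let f : M → M := fun x => fl H.field (t - B.θ x) (H.reset (B.π x))
  -- The condition `0 < θ` excludes points of the surface and, by uniqueness of hits in the box,
  -- makes `θ x` the first impact time.
  let A : Set M := {x | x ∈ B.O ∧ (∀ s ∈ Ico 0 ε, (s, H.reset (B.π x)) ∈ flowDomain H.field ∧
      fl H.field s (H.reset (B.π x)) ∉ H.surface) ∧ 0 < B.θ x ∧ B.θ x < t ∧ t - B.θ x < ε}
  have hA : A ∈ 𝓝 x₁ := by
    have hcθ : ContinuousAt B.θ x₁ := (B.hasTD_θ hrO).continuousAt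
    have hcπ : ContinuousAt B.π x₁ := (B.hasTD_π hrO).continuousAt
    refine Filter.Eventually.and (B.isOpen_O.mem_nhds hrO) (.and ?_ (.and ?_ (.and ?_ ?_)))
    · exact hcπ.eventually (by rw [hπ₁]; exact hq)
    · exact hcθ.eventually_const_lt (by rw [hθ₁]; exact hr0)
    · exact hcθ.eventually_lt_const (by rw [hθ₁]; simp only [t]; linarith)
    · refine (continuousAt_const.sub hcθ).eventually_lt_const ?_
      change t - B.θ (fl H.field (-r) (H.emb q)) < ε
      rw [hθ₁]
      simp only [t]
      linarith
  have hfD : ∀ x ∈ A, (t - B.θ x, H.reset (B.π x)) ∈ flowDomain H.field ∧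
      f x ∉ H.surface := by
    rintro x ⟨-, h2, h3, h4, h5⟩
    exact h2 _ ⟨by linarith, h5⟩
  have hfsm : ∀ x ∈ A, ContMDiffAt 𝓘(ℝ, E) 𝓘(ℝ, E) ∞ f x := by
    intro x hx
    have h1 : ContMDiffAt 𝓘(ℝ, E) 𝓘(ℝ, ℝ) ∞ (fun x => t - B.θ x) x :=
      contMDiffAt_const.sub (B.contMDiffOn_θ.contMDiffAt (B.isOpen_O.mem_nhds hx.1))
    have h2 : ContMDiffAt 𝓘(ℝ, E) 𝓘(ℝ, E) ∞ (fun x => H.reset (B.π x)) x :=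
      ContMDiffAt.comp x H.contMDiff_reset.contMDiffAt
        (B.contMDiffOn_π.contMDiffAt (B.isOpen_O.mem_nhds hx.1))
    exact ContMDiffAt.comp (f := fun x => (t - B.θ x, H.reset (B.π x))) x
      (contMDiffAt_fl hX (hfD x hx).1) (h1.prodMk h2)
  have hx₁A : x₁ ∈ A := mem_of_mem_nhds hA
  have hpull : ∀ w : Fin m → E, frm α (f x₁) (fun i => tderiv 𝓘(ℝ, E) 𝓘(ℝ, E) f x₁ (w i)) =
      frm α x₁ w := by
    intro w
    refine hI t (by simp only [t]; linarith) (interior A) f isOpen_interior ?_ ?_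
      (fun x hx => (hfsm x (interior_subset hx)).contMDiffWithinAt) x₁
      (mem_interior_iff_mem_nhds.2 hA) (hfD x₁ hx₁A).2 w
    · refine disjoint_left.2 fun x hx hxS => ?_
      obtain ⟨p, rfl⟩ := hxS
      obtain ⟨h1, -, h3, -⟩ := interior_subset hx
      rw [B.θ_emb h1] at h3
      exact h3.false
    · intro x hx
      obtain ⟨h1, h2, h3, h4, h5⟩ := interior_subset hx
      have hθδ := B.abs_θ_lt x h1
      have hflow : H.Flow (t - B.θ x) (H.reset (B.π x)) (f x) :=
        flow_fl (by linarith) (h2 _ ⟨by linarith, h5⟩).1 fun s hs =>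
          (h2 s ⟨hs.1, hs.2.trans h5⟩).2
      have := flow_impact h3.le (B.mem_flowDomain x h1 _ hθδ) (fun s hs hS => ?_) (B.fl_θ x h1)
        (by linarith) hflow
      · rwa [add_sub_cancel] at this
      · rw [abs_of_pos h3] at hθδ
        exact hs.2.ne (B.eq_θ x h1 s (by rw [abs_of_nonneg hs.1]; exact hs.2.trans hθδ) hS)
  -- the derivative of `f` along the backward motion
  have hfst : HasTD (𝓘(ℝ, F).prod 𝓘(ℝ, ℝ)) 𝓘(ℝ, F) (fun z : S × ℝ => z.1) (q, 0)
      (ContinuousLinearMap.fst ℝ F ℝ) := hasMFDerivAt_fst _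
  have hsnd : HasTD (𝓘(ℝ, F).prod 𝓘(ℝ, ℝ)) 𝓘(ℝ, ℝ) (fun z : S × ℝ => z.2) (q, 0)
      (ContinuousLinearMap.snd ℝ F ℝ) := hasMFDerivAt_snd _
  have htime : ∀ b : ℝ, HasTD (𝓘(ℝ, F).prod 𝓘(ℝ, ℝ)) 𝓘(ℝ, ℝ) (fun z : S × ℝ => b + z.2) (q, 0)
      (ContinuousLinearMap.snd ℝ F ℝ) := fun b =>
    HasTD.comp (hasTD_iff_hasFDerivAt.2 ((hasFDerivAt_id (0 : ℝ)).const_add b)) hsnd rfl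
  have hE : HasTD (𝓘(ℝ, F).prod 𝓘(ℝ, ℝ)) 𝓘(ℝ, E) (fun z : S × ℝ => H.emb z.1) (q, 0) _ :=
    (hasTD_of_contMDiffAt hemb.contMDiffAt (by simp)).comp hfst rfl
  have hR : HasTD (𝓘(ℝ, F).prod 𝓘(ℝ, ℝ)) 𝓘(ℝ, E) (fun z : S × ℝ => H.reset z.1) (q, 0) _ :=
    (hasTD_of_contMDiffAt H.contMDiff_reset.contMDiffAt (by simp)).comp hfst rfl
  have hrD' : (-r + (0 : ℝ), H.emb q) ∈ flowDomain H.field := by rwa [add_zero]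
  have hRD : (t - r + (0 : ℝ), H.reset q) ∈ flowDomain H.field := by
    have h := (hfD x₁ hx₁A).1
    rw [add_zero]
    rwa [hθ₁, hπ₁] at h
  have dk := HasTD.fl_comp hX (htime (-r)) hE hrD'
  have dF := HasTD.fl_comp hX (htime (t - r)) hR hRD
  have hk0 : fl H.field (-r + ((q, (0 : ℝ)) : S × ℝ).2) (H.emb ((q, (0 : ℝ)) : S × ℝ).1) = x₁ := by
    change fl H.field (-r + 0) (H.emb q) = _
    rw [add_zero]
  have dfk := (hasTD_of_contMDiffAt (hfsm x₁ hx₁A) (by simp)).comp dk hk0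
  -- Starting later along the trajectory by `z.2` ends later by `z.2`. Differentiating this identity
  -- at `(q, 0)` in the direction `(u, a)` shows that `f_*` matches `emb_* u + a X` with `reset_* u
  -- + a X`, each transported by the flow.
  have hcomp : (fun z : S × ℝ => fl H.field (t - r + z.2) (H.reset z.1)) =ᶠ[𝓝 (q, 0)]
      fun z => f (fl H.field (-r + z.2) (H.emb z.1)) := by
    have hc1 : ContinuousAt (fun z : S × ℝ => (-r + z.2, H.emb z.1)) (q, 0) := by
      have := hemb.continuous
      fun_prop
    have hc2 := dk.continuousAt
    have hc3 : ContinuousAt (fun z : S × ℝ => |r - z.2|) (q, 0) := by fun_prop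
    filter_upwards [hc1.eventually_mem ((isOpen_flowDomain hX).mem_nhds hrD'),
      hc2.eventually_mem (B.isOpen_O.mem_nhds (by rw [hk0]; exact hrO)),
      hc3.eventually_lt_const (by simpa using hrδ)] with z hz1 hz2 hz3
    have hz : -r + z.2 = -(r - z.2) := by ring
    rw [hz] at hz1 hz2 ⊢
    obtain ⟨e1, e2⟩ := hk z.1 (r - z.2) hz3 hz1 hz2
    change _ = fl H.field (t - B.θ _) (H.reset (B.π _))
    rw [e1, e2]
    congr 1
    ring
  have hder := fun i => DFunLike.congr_fun (dF.unique (dfk.congr hcomp)) (u i, a i)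
  have hfx₁ : f x₁ = fl H.field (t - r) (H.reset q) := by
    change fl H.field (t - B.θ x₁) (H.reset (B.π x₁)) = _
    rw [hθ₁, hπ₁]
  rw [add_zero] at hRD
  have e1 := frm_fl_eq hX hα hL hRD (fun i => tderiv 𝓘(ℝ, F) 𝓘(ℝ, E) H.reset q (u i) +
        a i • vec H.field (H.reset q))
  have e2 := frm_fl_eq hX hα hL hrD (fun i => tderiv 𝓘(ℝ, F) 𝓘(ℝ, E) H.emb q (u i) +
        a i • vec H.field (H.emb q))
  rw [← e1, ← e2]
  refine Eq.trans ?_ (hpull _)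
  rw [← hfx₁]
  congr 1
  funext i
  have hi := hder i
  simp only [_root_.add_apply, ContinuousLinearMap.smulRight_apply,
    ContinuousLinearMap.comp_apply, ContinuousLinearMap.coe_fst', ContinuousLinearMap.coe_snd',
    add_zero] at hi
  rw [map_add, map_smul, dfl_field hX hRD, map_add (dfl H.field (-r) (H.emb q)),
    map_smul (dfl H.field (-r) (H.emb q)), dfl_field hX hrD, add_comm]
  refine hi.trans ?_
  rw [add_comm]

/-- The equality holds at a dense set of impact points, and extends by continuity along tangent
vectors that are constant in a chart of `S`. -/
theorem frm_reset_eq_of_isInvariant [BaireSpace S] (hH : H.IsSmooth) (hα : α.IsSmooth)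
    (hI : H.IsInvariant α) (p : S) (u : Fin m → F) (a : Fin m → ℝ) :
    frm α (H.reset p) (fun i => tderiv 𝓘(ℝ, F) 𝓘(ℝ, E) H.reset p (u i) +
        a i • vec H.field (H.reset p)) =
      frm α (H.emb p) (fun i => tderiv 𝓘(ℝ, F) 𝓘(ℝ, E) H.emb p (u i) +
        a i • vec H.field (H.emb p)) := by
  have hcont : ∀ g : S → M, ContMDiff 𝓘(ℝ, F) 𝓘(ℝ, E) ∞ g → ContinuousAt (fun q =>
      frm α (g q) (fun i => tderiv 𝓘(ℝ, F) 𝓘(ℝ, E) g q (chartConst p (u i) q) +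
        a i • vec H.field (g q))) p := by
    intro g hg
    refine continuousAt_frm hα hg.continuous.continuousAt fun i => ?_
    simp only [map_add, map_smul]
    exact (continuousAt_tderiv_chart_tderiv hg.contMDiffAt (u i)).add
      ((continuousAt_tderiv_chart_vec H.smoothField hg.continuous.continuousAt).const_smul (a i))
  have hfreq : ∃ᶠ q in 𝓝 p, frm α (H.reset q)
      (fun i => tderiv 𝓘(ℝ, F) 𝓘(ℝ, E) H.reset q (chartConst p (u i) q) +
        a i • vec H.field (H.reset q)) =
      frm α (H.emb q) (fun i => tderiv 𝓘(ℝ, F) 𝓘(ℝ, E) H.emb q (chartConst p (u i) q) +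
        a i • vec H.field (H.emb q)) := by
    rw [frequently_nhds_iff]
    intro W hpW hW
    obtain ⟨q, hqW, ε, hε, hq⟩ := hH.exists_uniform_avoid hW ⟨p, hpW⟩
    exact ⟨q, hqW, frm_reset_eq_of_uniform_avoid hH hα hI hε hq _ _⟩
  have h := tendsto_nhds_unique_of_frequently_eq (hcont H.reset H.contMDiff_reset).tendsto
    (hcont H.emb H.isSmoothEmbedding_emb.contMDiff).tendsto hfreq
  simpa only [chartConst_self] using h

end Necessity

end Hybrid

end

theorem mainTheorem2
    {E : Type*} [NormedAddCommGroup E] [NormedSpace ℝ E] [FiniteDimensional ℝ E]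
    {M : Type*} [TopologicalSpace M] [T2Space M] [SecondCountableTopology M]
    [ChartedSpace E M] [IsManifold 𝓘(ℝ, E) ∞ M]
    {F : Type*} [NormedAddCommGroup F] [NormedSpace ℝ F] [FiniteDimensional ℝ F]
    {S : Type*} [TopologicalSpace S] [ChartedSpace F S] [IsManifold 𝓘(ℝ, F) ∞ S]
    (H : Hybrid.HybridSystem E M F S) (hH : H.IsSmooth)
    {m : ℕ} (α : Hybrid.Form E M m) (hα : α.IsSmooth) :
    H.IsInvariant α ↔
      (∀ (x : M) (v : Fin m → TangentSpace 𝓘(ℝ, E) x), Hybrid.lieDeriv H.field α x v = 0) ∧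
      (∀ (p : S) (v : Fin m → TangentSpace 𝓘(ℝ, E) (H.emb p)),
        α (H.reset p) (fun i => hH.augmentedDifferential p (v i)) = α (H.emb p) v) := by
  -- Both manifolds are locally compact, and `S` inherits the Hausdorff property through its
  -- embedding; this makes them Baire spaces.
  have := ChartedSpace.locallyCompactSpace E M
  have := ChartedSpace.locallyCompactSpace F S
  have := H.isSmoothEmbedding_emb.isEmbedding.t2Space
  refine ⟨fun hI => ⟨Hybrid.lieDeriv_eq_zero_of_isInvariant hH hα hI, fun p => ?_⟩,
    fun h => Hybrid.isInvariant_of_lieDeriv_eq_zero hH hα h.1 h.2⟩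
  exact (hH.frm_reset_iff p).2 (Hybrid.frm_reset_eq_of_isInvariant hH hα hI p)
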